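/- **Notation.** Let $d\ge 0$ be an integer. For a nonzero window $g\in\mathcal S(\mathbb R^n)$ and $f\in\mathcal S'(\mathbb R^n)$ let $V_gf(x,\omega)=\langle f, M_\omega T_x g\rangle$ be the short-time Fourier transform, where $M_\omega T_xg(t)=e^{2\pi i\omega\cdot t}g(t-x)$ and $\langle\cdot,\cdot\rangle$ is conjugate-linear in the second argument. For $1\le p,q<\infty$ and positive weights $m$ on $\mathbb R^{2n}$, $w$ on $\mathbb R^n$ put $$\|f\|_{M^{p,q}_m}=\Big(\int_{\mathbb R^n}\Big(\int_{\mathbb R^n}|V_gf(x,\omega)|^p m(x,\omega)^p\,dx\Big)^{q/p}d\omega\Big)^{1/q},$$ $$\|f\|_{W(\mathcal FL^p,L^q_w)}=\Big(\int_{\mathbb R^n}\Big(\int_{\mathbb R^n}|V_gf(x,\omega)|^p\,d\omega\Big)^{q/p}w(x)^q\,dx\Big)^{1/q},$$ and let $M^{p,q}_m(\mathbb R^n)$ and $W(\mathcal FL^p,L^q_w)(\mathbb R^n)$ be the spaces of all $f\in\mathcal S'(\mathbb R^n)$ for which the respective norm is finite. Let $v_s(z)=(1+|z|^2)^{s/2}$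 for $s\in\mathbb R$ and $z\in\mathbb R^{2d}$, and $(1\otimes v_s)(z,\zeta)=v_s(\zeta)$ for $z,\zeta\in\mathbb R^{2d}$. For $A\in\mathrm{GL}(2d,\mathbb R)$ and $f,g\in\mathcal S'(\mathbb R^d)$ the matrix-Wigner distribution is $\mathcal B_A(f,g)=\mathcal F_2\mathfrak T_A(f\otimes\overline g)\in\mathcal S'(\mathbb R^{2d})$, where $\mathfrak T_AF(z)=F(Az)$ and $\mathcal F_2$ is the partial Fourier transform (with kernel $e^{-2\pi i\omega\cdot y}$) in the second group of $d$ variables. For $M\in\mathbb R^{d\times d}$ the associated Cohen-type matrix is $$A_M=\begin{pmatrix} I & M+\tfrac12 I\\ I & M-\tfrac12 I\end{pmatrix}\in\mathrm{GL}(2d,\mathbb R),$$ so that, formally, $\mathcal B_{A_M}(f,g)(x,\omega)=\int_{\mathbb R^d}e^{-2\pi i\omega\cdot y}f\big(x+(M+\tfrac12I)y\big)\overline{g\big(x+(M-\tfrac12I)y\big)}\,dy$. Put $$P_M=\begin{pmatrix}-(M+\tfrac12 I)&0\\0&M-\tfrac12 I\end{pmatrix},\qquad C_M=\left|\det\left(M+\tfrac12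 I\right)\det\left(M-\tfrac12 I\right)\right|.$$ A $2\times2$ block matrix with $d\times d$ blocks is called right-regular if both blocks of its second column are invertible. **Theorem.** Let $M\in\mathbb R^{d\times d}$, $A=A_M$, $s\in\mathbb R$, and let $1\le p_1,p_2,q_1,q_2,p,q<\infty$ satisfy $$p_i,q_i\le q\ (i=1,2),\qquad \frac1{p_1}+\frac1{p_2}\ge\frac1p+\frac1q,\qquad \frac1{q_1}+\frac1{q_2}\ge\frac1p+\frac1q .$$ Fix nonzero Schwartz windows $g_1,g_2$ on $\mathbb R^d$ (used for the norms of $f_1$, $f_2$ respectively) and $\Phi$ on $\mathbb R^{2d}$ (used for the norms of $\mathcal B_A(f_1,f_2)$). Below, $C$ denotes a finite constant that depends only on $d$, $M$, $s$, the exponents and the windows, and not on $f_1,f_2$. (i) There is such a $C$ that, for all $f_1\in M^{p_1,q_1}_{v_{|s|}}(\mathbb R^d)$ and $f_2\in M^{p_2,q_2}_{v_s}(\mathbb R^d)$, one has $\mathcal B_A(f_1,f_2)\in M^{p,q}_{1\otimes v_s}(\mathbb R^{2d})$ and $$\|\mathcal B_A(f_1,f_2)\|_{M^{p,q}_{1\otimes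 v_s}}\le C\,\|f_1\|_{M^{p_1,q_1}_{v_{|s|}}}\|f_2\|_{M^{p_2,q_2}_{v_s}} .$$ (ii) The matrices $M-\tfrac12I$ and $M+\tfrac12I$ are both invertible if and only if $A_M$ is right-regular, and if and only if $P_M$ is invertible. Suppose they are. Then $I+P_M^{-1}$ is invertible and $C_M>0$; put $v_s^M=v_s\circ(I+P_M^{-1})^{-1}$. There is such a $C$ that, for all $f_1\in M^{p_1,q_1}_{v_{|s|}}(\mathbb R^d)$ and $f_2\in M^{p_2,q_2}_{v_s^M}(\mathbb R^d)$, one has $\mathcal B_A(f_1,f_2)\in W(\mathcal FL^p,L^q_{v_s^M})(\mathbb R^{2d})$ and $$\|\mathcal B_A(f_1,f_2)\|_{W(\mathcal FL^p,L^q_{v_s^M})}\le C\,(C_M)^{1/q-1/p}\,\|f_1\|_{M^{p_1,q_1}_{v_{|s|}}}\|f_2\|_{M^{p_2,q_2}_{v_s^M}} .$$ -/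

import Mathlib

open scoped SchwartzMap FourierTransform LineDeriv ENNReal NNReal
open MeasureTheory
namespace MWD
noncomputable section

section Abstract

variable {V : Type*} [NormedAddCommGroup V] [NormedSpace ℝ V] {κ : Type*} [Fintype κ]

/-- Continuous seminorms on the Schwartz space that dominate a family of operators can be
summed. -/
theorem exists_seminorm_sum {α : Type*} {N : κ → 𝓢(V, ℂ) → α → ℝ}
    (h : ∀ i, ∃ q : Seminorm ℂ 𝓢(V, ℂ), Continuous q ∧ ∀ Φ a, N i Φ a ≤ q Φ) :
    ∃ q : Seminorm ℂ 𝓢(V, ℂ), Continuous q ∧ ∀ Φ a, ∑ i, N i Φ a ≤ q Φ := by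
  choose q hq hN using h
  refine ⟨∑ i, q i, ?_, fun Φ a => ?_⟩
  · exact Seminorm.continuous_finsetSum fun i _ => hq i
  · have : (∑ i, q i) Φ = ∑ i, q i Φ := by
      change FunLike.coeAddMonoidHom _ _ _ (∑ i, q i) Φ = _
      simp_rw [map_sum, Finset.sum_apply]; rfl
    rw [this]
    exact Finset.sum_le_sum fun i _ => hN i Φ a

variable (U : 𝓢(V, ℂ) →ₗ[ℂ] (EuclideanSpace ℝ κ → ℂ)) (D Q : κ → 𝓢(V, ℂ) →L[ℂ] 𝓢(V, ℂ))

theorem exists_bound_pow (hQ : ∀ i Φ x, (x i : ℂ) * U Φ x = U (Q i Φ) x)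
    (h0 : ∃ q : Seminorm ℂ 𝓢(V, ℂ), Continuous q ∧ ∀ Φ x, ‖U Φ x‖ ≤ q Φ) (k : ℕ) :
    ∃ q : Seminorm ℂ 𝓢(V, ℂ), Continuous q ∧ ∀ Φ x, ‖x‖ ^ k * ‖U Φ x‖ ≤ q Φ := by
  induction k with
  | zero => simpa using h0
  | succ k ih =>
    obtain ⟨q, hq, h⟩ := ih
    obtain ⟨q', hq', h'⟩ := exists_seminorm_sum
      (N := fun i Φ x => ‖x‖ ^ k * ‖U (Q i Φ) x‖) (κ := κ)
      fun i => ⟨q.comp (Q i).toLinearMap, hq.comp (Q i).continuous, fun Φ x => h (Q i Φ) x⟩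
    refine ⟨q', hq', fun Φ x => le_trans ?_ (h' Φ x)⟩
    have hx : ‖x‖ ≤ ∑ i, ‖x i‖ := by
      conv_lhs => rw [← (EuclideanSpace.basisFun κ ℝ).sum_repr x]
      refine (norm_sum_le _ _).trans (Finset.sum_le_sum fun i _ => ?_)
      rw [norm_smul, (EuclideanSpace.basisFun κ ℝ).norm_eq_one]; simp
    calc ‖x‖ ^ (k + 1) * ‖U Φ x‖ = ‖x‖ * (‖x‖ ^ k * ‖U Φ x‖) := by ring
      _ ≤ (∑ i, ‖x i‖) * (‖x‖ ^ k * ‖U Φ x‖) := by gcongr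
      _ = ∑ i, ‖x‖ ^ k * ‖U (Q i Φ) x‖ := by
        rw [Finset.sum_mul]
        refine Finset.sum_congr rfl fun i _ => ?_
        rw [← hQ, norm_mul, Complex.norm_real]; ring

theorem fderiv_operator
    (hD : ∀ Φ x, HasFDerivAt (U Φ)
      (∑ i, (EuclideanSpace.proj i : EuclideanSpace ℝ κ →L[ℝ] ℝ).smulRight (U (D i Φ) x)) x)
    (Φ : 𝓢(V, ℂ)) :
    fderiv ℝ (U Φ) = fun x => ∑ i, (ContinuousLinearMap.smulRightL ℝ (EuclideanSpace ℝ κ) ℂ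
      (EuclideanSpace.proj i) ∘ U (D i Φ)) x := by
  ext1 x
  rw [(hD Φ x).fderiv]; rfl

theorem contDiff_operator
    (hD : ∀ Φ x, HasFDerivAt (U Φ)
      (∑ i, (EuclideanSpace.proj i : EuclideanSpace ℝ κ →L[ℝ] ℝ).smulRight (U (D i Φ) x)) x)
    (Φ : 𝓢(V, ℂ)) (n : ℕ) : ContDiff ℝ n (U Φ) := by
  induction n generalizing Φ with
  | zero =>
    exact contDiff_zero.2 (continuous_iff_continuousAt.2 fun x => (hD Φ x).continuousAt)
  | succ n ih =>
    rw [show ((n + 1 : ℕ) : WithTop ℕ∞) = (n : WithTop ℕ∞) + 1 by push_cast; rfl,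
      contDiff_succ_iff_fderiv]
    refine ⟨fun x => (hD Φ x).differentiableAt, by simp, ?_⟩
    rw [fderiv_operator U D hD]
    exact ContDiff.sum fun i _ => (ContinuousLinearMap.contDiff _).comp (ih _)

set_option synthInstance.maxHeartbeats 200000 in
theorem exists_bound_iteratedFDeriv
    (hD : ∀ Φ x, HasFDerivAt (U Φ)
      (∑ i, (EuclideanSpace.proj i : EuclideanSpace ℝ κ →L[ℝ] ℝ).smulRight (U (D i Φ) x)) x)
    (hQ : ∀ i Φ x, (x i : ℂ) * U Φ x = U (Q i Φ) x)
    (h0 : ∃ q : Seminorm ℂ 𝓢(V, ℂ), Continuous q ∧ ∀ Φ x, ‖U Φ x‖ ≤ q Φ) (k n : ℕ) :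
    ∃ q : Seminorm ℂ 𝓢(V, ℂ), Continuous q ∧
      ∀ Φ x, ‖x‖ ^ k * ‖iteratedFDeriv ℝ n (U Φ) x‖ ≤ q Φ := by
  induction n with
  | zero => simpa using exists_bound_pow U Q hQ h0 k
  | succ n ih =>
    obtain ⟨q, hq, h⟩ := ih
    let R : κ → (ℂ →L[ℝ] (EuclideanSpace ℝ κ →L[ℝ] ℂ)) := fun i =>
      ContinuousLinearMap.smulRightL ℝ (EuclideanSpace ℝ κ) ℂ (EuclideanSpace.proj i)
    obtain ⟨q', hq', h'⟩ := exists_seminorm_sum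
      (N := fun i Φ x => ‖R i‖ * (‖x‖ ^ k * ‖iteratedFDeriv ℝ n (U (D i Φ)) x‖)) (κ := κ)
      fun i => ⟨‖R i‖₊ • q.comp (D i).toLinearMap,
        continuous_const.mul (hq.comp (D i).continuous), fun Φ x =>
          mul_le_mul_of_nonneg_left (h (D i Φ) x) (norm_nonneg (R i))⟩
    refine ⟨q', hq', fun Φ x => le_trans ?_ (h' Φ x)⟩
    have hc : ∀ i, ContDiff ℝ n (R i ∘ U (D i Φ)) := fun i =>
      (R i).contDiff.comp (contDiff_operator U D hD _ n)
    rw [← norm_iteratedFDeriv_fderiv, fderiv_operator U D hD, iteratedFDeriv_sum fun i _ => hc i,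
      Finset.sum_apply]
    calc _ ≤ ‖x‖ ^ k * ∑ i, ‖R i‖ * ‖iteratedFDeriv ℝ n (U (D i Φ)) x‖ := by
          gcongr
          refine (norm_sum_le _ _).trans (Finset.sum_le_sum fun i _ => ?_)
          exact (R i).norm_iteratedFDeriv_comp_left
            (contDiff_operator U D hD _ n).contDiffAt le_rfl
      _ = _ := by
          rw [Finset.mul_sum]
          exact Finset.sum_congr rfl fun i _ => by ring

/-- A linear map from Schwartz functions to functions that intertwines partial derivatives and
multiplication by coordinates with continuous operators, and is bounded in sup norm by a continuous
seminorm, is a continuous linear map between Schwartz spaces. -/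
def operatorCLM
    (hD : ∀ Φ x, HasFDerivAt (U Φ)
      (∑ i, (EuclideanSpace.proj i : EuclideanSpace ℝ κ →L[ℝ] ℝ).smulRight (U (D i Φ) x)) x)
    (hQ : ∀ i Φ x, (x i : ℂ) * U Φ x = U (Q i Φ) x)
    (h0 : ∃ q : Seminorm ℂ 𝓢(V, ℂ), Continuous q ∧ ∀ Φ x, ‖U Φ x‖ ≤ q Φ) :
    𝓢(V, ℂ) →L[ℂ] 𝓢(EuclideanSpace ℝ κ, ℂ) :=
  SchwartzMap.mkCLM (fun Φ => U Φ) (fun Φ Ψ x => by simp) (fun a Φ x => by simp)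
    (fun Φ => contDiff_infty.2 (contDiff_operator U D hD Φ))
    (fun n => by
      obtain ⟨q, hq, h⟩ := exists_bound_iteratedFDeriv U D Q hD hQ h0 n.1 n.2
      obtain ⟨t, C, -, h'⟩ := Seminorm.bound_of_continuous (schwartz_withSeminorms ℂ V ℂ) q hq
      exact ⟨t, C, C.2, fun Φ x => (h Φ x).trans (h' Φ)⟩)

end Abstract

section Translation

variable {V : Type*} [NormedAddCommGroup V] [NormedSpace ℝ V]

theorem lineDerivOp_comm (Φ : 𝓢(V, ℂ)) (v w : V) :
    (∂_{v} (∂_{w} Φ) : 𝓢(V, ℂ)) = ∂_{w} (∂_{v} Φ) := by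
  ext x
  have hd : DifferentiableAt ℝ (fderiv ℝ Φ) x :=
    ((Φ.smooth 2).fderiv_right (m := 1) (by norm_num)).differentiable (by norm_num) x
  have key : ∀ a b : V, (∂_{a} (∂_{b} Φ) : 𝓢(V, ℂ)) x = fderiv ℝ (fderiv ℝ Φ) x a b :=
    fun a b => by
    rw [SchwartzMap.lineDerivOp_apply_eq_fderiv,
      show ⇑(∂_{b} Φ : 𝓢(V, ℂ)) = fun y => fderiv ℝ Φ y b from
        funext fun y => SchwartzMap.lineDerivOp_apply_eq_fderiv b Φ y]
    rw [fderiv_clm_apply hd (by fun_prop)]; simp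
  rw [key, key]
  exact (((Φ.smooth 2).contDiffAt (x := x)).isSymmSndFDerivAt (by simp)).eq v w

theorem iteratedLineDerivOp_lineDerivOp_comm (Φ : 𝓢(V, ℂ)) (h : V) {n : ℕ} (m : Fin n → V) :
    (∂^{m} (∂_{h} Φ) : 𝓢(V, ℂ)) = ∂_{h} (∂^{m} Φ) := by
  induction n with
  | zero => simp
  | succ n ih =>
    rw [LineDeriv.iteratedLineDerivOp_succ_left, LineDeriv.iteratedLineDerivOp_succ_left, ih,
      lineDerivOp_comm]

theorem iteratedFDeriv_lineDerivOp (Φ : 𝓢(V, ℂ)) (h : V) (n : ℕ) (z : V) :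
    iteratedFDeriv ℝ n (∂_{h} Φ : 𝓢(V, ℂ)) z = fderiv ℝ (iteratedFDeriv ℝ n Φ) z h := by
  ext m
  have h1 := iteratedFDeriv_succ_apply_left (𝕜 := ℝ) (f := Φ) (x := z) (Fin.cons h m : Fin (n + 1) → V)
  rw [Fin.tail_cons, Fin.cons_zero] at h1
  rw [← SchwartzMap.iteratedLineDerivOp_eq_iteratedFDeriv, iteratedLineDerivOp_lineDerivOp_comm,
    ← h1, ← SchwartzMap.iteratedLineDerivOp_eq_iteratedFDeriv,
    LineDeriv.iteratedLineDerivOp_succ_left]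
  simp

/-- Second order remainder of a translation, in a Schwartz seminorm. -/
theorem exists_seminorm_translation_le (Φ : 𝓢(V, ℂ)) (k l : ℕ) :
    ∃ C : ℝ, 0 ≤ C ∧ ∀ h : V, ‖h‖ ≤ 1 →
      SchwartzMap.seminorm ℂ k l (Φ.compSubConstCLM ℂ (-h) - Φ - ∂_{h} Φ) ≤ C * ‖h‖ ^ 2 := by
  let q := (Finset.Iic (k, l + 2)).sup (fun m : ℕ × ℕ => SchwartzMap.seminorm ℂ m.1 m.2 (E := V) (F := ℂ))
  refine ⟨2 ^ k * (2 ^ k * q Φ), by positivity, fun h hh => ?_⟩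
  refine SchwartzMap.seminorm_le_bound ℂ k l _ (by positivity) fun z => ?_
  have hG : ∀ n : ℕ, Differentiable ℝ (iteratedFDeriv ℝ n Φ) := fun n =>
    (Φ.smooth ⊤).differentiable_iteratedFDeriv (by exact_mod_cast WithTop.coe_lt_top _)
  -- the segment from `z` to `z + h`
  have hseg : ∀ w ∈ segment ℝ z (z + h), 1 + ‖z‖ ≤ 2 * (1 + ‖w‖) ∧ ‖w - z‖ ≤ ‖h‖ := by
    intro w hw
    obtain ⟨t, ht, rfl⟩ := (segment_eq_image' ℝ z (z + h)) ▸ hw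
    have h1 : ‖t • h‖ ≤ ‖h‖ := by
      rw [norm_smul, Real.norm_of_nonneg ht.1]
      exact mul_le_of_le_one_left (norm_nonneg _) ht.2
    have h2 : ‖z‖ ≤ ‖z + t • h‖ + ‖t • h‖ := by
      simpa using norm_sub_le (z + t • h) (t • h)
    simp only [add_sub_cancel_left]
    exact ⟨by linarith [norm_nonneg (z + t • h)], h1⟩
  have hB : ∀ w ∈ segment ℝ z (z + h),
      ‖iteratedFDeriv ℝ (l + 2) Φ w‖ ≤ 2 ^ k * (2 ^ k * q Φ) / (1 + ‖z‖) ^ k := by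
    intro w hw
    have h1 := SchwartzMap.one_add_le_sup_seminorm_apply (𝕜 := ℂ) (m := (k, l + 2)) (k := k)
      (n := l + 2) le_rfl le_rfl Φ w
    rw [le_div_iff₀ (by positivity)]
    calc _ ≤ ‖iteratedFDeriv ℝ (l + 2) Φ w‖ * (2 * (1 + ‖w‖)) ^ k := by
          gcongr; exact (hseg w hw).1
      _ = 2 ^ k * ((1 + ‖w‖) ^ k * ‖iteratedFDeriv ℝ (l + 2) Φ w‖) := by rw [mul_pow]; ring
      _ ≤ _ := by gcongr
  set B := 2 ^ k * (2 ^ k * q Φ) / (1 + ‖z‖) ^ k with hBdef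
  have hB0 : 0 ≤ B := by positivity
  have hz : z ∈ segment ℝ z (z + h) := left_mem_segment ..
  have hzh : z + h ∈ segment ℝ z (z + h) := right_mem_segment ..
  have h1 : ∀ w ∈ segment ℝ z (z + h),
      ‖fderiv ℝ (iteratedFDeriv ℝ l Φ) w - fderiv ℝ (iteratedFDeriv ℝ l Φ) z‖ ≤ B * ‖h‖ := by
    intro w hw
    have e := (continuousMultilinearCurryLeftEquiv ℝ (fun _ : Fin (l + 1) => V) ℂ).dist_map
      (iteratedFDeriv ℝ (l + 1) Φ w) (iteratedFDeriv ℝ (l + 1) Φ z)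
    rw [fderiv_iteratedFDeriv]
    refine le_trans (le_of_eq ((dist_eq_norm _ _).symm.trans (e.trans (dist_eq_norm _ _)))) ?_
    refine ((convex_segment z (z + h)).norm_image_sub_le_of_norm_fderiv_le (𝕜 := ℝ)
      (fun x _ => hG (l + 1) x) (fun x hx => ?_) hz hw).trans
      (mul_le_mul_of_nonneg_left (hseg w hw).2 hB0)
    rw [norm_fderiv_iteratedFDeriv]; exact hB x hx
  have h2 := (convex_segment z (z + h)).norm_image_sub_le_of_norm_fderiv_le' (𝕜 := ℝ)
      (fun x _ => hG l x) h1 hz hzh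
  rw [add_sub_cancel_left] at h2
  have h3 : iteratedFDeriv ℝ l (Φ.compSubConstCLM ℂ (-h) - Φ - ∂_{h} Φ : 𝓢(V, ℂ)) z =
      iteratedFDeriv ℝ l Φ (z + h) - iteratedFDeriv ℝ l Φ z
        - fderiv ℝ (iteratedFDeriv ℝ l Φ) z h := by
    rw [← iteratedFDeriv_lineDerivOp, ← iteratedFDeriv_comp_add_right]
    have e : ⇑(Φ.compSubConstCLM ℂ (-h) - Φ - ∂_{h} Φ : 𝓢(V, ℂ)) =
        (fun z => Φ (z + h)) - ⇑Φ - ⇑(∂_{h} Φ : 𝓢(V, ℂ)) := by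
      ext y; simp
    have c0 : ContDiff ℝ l (fun z => Φ (z + h)) := (Φ.smooth l).comp (by fun_prop)
    have c1 : ContDiff ℝ l ((fun z => Φ (z + h)) - ⇑Φ) := c0.sub (Φ.smooth l)
    rw [e, iteratedFDeriv_sub_apply c1.contDiffAt
      (SchwartzMap.smooth _ l).contDiffAt, iteratedFDeriv_sub_apply c0.contDiffAt
      (Φ.smooth l).contDiffAt]
  rw [h3]
  calc _ ≤ (1 + ‖z‖) ^ k * (B * ‖h‖ * ‖h‖) := by
        gcongr; linarith [norm_nonneg z]
    _ = _ := by rw [hBdef]; field_simp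

/-- A tempered distribution applied to translates of a Schwartz function is differentiable in the
translation parameter. -/
theorem hasFDerivAt_apply_translation (T : 𝓢(V, ℂ) →L[ℂ] ℂ) (Φ : 𝓢(V, ℂ)) (L : V →L[ℝ] ℂ)
    (hL : ∀ h, L h = T (∂_{h} Φ)) :
    HasFDerivAt (fun h => T (Φ.compSubConstCLM ℂ (-h))) L 0 := by
  obtain ⟨s, C, -, hC⟩ := Seminorm.bound_of_continuous (schwartz_withSeminorms ℂ V ℂ)
    ((normSeminorm ℂ ℂ).comp T.toLinearMap) (continuous_norm.comp T.continuous)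
  choose c hc0 hc using fun m : ℕ × ℕ => exists_seminorm_translation_le Φ m.1 m.2
  have hbd : ∀ h : V, ‖h‖ ≤ 1 →
      ‖T (Φ.compSubConstCLM ℂ (-h)) - T Φ - L h‖ ≤ C * (∑ m ∈ s, c m) * ‖h‖ ^ 2 := by
    intro h hh
    rw [hL, ← map_sub, ← map_sub]
    refine (hC _).trans ?_
    rw [mul_assoc]
    refine mul_le_mul_of_nonneg_left ?_ C.2
    refine Seminorm.finset_sup_apply_le (mul_nonneg (Finset.sum_nonneg fun m _ => hc0 m)
      (by positivity)) fun m hm => (hc m h hh).trans ?_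
    gcongr
    exact Finset.single_le_sum (f := c) (fun m _ => hc0 m) hm
  rw [hasFDerivAt_iff_isLittleO_nhds_zero]
  refine Asymptotics.IsBigO.trans_isLittleO (g := fun h : V => ‖h‖ ^ 2) ?_
    (Asymptotics.isLittleO_norm_pow_id one_lt_two)
  refine Asymptotics.IsBigO.of_bound (C * ∑ m ∈ s, c m) ?_
  filter_upwards [Metric.closedBall_mem_nhds (0 : V) one_pos] with h hh
  have := hbd h (by simpa using hh)
  simpa using this

end Translation

section Product

variable {ι κ : Type*}

/-- The point `(x, y)` of `ℝ^(ι ⊕ κ) = ℝ^ι × ℝ^κ`, with the Euclidean norm. -/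
def join (x : EuclideanSpace ℝ ι) (y : EuclideanSpace ℝ κ) : EuclideanSpace ℝ (ι ⊕ κ) :=
  WithLp.toLp 2 (Sum.elim x y)

@[simp] theorem join_inl (x : EuclideanSpace ℝ ι) (y : EuclideanSpace ℝ κ) (i : ι) :
    join x y (Sum.inl i) = x i := rfl

@[simp] theorem join_inr (x : EuclideanSpace ℝ ι) (y : EuclideanSpace ℝ κ) (i : κ) :
    join x y (Sum.inr i) = y i := rfl

variable [Fintype ι] [Fintype κ]

/-- The first component of a point of `ℝ^(ι ⊕ κ) = ℝ^ι × ℝ^κ`. -/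
def fstL : EuclideanSpace ℝ (ι ⊕ κ) →L[ℝ] EuclideanSpace ℝ ι :=
  LinearMap.toContinuousLinearMap
    { toFun := fun z => WithLp.toLp 2 fun i => z (Sum.inl i)
      map_add' := fun _ _ => by ext; simp
      map_smul' := fun _ _ => by ext; simp }

/-- The second component of a point of `ℝ^(ι ⊕ κ) = ℝ^ι × ℝ^κ`. -/
def sndL : EuclideanSpace ℝ (ι ⊕ κ) →L[ℝ] EuclideanSpace ℝ κ :=
  LinearMap.toContinuousLinearMap
    { toFun := fun z => WithLp.toLp 2 fun i => z (Sum.inr i)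
      map_add' := fun _ _ => by ext; simp
      map_smul' := fun _ _ => by ext; simp }

/-- The inclusion `x ↦ (x, 0)`. -/
def inlL : EuclideanSpace ℝ ι →L[ℝ] EuclideanSpace ℝ (ι ⊕ κ) :=
  LinearMap.toContinuousLinearMap
    { toFun := fun x => join x 0
      map_add' := fun _ _ => by ext i; cases i <;> simp [join]
      map_smul' := fun _ _ => by ext i; cases i <;> simp [join] }

/-- The inclusion `y ↦ (0, y)`. -/
def inrL : EuclideanSpace ℝ κ →L[ℝ] EuclideanSpace ℝ (ι ⊕ κ) :=
  LinearMap.toContinuousLinearMap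
    { toFun := fun y => join 0 y
      map_add' := fun _ _ => by ext i; cases i <;> simp [join]
      map_smul' := fun _ _ => by ext i; cases i <;> simp [join] }

@[simp] theorem fstL_apply (z : EuclideanSpace ℝ (ι ⊕ κ)) (i : ι) : fstL z i = z (Sum.inl i) := rfl

@[simp] theorem sndL_apply (z : EuclideanSpace ℝ (ι ⊕ κ)) (i : κ) : sndL z i = z (Sum.inr i) := rfl

theorem inlL_apply (x : EuclideanSpace ℝ ι) :
    (inlL x : EuclideanSpace ℝ (ι ⊕ κ)) = join x 0 := rfl

theorem inrL_apply (y : EuclideanSpace ℝ κ) :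
    (inrL y : EuclideanSpace ℝ (ι ⊕ κ)) = join 0 y := rfl

theorem join_eq (x : EuclideanSpace ℝ ι) (y : EuclideanSpace ℝ κ) :
    join x y = inrL y + inlL x := by
  ext i; cases i <;> simp [inlL_apply, inrL_apply]

theorem norm_join_sq (x : EuclideanSpace ℝ ι) (y : EuclideanSpace ℝ κ) :
    ‖join x y‖ ^ 2 = ‖x‖ ^ 2 + ‖y‖ ^ 2 := by
  simp [EuclideanSpace.norm_sq_eq]

theorem norm_snd_le (x : EuclideanSpace ℝ ι) (y : EuclideanSpace ℝ κ) : ‖y‖ ≤ ‖join x y‖ := by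
  refine le_of_sq_le_sq ?_ (norm_nonneg _)
  rw [norm_join_sq]; nlinarith [norm_nonneg x]

theorem norm_inrL_le : ‖(inrL : EuclideanSpace ℝ κ →L[ℝ] EuclideanSpace ℝ (ι ⊕ κ))‖ ≤ 1 :=
  ContinuousLinearMap.opNorm_le_bound _ zero_le_one fun y => by
    rw [one_mul]
    refine le_of_sq_le_sq ?_ (norm_nonneg _)
    rw [inrL_apply, norm_join_sq]; simp

/-- The section `Φ_x = Φ(x, ·)` of a Schwartz function. -/
def sectionCLM (x : EuclideanSpace ℝ ι) :
    𝓢(EuclideanSpace ℝ (ι ⊕ κ), ℂ) →L[ℂ] 𝓢(EuclideanSpace ℝ κ, ℂ) :=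
  SchwartzMap.compCLMOfAntilipschitz (K := 1) ℂ (g := fun y => join x y)
    (by simp_rw [join_eq]; fun_prop)
    (AntilipschitzWith.of_le_mul_dist fun y y' => by
      rw [NNReal.coe_one, one_mul, dist_eq_norm, dist_eq_norm]
      have : join x y - join x y' = join 0 (y - y') := by
        ext i; cases i <;> simp
      rw [this]
      exact norm_snd_le _ _)

@[simp] theorem sectionCLM_apply (x : EuclideanSpace ℝ ι) (Φ : 𝓢(EuclideanSpace ℝ (ι ⊕ κ), ℂ))
    (y : EuclideanSpace ℝ κ) : sectionCLM x Φ y = Φ (join x y) := rfl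

theorem seminorm_sectionCLM_le (x : EuclideanSpace ℝ ι) (Φ : 𝓢(EuclideanSpace ℝ (ι ⊕ κ), ℂ))
    (k l : ℕ) :
    SchwartzMap.seminorm ℂ k l (sectionCLM x Φ) ≤ SchwartzMap.seminorm ℂ k l Φ := by
  refine SchwartzMap.seminorm_le_bound ℂ k l _ (by positivity) fun y => ?_
  have e : ⇑(sectionCLM x Φ) = (fun z => Φ (z + inlL x)) ∘ ⇑(inrL (ι := ι) (κ := κ)) := by
    ext y; simp [join_eq]
  have c0 : ContDiff ℝ l (fun z => Φ (z + inlL x)) := (Φ.smooth l).comp (by fun_prop)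
  have hn : ‖iteratedFDeriv ℝ l (sectionCLM x Φ) y‖ ≤ ‖iteratedFDeriv ℝ l Φ (join x y)‖ := by
    rw [e, ContinuousLinearMap.iteratedFDeriv_comp_right _ c0 _ le_rfl,
      iteratedFDeriv_comp_add_right, ← join_eq]
    refine (ContinuousMultilinearMap.norm_compContinuousLinearMap_le _ _).trans ?_
    refine mul_le_of_le_one_right (norm_nonneg _) ?_
    exact Finset.prod_le_one (fun _ _ => norm_nonneg _) fun _ _ => norm_inrL_le
  calc _ ≤ ‖join x y‖ ^ k * ‖iteratedFDeriv ℝ l Φ (join x y)‖ := by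
        gcongr; exact norm_snd_le x y
    _ ≤ _ := SchwartzMap.le_seminorm ℂ k l Φ _

theorem exists_seminorm_section (p : Seminorm ℂ 𝓢(EuclideanSpace ℝ κ, ℂ)) (hp : Continuous p) :
    ∃ q : Seminorm ℂ 𝓢(EuclideanSpace ℝ (ι ⊕ κ), ℂ), Continuous q ∧
      ∀ Φ (x : EuclideanSpace ℝ ι), p (sectionCLM x Φ) ≤ q Φ := by
  obtain ⟨s, C, -, hC⟩ := Seminorm.bound_of_continuous
    (schwartz_withSeminorms ℂ (EuclideanSpace ℝ κ) ℂ) p hp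
  refine ⟨C • s.sup (schwartzSeminormFamily ℂ _ ℂ), ?_, fun Φ x => (hC _).trans ?_⟩
  · exact continuous_const.mul (Seminorm.continuous_finsetSup fun i _ =>
      (schwartz_withSeminorms ℂ (EuclideanSpace ℝ (ι ⊕ κ)) ℂ).continuous_seminorm i)
  · refine mul_le_mul_of_nonneg_left ?_ C.2
    refine Seminorm.finset_sup_apply_le (apply_nonneg _ _) fun m hm => ?_
    exact (seminorm_sectionCLM_le x Φ m.1 m.2).trans
      (Seminorm.le_finset_sup_apply (p := schwartzSeminormFamily ℂ _ ℂ) hm)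

theorem hasTemperateGrowth_coord (i : ι) :
    (fun z : EuclideanSpace ℝ ι => ((z i : ℝ) : ℂ)).HasTemperateGrowth :=
  (Complex.ofRealCLM.comp (EuclideanSpace.proj i : EuclideanSpace ℝ ι →L[ℝ] ℝ)).hasTemperateGrowth

/-- The function `x ↦ g(Φ(x, ·))`. -/
def sliceLM (g : 𝓢'(EuclideanSpace ℝ κ, ℂ)) :
    𝓢(EuclideanSpace ℝ (ι ⊕ κ), ℂ) →ₗ[ℂ] (EuclideanSpace ℝ ι → ℂ) where
  toFun Φ x := g (sectionCLM x Φ)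
  map_add' _ _ := by ext; simp
  map_smul' _ _ := by ext; simp

theorem hasFDerivAt_sliceLM (g : 𝓢'(EuclideanSpace ℝ κ, ℂ))
    (Φ : 𝓢(EuclideanSpace ℝ (ι ⊕ κ), ℂ)) (x : EuclideanSpace ℝ ι) :
    HasFDerivAt (sliceLM g Φ)
      (∑ i, (EuclideanSpace.proj i : EuclideanSpace ℝ ι →L[ℝ] ℝ).smulRight
        (sliceLM g (LineDeriv.lineDerivOpCLM ℂ 𝓢(EuclideanSpace ℝ (ι ⊕ κ), ℂ)
          (inlL (κ := κ) (EuclideanSpace.basisFun ι ℝ i)) Φ) x)) x := by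
  let T : 𝓢(EuclideanSpace ℝ (ι ⊕ κ), ℂ) →L[ℂ] ℂ :=
    ContinuousLinearMap.comp (g : 𝓢(EuclideanSpace ℝ κ, ℂ) →L[ℂ] ℂ) (sectionCLM x)
  have hTa : ∀ Ψ, T Ψ = g (sectionCLM x Ψ) := fun Ψ => rfl
  let L : EuclideanSpace ℝ (ι ⊕ κ) →L[ℝ] ℂ := LinearMap.toContinuousLinearMap
    { toFun := fun h => T (∂_{h} Φ)
      map_add' := fun a b => by rw [LineDeriv.lineDerivOp_left_add, map_add]
      map_smul' := fun c a => by
        rw [LineDeriv.lineDerivOp_left_smul]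
        exact map_real_smul T.toLinearMap.toAddMonoidHom T.continuous c _ }
  have h1 := hasFDerivAt_apply_translation T Φ L (fun h => rfl)
  have h2 : HasFDerivAt (fun x' => inlL (κ := κ) (x' - x)) inlL x := by
    simp_rw [map_sub]
    exact (inlL (κ := κ)).hasFDerivAt.sub_const _
  have h1' : HasFDerivAt (fun h => T (Φ.compSubConstCLM ℂ (-h))) L (inlL (κ := κ) (x - x)) := by
    simpa using h1
  have h3 := h1'.comp x h2
  have hfun : (fun h => T (Φ.compSubConstCLM ℂ (-h))) ∘ (fun x' => inlL (κ := κ) (x' - x)) =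
      sliceLM g Φ := by
    ext x'
    simp only [Function.comp_apply, hTa, sliceLM, LinearMap.coe_mk, AddHom.coe_mk]
    congr 1
    ext y
    simp only [sectionCLM_apply, SchwartzMap.compSubConstCLM_apply]
    congr 1
    ext i; cases i <;> simp [inlL_apply]
  rw [hfun] at h3
  refine h3.congr_fderiv (ContinuousLinearMap.ext fun v => ?_)
  have hv : v = ∑ i, v i • EuclideanSpace.basisFun ι ℝ i :=
    ((EuclideanSpace.basisFun ι ℝ).sum_repr v).symm
  conv_lhs => rw [hv]
  simp only [map_sum, map_smul, sum_apply]
  rfl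

theorem coord_mul_sliceLM (g : 𝓢'(EuclideanSpace ℝ κ, ℂ)) (i : ι)
    (Φ : 𝓢(EuclideanSpace ℝ (ι ⊕ κ), ℂ)) (x : EuclideanSpace ℝ ι) :
    (x i : ℂ) * sliceLM g Φ x = sliceLM g (SchwartzMap.smulLeftCLM ℂ
      (fun z : EuclideanSpace ℝ (ι ⊕ κ) => ((z (Sum.inl i) : ℝ) : ℂ)) Φ) x := by
  have : sectionCLM x (SchwartzMap.smulLeftCLM ℂ
      (fun z : EuclideanSpace ℝ (ι ⊕ κ) => ((z (Sum.inl i) : ℝ) : ℂ)) Φ) =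
      (x i : ℂ) • sectionCLM x Φ := by
    ext y
    simp [SchwartzMap.smulLeftCLM_apply_apply (hasTemperateGrowth_coord (Sum.inl i))]
  simp only [sliceLM, LinearMap.coe_mk, AddHom.coe_mk, this, map_smul, smul_eq_mul]

theorem exists_bound_sliceLM (g : 𝓢'(EuclideanSpace ℝ κ, ℂ)) :
    ∃ q : Seminorm ℂ 𝓢(EuclideanSpace ℝ (ι ⊕ κ), ℂ), Continuous q ∧
      ∀ Φ x, ‖sliceLM g Φ x‖ ≤ q Φ :=
  exists_seminorm_section
    ((normSeminorm ℂ ℂ).comp (g : 𝓢(EuclideanSpace ℝ κ, ℂ) →L[ℂ] ℂ).toLinearMap)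
    (continuous_norm.comp (g : 𝓢(EuclideanSpace ℝ κ, ℂ) →L[ℂ] ℂ).continuous)

/-- For a tempered distribution `g` and a Schwartz function `Φ` on a product, the Schwartz function
`x ↦ ⟨g, Φ(x, ·)⟩`. -/
def sliceCLM (g : 𝓢'(EuclideanSpace ℝ κ, ℂ)) :
    𝓢(EuclideanSpace ℝ (ι ⊕ κ), ℂ) →L[ℂ] 𝓢(EuclideanSpace ℝ ι, ℂ) :=
  operatorCLM (sliceLM g)
    (fun i => LineDeriv.lineDerivOpCLM ℂ 𝓢(EuclideanSpace ℝ (ι ⊕ κ), ℂ)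
      (inlL (κ := κ) (EuclideanSpace.basisFun ι ℝ i)))
    (fun i => SchwartzMap.smulLeftCLM ℂ fun z => ((z (Sum.inl i) : ℝ) : ℂ))
    (hasFDerivAt_sliceLM g) (coord_mul_sliceLM g) (exists_bound_sliceLM g)

theorem sliceCLM_apply (g : 𝓢'(EuclideanSpace ℝ κ, ℂ)) (Φ : 𝓢(EuclideanSpace ℝ (ι ⊕ κ), ℂ))
    (x : EuclideanSpace ℝ ι) : sliceCLM g Φ x = g (sectionCLM x Φ) := rfl

end Product

section PartialFourier

variable {ι κ : Type*} [Fintype ι] [Fintype κ]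

/-- The partial Fourier transform `(x, ω) ↦ ∫ e^{-2πi ω·y} Φ(x, y) dy`, as a function. -/
def partialFourierLM :
    𝓢(EuclideanSpace ℝ (ι ⊕ κ), ℂ) →ₗ[ℂ] (EuclideanSpace ℝ (ι ⊕ κ) → ℂ) where
  toFun Φ z := 𝓕 (sectionCLM (fstL z) Φ) (sndL z)
  map_add' _ _ := by ext; simp [FourierTransform.fourier_add]
  map_smul' _ _ := by ext; simp [FourierTransform.fourier_smul]

theorem partialFourierLM_apply (Φ : 𝓢(EuclideanSpace ℝ (ι ⊕ κ), ℂ))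
    (z : EuclideanSpace ℝ (ι ⊕ κ)) :
    partialFourierLM Φ z = ∫ y, Real.fourierChar (-inner ℝ y (sndL z)) • Φ (join (fstL z) y) := by
  change 𝓕 (sectionCLM (fstL z) Φ) (sndL z) = _
  rw [SchwartzMap.fourier_coe, Real.fourier_eq]
  rfl

/-- The operator which the partial Fourier transform intertwines with a partial derivative. -/
def derivOp (i : ι ⊕ κ) :
    𝓢(EuclideanSpace ℝ (ι ⊕ κ), ℂ) →L[ℂ] 𝓢(EuclideanSpace ℝ (ι ⊕ κ), ℂ) :=
  Sum.elim
    (fun i => LineDeriv.lineDerivOpCLM ℂ 𝓢(EuclideanSpace ℝ (ι ⊕ κ), ℂ)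
      (inlL (κ := κ) (EuclideanSpace.basisFun ι ℝ i)))
    (fun j => (-(2 * Real.pi * Complex.I)) •
      SchwartzMap.smulLeftCLM ℂ fun z => ((z (Sum.inr j) : ℝ) : ℂ)) i

/-- The operator which the partial Fourier transform intertwines with multiplication by a
coordinate. -/
def coordOp (i : ι ⊕ κ) :
    𝓢(EuclideanSpace ℝ (ι ⊕ κ), ℂ) →L[ℂ] 𝓢(EuclideanSpace ℝ (ι ⊕ κ), ℂ) :=
  Sum.elim
    (fun i => SchwartzMap.smulLeftCLM ℂ fun z => ((z (Sum.inl i) : ℝ) : ℂ))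
    (fun j => (2 * Real.pi * Complex.I)⁻¹ •
      LineDeriv.lineDerivOpCLM ℂ 𝓢(EuclideanSpace ℝ (ι ⊕ κ), ℂ)
        (inrL (ι := ι) (EuclideanSpace.basisFun κ ℝ j))) i

theorem sectionCLM_lineDerivOp_inrL (Φ : 𝓢(EuclideanSpace ℝ (ι ⊕ κ), ℂ))
    (x : EuclideanSpace ℝ ι) (m : EuclideanSpace ℝ κ) :
    sectionCLM x (∂_{inrL (ι := ι) m} Φ) = ∂_{m} (sectionCLM x Φ) := by
  ext y
  rw [sectionCLM_apply, SchwartzMap.lineDerivOp_apply_eq_fderiv,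
    SchwartzMap.lineDerivOp_apply_eq_fderiv]
  have h : HasFDerivAt (fun y => join x y) (inrL : EuclideanSpace ℝ κ →L[ℝ] _) y := by
    simp_rw [join_eq]
    exact (inrL (ι := ι) (κ := κ)).hasFDerivAt.add_const _
  have h2 : HasFDerivAt (sectionCLM x Φ) _ y := (Φ.hasFDerivAt (join x y)).comp y h
  rw [h2.fderiv]; rfl

theorem coord_mul_partialFourierLM (i : ι ⊕ κ) (Φ : 𝓢(EuclideanSpace ℝ (ι ⊕ κ), ℂ))
    (z : EuclideanSpace ℝ (ι ⊕ κ)) :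
    (z i : ℂ) * partialFourierLM Φ z = partialFourierLM (coordOp i Φ) z := by
  cases i with
  | inl i =>
    have : sectionCLM (fstL z) (coordOp (Sum.inl i) Φ) =
        (z (Sum.inl i) : ℂ) • sectionCLM (fstL z) Φ := by
      ext y
      simp [coordOp, SchwartzMap.smulLeftCLM_apply_apply (hasTemperateGrowth_coord (Sum.inl i))]
    change _ = 𝓕 (sectionCLM (fstL z) (coordOp (Sum.inl i) Φ)) (sndL z)
    rw [this, FourierTransform.fourier_smul]; rfl
  | inr j =>
    have : sectionCLM (fstL z) (coordOp (Sum.inr j) Φ) =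
        (2 * Real.pi * Complex.I)⁻¹ • ∂_{EuclideanSpace.basisFun κ ℝ j} (sectionCLM (fstL z) Φ) := by
      rw [← sectionCLM_lineDerivOp_inrL, ← map_smul]; rfl
    change _ = 𝓕 (sectionCLM (fstL z) (coordOp (Sum.inr j) Φ)) (sndL z)
    rw [this, FourierTransform.fourier_smul, SchwartzMap.fourier_lineDerivOp_eq, smul_smul,
      inv_mul_cancel₀ Complex.two_pi_I_ne_zero, one_smul,
      SchwartzMap.smulLeftCLM_apply_apply (by fun_prop)]
    change _ = inner ℝ (sndL z) (EuclideanSpace.basisFun κ ℝ j) • partialFourierLM Φ z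
    rw [real_inner_comm, EuclideanSpace.basisFun_inner, Complex.real_smul]; rfl

theorem exists_bound_partialFourierLM :
    ∃ q : Seminorm ℂ 𝓢(EuclideanSpace ℝ (ι ⊕ κ), ℂ), Continuous q ∧
      ∀ Φ (z : EuclideanSpace ℝ (ι ⊕ κ)), ‖partialFourierLM Φ z‖ ≤ q Φ := by
  obtain ⟨q, hq, h⟩ := exists_seminorm_section (ι := ι) (κ := κ)
    ((schwartzSeminormFamily ℂ (EuclideanSpace ℝ κ) ℂ (0, 0)).comp
      (FourierTransform.fourierCLM ℂ 𝓢(EuclideanSpace ℝ κ, ℂ)).toLinearMap)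
    (((schwartz_withSeminorms ℂ (EuclideanSpace ℝ κ) ℂ).continuous_seminorm (0, 0)).comp
      (FourierTransform.fourierCLM ℂ 𝓢(EuclideanSpace ℝ κ, ℂ)).continuous)
  exact ⟨q, hq, fun Φ z => (SchwartzMap.norm_le_seminorm ℂ _ (sndL z)).trans (h Φ (fstL z))⟩

/-- Uniform integrable bound on the sections of a Schwartz function. -/
theorem exists_section_bound (Φ : 𝓢(EuclideanSpace ℝ (ι ⊕ κ), ℂ)) :
    ∃ b : EuclideanSpace ℝ κ → ℝ, Integrable b ∧
      ∀ (x : EuclideanSpace ℝ ι) y, ‖Φ (join x y)‖ ≤ b y := by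
  let N := (volume : Measure (EuclideanSpace ℝ κ)).integrablePower
  let C := 2 ^ N * ((Finset.Iic (N, 0)).sup fun m => SchwartzMap.seminorm ℂ m.1 m.2) Φ
  refine ⟨fun y => (1 + ‖y‖) ^ (-(N : ℝ)) * C,
    (Measure.integrable_pow_neg_integrablePower volume).mul_const C, fun x y => ?_⟩
  have h := SchwartzMap.one_add_le_sup_seminorm_apply (𝕜 := ℂ) (m := (N, 0)) (k := N) (n := 0)
    le_rfl le_rfl Φ (join x y)
  rw [norm_iteratedFDeriv_zero] at h
  change _ ≤ (1 + ‖y‖) ^ (-(N : ℝ)) * C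
  rw [Real.rpow_neg (by positivity), Real.rpow_natCast, ← div_eq_inv_mul,
    le_div_iff₀ (by positivity), mul_comm]
  refine le_trans ?_ h
  gcongr
  exact norm_snd_le x y

theorem sum_proj_smulRight_apply (c : ι → ℂ) (v : EuclideanSpace ℝ ι) :
    (∑ i, (EuclideanSpace.proj i : EuclideanSpace ℝ ι →L[ℝ] ℝ).smulRight (c i)) v =
      ∑ i, v i • c i := by
  rw [sum_apply]; rfl

theorem hasFDerivAt_integrand (Φ : 𝓢(EuclideanSpace ℝ (ι ⊕ κ), ℂ)) (y : EuclideanSpace ℝ κ)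
    (z : EuclideanSpace ℝ (ι ⊕ κ)) :
    HasFDerivAt (fun z => Real.fourierChar (-inner ℝ y (sndL z)) • Φ (join (fstL z) y))
      (∑ i, (EuclideanSpace.proj i : EuclideanSpace ℝ (ι ⊕ κ) →L[ℝ] ℝ).smulRight
        (Real.fourierChar (-inner ℝ y (sndL z)) • derivOp i Φ (join (fstL z) y))) z := by
  have h1 : HasFDerivAt (fun z : EuclideanSpace ℝ (ι ⊕ κ) => join (fstL z) y)
      ((inlL (κ := κ)).comp fstL) z := by
    simp_rw [join_eq]
    exact ((inlL (κ := κ)).comp (fstL (ι := ι))).hasFDerivAt.const_add _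
  have h2 := (Φ.hasFDerivAt (join (fstL z) y)).comp z h1
  let l : EuclideanSpace ℝ (ι ⊕ κ) →L[ℝ] ℝ := (innerSL ℝ y).comp sndL
  have h3 : HasFDerivAt (fun z => Complex.exp (-(2 * Real.pi * Complex.I) * (l z : ℂ)))
      (Complex.exp (-(2 * Real.pi * Complex.I) * (l z : ℂ)) •
        ((-(2 * Real.pi * Complex.I)) • Complex.ofRealCLM.comp l)) z :=
    ((Complex.ofRealCLM.comp l).hasFDerivAt.const_mul _).cexp
  have hc : ∀ z, ((Real.fourierChar (-inner ℝ y (sndL z)) : Circle) : ℂ) =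
      Complex.exp (-(2 * Real.pi * Complex.I) * (l z : ℂ)) := fun z => by
    rw [Real.fourierChar_apply]
    congr 1
    simp only [l, ContinuousLinearMap.comp_apply, innerSL_apply_apply]
    push_cast; ring
  have h4 := h3.mul h2
  simp_rw [Circle.smul_def, hc]
  refine h4.congr_fderiv (ContinuousLinearMap.ext fun v => ?_)
  have hv : fstL v = ∑ i, v (Sum.inl i) • EuclideanSpace.basisFun ι ℝ i :=
    ((EuclideanSpace.basisFun ι ℝ).sum_repr (fstL v)).symm
  have hl : l v = ∑ j, v (Sum.inr j) * y j := by
    simp [l, PiLp.inner_apply]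
  have hi : ∀ i, derivOp (κ := κ) (Sum.inl i) Φ (join (fstL z) y) =
      fderiv ℝ Φ (join (fstL z) y) (inlL (κ := κ) (EuclideanSpace.basisFun ι ℝ i)) := fun i =>
    SchwartzMap.lineDerivOp_apply_eq_fderiv _ Φ _
  have hj : ∀ j, derivOp (ι := ι) (Sum.inr j) Φ (join (fstL z) y) =
      -(2 * Real.pi * Complex.I) * ((y j : ℂ) * Φ (join (fstL z) y)) := fun j => by
    simp [derivOp, SchwartzMap.smulLeftCLM_apply_apply (hasTemperateGrowth_coord (Sum.inr j))]
  rw [sum_proj_smulRight_apply]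
  simp only [Fintype.sum_sum_type, hi, hj]
  simp only [add_apply, smul_apply,
    ContinuousLinearMap.comp_apply, Complex.ofRealCLM_apply, hv, hl, map_sum, map_smul,
    Function.comp_apply]
  push_cast
  simp only [smul_eq_mul, Complex.real_smul, Finset.mul_sum]
  congr 1
  · exact Finset.sum_congr rfl fun i _ => by ring
  · exact Finset.sum_congr rfl fun i _ => by ring

theorem hasFDerivAt_partialFourierLM (Φ : 𝓢(EuclideanSpace ℝ (ι ⊕ κ), ℂ))
    (z : EuclideanSpace ℝ (ι ⊕ κ)) :
    HasFDerivAt (partialFourierLM Φ)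
      (∑ i, (EuclideanSpace.proj i : EuclideanSpace ℝ (ι ⊕ κ) →L[ℝ] ℝ).smulRight
        (partialFourierLM (derivOp i Φ) z)) z := by
  let R : ι ⊕ κ → (ℂ →L[ℝ] (EuclideanSpace ℝ (ι ⊕ κ) →L[ℝ] ℂ)) := fun i =>
      ContinuousLinearMap.smulRightL ℝ (EuclideanSpace ℝ (ι ⊕ κ)) ℂ (EuclideanSpace.proj i)
  have hint : ∀ (Ψ : 𝓢(EuclideanSpace ℝ (ι ⊕ κ), ℂ)) (z : EuclideanSpace ℝ (ι ⊕ κ)),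
      Integrable fun y => Real.fourierChar (-inner ℝ y (sndL z)) • Ψ (join (fstL z) y) :=
    fun Ψ z => (Real.fourierIntegral_convergent_iff (sndL z)).2 (sectionCLM (fstL z) Ψ).integrable
  choose b hb hΨ using fun i : ι ⊕ κ => exists_section_bound (derivOp i Φ)
  have h := hasFDerivAt_integral_of_dominated_of_fderiv_le (𝕜 := ℝ) (μ := volume) (x₀ := z)
    (s := Set.univ)
    (F := fun z y => Real.fourierChar (-inner ℝ y (sndL z)) • Φ (join (fstL z) y))
    (F' := fun z y => ∑ i, R i (Real.fourierChar (-inner ℝ y (sndL z)) •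
      derivOp i Φ (join (fstL z) y)))
    (bound := fun y => ∑ i, ‖R i‖ * b i y) Filter.univ_mem
    (Filter.Eventually.of_forall fun z => (hint Φ z).aestronglyMeasurable) (hint Φ z)
    (integrable_finsetSum _ fun i _ => (R i).integrable_comp (hint _ z)).aestronglyMeasurable
    (Filter.Eventually.of_forall fun y z _ => by
      refine (norm_sum_le _ _).trans (Finset.sum_le_sum fun i _ => ?_)
      refine ((R i).le_opNorm _).trans ?_
      rw [Circle.norm_smul]
      gcongr
      exact hΨ i _ y)
    (integrable_finsetSum _ fun i _ => (hb i).const_mul _)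
    (Filter.Eventually.of_forall fun y z _ => hasFDerivAt_integrand Φ y z)
  have e1 : (fun z => ∫ y, Real.fourierChar (-inner ℝ y (sndL z)) • Φ (join (fstL z) y)) =
      partialFourierLM Φ := funext fun z => (partialFourierLM_apply Φ z).symm
  rw [e1] at h
  refine h.congr_fderiv ?_
  rw [integral_finsetSum _ fun i _ => (R i).integrable_comp (hint _ z)]
  refine Finset.sum_congr rfl fun i _ => ?_
  rw [ContinuousLinearMap.integral_comp_comm _ (hint _ z), ← partialFourierLM_apply]
  rfl

/-- The partial Fourier transform `𝓕₂Φ(x, ω) = ∫ e^{-2πi ω·y} Φ(x, y) dy` on the Schwartz space of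
a product. -/
def partialFourierCLM :
    𝓢(EuclideanSpace ℝ (ι ⊕ κ), ℂ) →L[ℂ] 𝓢(EuclideanSpace ℝ (ι ⊕ κ), ℂ) :=
  operatorCLM partialFourierLM derivOp coordOp hasFDerivAt_partialFourierLM
    coord_mul_partialFourierLM exists_bound_partialFourierLM

theorem partialFourierCLM_apply (Φ : 𝓢(EuclideanSpace ℝ (ι ⊕ κ), ℂ)) (x : EuclideanSpace ℝ ι)
    (ω : EuclideanSpace ℝ κ) :
    partialFourierCLM Φ (join x ω) =
      ∫ y, Real.fourierChar (-inner ℝ y ω) • Φ (join x y) :=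
  partialFourierLM_apply Φ (join x ω)

end PartialFourier

section TempDist

variable {ι κ : Type*} [Fintype ι] [Fintype κ]

/-- The complex conjugate of a Schwartz function. -/
def conjSchwartz : 𝓢(EuclideanSpace ℝ ι, ℂ) →L[ℝ] 𝓢(EuclideanSpace ℝ ι, ℂ) :=
  SchwartzMap.postcompCLM (Complex.conjCLE : ℂ →L[ℝ] ℂ)

@[simp] theorem conjSchwartz_apply (φ : 𝓢(EuclideanSpace ℝ ι, ℂ)) (t : EuclideanSpace ℝ ι) :
    conjSchwartz φ t = starRingEnd ℂ (φ t) := rfl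

/-- The complex conjugate `φ ↦ conj (g (conj φ))` of a tempered distribution `g`. Mathlib's tempered
distributions act linearly on test functions: `g φ` is `⟨g, conj φ⟩` for the sesquilinear
bracket. -/
def conjDist (g : 𝓢'(EuclideanSpace ℝ ι, ℂ)) : 𝓢'(EuclideanSpace ℝ ι, ℂ) :=
  ({ toFun := fun φ => starRingEnd ℂ (g (conjSchwartz φ))
     map_add' := fun φ ψ => by simp
     map_smul' := fun c φ => by
       have : conjSchwartz (c • φ) = starRingEnd ℂ c • conjSchwartz φ := by ext t; simp
       rw [this, map_smul]; simp
     cont := Complex.continuous_conj.comp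
       ((g : 𝓢(EuclideanSpace ℝ ι, ℂ) →L[ℂ] ℂ).continuous.comp conjSchwartz.continuous) } :
    𝓢(EuclideanSpace ℝ ι, ℂ) →L[ℂ] ℂ)

@[simp] theorem conjDist_apply (g : 𝓢'(EuclideanSpace ℝ ι, ℂ)) (φ : 𝓢(EuclideanSpace ℝ ι, ℂ)) :
    conjDist g φ = starRingEnd ℂ (g (conjSchwartz φ)) := rfl

/-- The tensor product of tempered distributions: `(f ⊗ g)(Φ) = f (x ↦ g (Φ(x, ·)))`. -/
def tensorDist (f : 𝓢'(EuclideanSpace ℝ ι, ℂ)) (g : 𝓢'(EuclideanSpace ℝ κ, ℂ)) :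
    𝓢'(EuclideanSpace ℝ (ι ⊕ κ), ℂ) :=
  PointwiseConvergenceCLM.precomp ℂ (sliceCLM g) f

@[simp] theorem tensorDist_apply (f : 𝓢'(EuclideanSpace ℝ ι, ℂ)) (g : 𝓢'(EuclideanSpace ℝ κ, ℂ))
    (Φ : 𝓢(EuclideanSpace ℝ (ι ⊕ κ), ℂ)) : tensorDist f g Φ = f (sliceCLM g Φ) := rfl

/-- The partial Fourier transform `𝓕₂` in the second variable of a tempered distribution. -/
def partialFourierDist (F : 𝓢'(EuclideanSpace ℝ (ι ⊕ κ), ℂ)) :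
    𝓢'(EuclideanSpace ℝ (ι ⊕ κ), ℂ) :=
  PointwiseConvergenceCLM.precomp ℂ partialFourierCLM F

@[simp] theorem partialFourierDist_apply (F : 𝓢'(EuclideanSpace ℝ (ι ⊕ κ), ℂ))
    (Φ : 𝓢(EuclideanSpace ℝ (ι ⊕ κ), ℂ)) :
    partialFourierDist F Φ = F (partialFourierCLM Φ) := rfl

/-- An invertible matrix as a linear automorphism `z ↦ A z` of Euclidean space. -/
def glEquiv [DecidableEq ι] (A : GL ι ℝ) : EuclideanSpace ℝ ι ≃L[ℝ] EuclideanSpace ℝ ι :=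
  ContinuousLinearEquiv.unitsEquiv ℝ (EuclideanSpace ℝ ι)
    (Units.map (Matrix.toEuclideanCLM (𝕜 := ℝ) (n := ι) :
      Matrix ι ι ℝ →* (EuclideanSpace ℝ ι →L[ℝ] EuclideanSpace ℝ ι)) A)

@[simp] theorem glEquiv_apply [DecidableEq ι] (A : GL ι ℝ) (z : EuclideanSpace ℝ ι) :
    glEquiv A z = WithLp.toLp 2 ((A : Matrix ι ι ℝ).mulVec z) := rfl

/-- The coordinate transformation `F ↦ F(A ·)` of a tempered distribution:
`(𝔗_A F)(Φ) = |det A|⁻¹ F(Φ(A⁻¹ ·))`. -/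
def coordTransform [DecidableEq ι] (A : GL ι ℝ) (F : 𝓢'(EuclideanSpace ℝ ι, ℂ)) :
    𝓢'(EuclideanSpace ℝ ι, ℂ) :=
  ((|(A : Matrix ι ι ℝ).det|⁻¹ : ℝ) : ℂ) •
    PointwiseConvergenceCLM.precomp ℂ
      (SchwartzMap.compCLMOfContinuousLinearEquiv ℂ (glEquiv A⁻¹)) F

/-- The matrix-Wigner distribution `𝓑_A(f, g) = 𝓕₂ 𝔗_A (f ⊗ conj g)` of two tempered
distributions. -/
def matrixWigner [DecidableEq ι] (A : GL (ι ⊕ ι) ℝ) (f g : 𝓢'(EuclideanSpace ℝ ι, ℂ)) :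
    𝓢'(EuclideanSpace ℝ (ι ⊕ ι), ℂ) :=
  partialFourierDist (coordTransform A (tensorDist f (conjDist g)))

/-- The Cohen-type matrix `A_M` with blocks `I, M + I/2; I, M - I/2`, with its inverse. -/
def cohenMatrix [DecidableEq ι] (M : Matrix ι ι ℝ) : GL (ι ⊕ ι) ℝ where
  val := Matrix.fromBlocks 1 (M + (1 / 2 : ℝ) • 1) 1 (M - (1 / 2 : ℝ) • 1)
  inv := Matrix.fromBlocks (-(M - (1 / 2 : ℝ) • 1)) (M + (1 / 2 : ℝ) • 1) 1 (-1)
  val_inv := by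
    have h : ((1 / 2 : ℝ) • (1 : Matrix ι ι ℝ)) + (1 / 2 : ℝ) • 1 = 1 := by
      rw [← add_smul]; norm_num
    generalize (1 / 2 : ℝ) • (1 : Matrix ι ι ℝ) = c at h ⊢
    rw [Matrix.fromBlocks_multiply, ← Matrix.fromBlocks_one]
    congr 1
    · have : 1 * -(M - c) + (M + c) * 1 = c + c := by noncomm_ring
      rw [this, h]
    · simp
    · simp
    · have : 1 * (M + c) + (M - c) * -1 = c + c := by noncomm_ring
      rw [this, h]
  inv_val := by
    have h : ((1 / 2 : ℝ) • (1 : Matrix ι ι ℝ)) + (1 / 2 : ℝ) • 1 = 1 := by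
      rw [← add_smul]; norm_num
    have hc : ((1 / 2 : ℝ) • (1 : Matrix ι ι ℝ)) * M = M * ((1 / 2 : ℝ) • 1) := by simp
    generalize (1 / 2 : ℝ) • (1 : Matrix ι ι ℝ) = c at h hc ⊢
    rw [Matrix.fromBlocks_multiply, ← Matrix.fromBlocks_one]
    congr 1
    · have : -(M - c) * 1 + (M + c) * 1 = c + c := by noncomm_ring
      rw [this, h]
    · have : -(M - c) * (M + c) + (M + c) * (M - c) = 2 • (c * M) - 2 • (M * c) := by noncomm_ring
      rw [this, hc, sub_self]
    · simp
    · have : 1 * (M + c) + -1 * (M - c) = c + c := by noncomm_ring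
      rw [this, h]

end TempDist

section TimeFrequency

variable {ι : Type*} [Fintype ι]

theorem hasTemperateGrowth_char (ω : EuclideanSpace ℝ ι) :
    (fun t : EuclideanSpace ℝ ι =>
      ((Real.fourierChar (inner ℝ ω t) : Circle) : ℂ)).HasTemperateGrowth := by
  let e : ℝ → ℂ := fun r => Complex.exp ((2 * Real.pi * Complex.I) * (r : ℂ))
  have he : e.HasTemperateGrowth := by
    have hs : ContDiff ℝ (⊤ : ℕ∞) e :=
      (contDiff_const.mul Complex.ofRealCLM.contDiff).cexp
    refine ⟨hs, fun n => ⟨0, (2 * Real.pi) ^ n, fun r => ?_⟩⟩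
    have hd : ∀ n, iteratedDeriv n e = fun r => (2 * Real.pi * Complex.I) ^ n * e r := by
      intro n
      induction n with
      | zero => simp
      | succ n ih =>
        rw [iteratedDeriv_succ, ih]
        ext r
        have h1 : HasDerivAt e (e r * (2 * Real.pi * Complex.I)) r := by
          have := ((Complex.ofRealCLM.hasDerivAt (x := r)).const_mul
            (2 * Real.pi * Complex.I)).cexp
          simpa using this
        rw [(h1.const_mul _).deriv]; ring
    rw [norm_iteratedFDeriv_eq_norm_iteratedDeriv, hd]
    have h2 : ‖e r‖ = 1 := by
      have : (2 * Real.pi * Complex.I) * (r : ℂ) = ((2 * Real.pi * r : ℝ) : ℂ) * Complex.I := by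
        push_cast; ring
      simp only [e, this, Complex.norm_exp_ofReal_mul_I]
    simp [h2, abs_of_pos Real.pi_pos]
  have h3 : (fun t : EuclideanSpace ℝ ι => ((Real.fourierChar (inner ℝ ω t) : Circle) : ℂ)) =
      e ∘ fun t => inner ℝ ω t := by
    ext t
    simp only [Function.comp_apply, e, Real.fourierChar_apply]
    congr 1; push_cast; ring
  rw [h3]
  exact he.comp (Function.hasTemperateGrowth_inner_right ω)

/-- The time-frequency shift `π(x, ω) g = M_ω T_x g`, i.e. `t ↦ e^{2πi ω·t} g(t - x)`, of a Schwartz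
function. -/
def tfShift (x ω : EuclideanSpace ℝ ι) (g : 𝓢(EuclideanSpace ℝ ι, ℂ)) :
    𝓢(EuclideanSpace ℝ ι, ℂ) :=
  SchwartzMap.smulLeftCLM ℂ (fun t => ((Real.fourierChar (inner ℝ ω t) : Circle) : ℂ))
    (SchwartzMap.compSubConstCLM ℂ x g)

theorem tfShift_apply (x ω : EuclideanSpace ℝ ι) (g : 𝓢(EuclideanSpace ℝ ι, ℂ))
    (t : EuclideanSpace ℝ ι) :
    tfShift x ω g t = ((Real.fourierChar (inner ℝ ω t) : Circle) : ℂ) * g (t - x) := by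
  simp [tfShift, SchwartzMap.smulLeftCLM_apply_apply (hasTemperateGrowth_char ω)]

/-- The short-time Fourier transform `V_g f(x, ω) = ⟨f, π(x, ω) g⟩` of a tempered distribution `f`
with window `g`. -/
def stft (g : 𝓢(EuclideanSpace ℝ ι, ℂ)) (f : 𝓢'(EuclideanSpace ℝ ι, ℂ))
    (x ω : EuclideanSpace ℝ ι) : ℂ :=
  f (conjSchwartz (tfShift x ω g))

/-- The norm of the modulation space `M^{p,q}_m(ℝ^ι)`, measured with the window `g`. -/
def modulationNorm (g : 𝓢(EuclideanSpace ℝ ι, ℂ)) (p q : ℝ) (m : EuclideanSpace ℝ (ι ⊕ ι) → ℝ)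
    (f : 𝓢'(EuclideanSpace ℝ ι, ℂ)) : ℝ≥0∞ :=
  (∫⁻ ω, (∫⁻ x, ‖stft g f x ω‖ₑ ^ p * ENNReal.ofReal (m (join x ω)) ^ p) ^ (q / p)) ^ (1 / q)

/-- Membership in the modulation space `M^{p,q}_m(ℝ^ι)`, with the window `g`. -/
def MemModulation (g : 𝓢(EuclideanSpace ℝ ι, ℂ)) (p q : ℝ) (m : EuclideanSpace ℝ (ι ⊕ ι) → ℝ)
    (f : 𝓢'(EuclideanSpace ℝ ι, ℂ)) : Prop :=
  modulationNorm g p q m f < ∞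

/-- The norm of the Wiener amalgam space `W(𝓕L^p_u, L^q_w)(ℝ^ι)`, measured with the window `g`. -/
def amalgamNorm (g : 𝓢(EuclideanSpace ℝ ι, ℂ)) (p q : ℝ) (u w : EuclideanSpace ℝ ι → ℝ)
    (f : 𝓢'(EuclideanSpace ℝ ι, ℂ)) : ℝ≥0∞ :=
  (∫⁻ x, (∫⁻ ω, ‖stft g f x ω‖ₑ ^ p * ENNReal.ofReal (u ω) ^ p) ^ (q / p)
    * ENNReal.ofReal (w x) ^ q) ^ (1 / q)

/-- Membership in the Wiener amalgam space `W(𝓕L^p_u, L^q_w)(ℝ^ι)`, with the window `g`. -/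
def MemAmalgam (g : 𝓢(EuclideanSpace ℝ ι, ℂ)) (p q : ℝ) (u w : EuclideanSpace ℝ ι → ℝ)
    (f : 𝓢'(EuclideanSpace ℝ ι, ℂ)) : Prop :=
  amalgamNorm g p q u w f < ∞

/-- The polynomial weight `v_s(z) = (1 + |z|²)^{s/2}`. -/
def polyWeight (s : ℝ) (z : EuclideanSpace ℝ ι) : ℝ := (1 + ‖z‖ ^ 2) ^ (s / 2)

/-- The tensor product `(u ⊗ w)(x, y) = u(x) w(y)` of two weights. -/
def tensorWeight (u w : EuclideanSpace ℝ ι → ℝ) (z : EuclideanSpace ℝ (ι ⊕ ι)) : ℝ :=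
  u (fstL z) * w (sndL z)

variable [DecidableEq ι]

/-- The block matrix `P_M = diag(-(M + I/2), M - I/2)`. -/
def matrixP (M : Matrix ι ι ℝ) : Matrix (ι ⊕ ι) (ι ⊕ ι) ℝ :=
  Matrix.fromBlocks (-(M + (1 / 2 : ℝ) • 1)) 0 0 (M - (1 / 2 : ℝ) • 1)

/-- The weight `v_s^M = v_s ∘ (I + P_M⁻¹)⁻¹`. -/
def polyWeightM (s : ℝ) (M : Matrix ι ι ℝ) (z : EuclideanSpace ℝ (ι ⊕ ι)) : ℝ :=
  polyWeight s (Matrix.toEuclideanCLM (𝕜 := ℝ) ((1 + (matrixP M)⁻¹)⁻¹) z)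

/-- The constant `C_M = |det(M + I/2) det(M - I/2)|`. -/
def constC (M : Matrix ι ι ℝ) : ℝ :=
  |(M + (1 / 2 : ℝ) • 1).det * (M - (1 / 2 : ℝ) • 1).det|

/-- A `2 × 2` block matrix is right-regular if the two blocks of its second column are
invertible. -/
def IsRightRegular (A : Matrix (ι ⊕ ι) (ι ⊕ ι) ℝ) : Prop :=
  IsUnit A.toBlocks₁₂ ∧ IsUnit A.toBlocks₂₂

end TimeFrequency

end

end MWD

/-! The reproducing formula bounds `|V_g f|` by the correlation of `|V_{g₀} f|` with the ambiguity
function of `g₀` and `g`, which decays rapidly. By Young's inequality, norms taken with different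
windows are therefore comparable, and both families of spaces grow with their exponents.

For the window `Ψ` on phase space adapted to `g₁`, `g₂` and `M`, the modulus of
`V_Ψ (B_A (f₁, f₂))` is the product of `|V_{g₁} f₁|` and `|V_{g₂} f₂|` at sheared arguments (the
magic formula). A mixed norm of this product is, after raising it to the power `p ≤ q`, an
iterated correlation, which Young's inequality estimates as soon as `1/p + 1/q = 1/P₁ + 1/P₂`, and
likewise for `Q₁`, `Q₂`. The inclusions reduce the general case to this one: lower `p` to
`min p q` and raise `p₁, p₂, q₁, q₂`. Peetre's inequality distributes the weight over the two
factors, and `v_s^M` is equivalent to `v_s` because `I + P_M⁻¹` is invertible. -/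

namespace MWD

noncomputable section

section Integrals

theorem rpow_mul_rpow_sub (x : ℝ≥0∞) {u v : ℝ} (hu : 0 ≤ u) (huv : u ≤ v) :
    x ^ u * x ^ (v - u) = x ^ v := by
  rw [← ENNReal.rpow_add_of_nonneg _ _ hu (sub_nonneg.2 huv), add_sub_cancel]

variable {X Y : Type*} [MeasurableSpace X] [MeasurableSpace Y] {μ : Measure X} {ν : Measure Y}

theorem exists_monotone_iSup_eq_lintegral_rpow_ne_top [SigmaFinite μ] {p : ℝ} (hp : 0 < p)
    {S : X → ℝ≥0∞} (hS : Measurable S) :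
    ∃ T : ℕ → X → ℝ≥0∞, (∀ n, Measurable (T n)) ∧ Monotone T ∧ (∀ x, ⨆ n, T n x = S x) ∧
      ∀ n, ∫⁻ x, T n x ^ p ∂μ ≠ ∞ := by
  let T : ℕ → X → ℝ≥0∞ := fun n => (spanningSets μ n).indicator fun x => min (S x) n
  have apply_of_mem {n : ℕ} {x : X} (hx : x ∈ spanningSets μ n) : T n x = min (S x) n :=
    Set.indicator_of_mem hx _
  have apply_of_notMem {n : ℕ} {x : X} (hx : x ∉ spanningSets μ n) : T n x = 0 :=
    Set.indicator_of_notMem hx _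
  refine ⟨T, fun n => (hS.min measurable_const).indicator (measurableSet_spanningSets μ n),
    fun m n hmn x => ?_, fun x => le_antisymm (iSup_le fun n => ?_) ?_, fun n => ?_⟩
  · by_cases hx : x ∈ spanningSets μ m
    · rw [apply_of_mem hx, apply_of_mem (monotone_spanningSets μ hmn hx)]
      exact min_le_min le_rfl (by exact_mod_cast hmn)
    · exact (apply_of_notMem hx).trans_le zero_le
  · exact Set.indicator_le' (fun _ _ => min_le_left _ _) (fun _ _ => zero_le) x
  · refine le_of_forall_lt fun c hc => ?_
    obtain ⟨n, hn⟩ := ENNReal.exists_nat_gt hc.ne_top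
    obtain ⟨m, hm⟩ := Set.mem_iUnion.1 ((iUnion_spanningSets μ).symm ▸ Set.mem_univ x)
    refine lt_of_lt_of_le ?_ (le_iSup _ (max m n))
    rw [apply_of_mem (monotone_spanningSets μ (le_max_left m n) hm)]
    exact lt_min hc (hn.trans_le (by exact_mod_cast le_max_right m n))
  · have hle (x : X) : T n x ^ p ≤ (spanningSets μ n).indicator (fun _ => (n : ℝ≥0∞) ^ p) x := by
      by_cases hx : x ∈ spanningSets μ n
      · rw [apply_of_mem hx, Set.indicator_of_mem hx]
        exact ENNReal.rpow_le_rpow (min_le_right _ _) hp.le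
      · rw [apply_of_notMem hx, ENNReal.zero_rpow_of_pos hp]
        exact zero_le
    refine ((lintegral_mono hle).trans_lt ?_).ne
    rw [lintegral_indicator (measurableSet_spanningSets μ n), setLIntegral_const]
    exact ENNReal.mul_lt_top (ENNReal.rpow_lt_top_of_nonneg hp.le (ENNReal.natCast_ne_top n))
      (measure_spanningSets_lt_top μ n)

theorem lintegral_rpow_le_of_le_lintegral [SFinite μ] [SFinite ν] {p p' : ℝ}
    (hpp' : p.HolderConjugate p') {h : X → Y → ℝ≥0∞} (hh : Measurable (Function.uncurry h))
    {T : X → ℝ≥0∞} (hT : Measurable T) (hTh : ∀ x, T x ≤ ∫⁻ y, h x y ∂ν)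
    (hT_top : ∫⁻ x, T x ^ p ∂μ ≠ ∞) :
    (∫⁻ x, T x ^ p ∂μ) ^ (1 / p) ≤ ∫⁻ y, (∫⁻ x, h x y ^ p ∂μ) ^ (1 / p) ∂ν := by
  set I := ∫⁻ x, T x ^ p ∂μ
  have hI : I ≤ (∫⁻ y, (∫⁻ x, h x y ^ p ∂μ) ^ (1 / p) ∂ν) * I ^ (1 / p') :=
    calc I = ∫⁻ x, T x * T x ^ (p - 1) ∂μ := lintegral_congr fun x => by
            simpa using (rpow_mul_rpow_sub (T x) zero_le_one hpp'.lt.le).symm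
      _ ≤ ∫⁻ x, ∫⁻ y, h x y * T x ^ (p - 1) ∂ν ∂μ := lintegral_mono fun x => by
            rw [lintegral_mul_const _ hh.of_uncurry_left]
            exact mul_le_mul_left (hTh x) _
      _ = ∫⁻ y, ∫⁻ x, h x y * T x ^ (p - 1) ∂μ ∂ν :=
            lintegral_lintegral_swap
              (hh.mul ((hT.comp measurable_fst).pow_const (p - 1))).aemeasurable
      _ ≤ ∫⁻ y, (∫⁻ x, h x y ^ p ∂μ) ^ (1 / p) * I ^ (1 / p') ∂ν := lintegral_mono fun y => by
            have hTp (x : X) : (T x ^ (p - 1)) ^ p' = T x ^ p := by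
              rw [← ENNReal.rpow_mul, hpp'.sub_one_mul_conj]
            simpa only [hTp, Pi.mul_apply] using ENNReal.lintegral_mul_le_Lp_mul_Lq μ hpp'
              (hh.of_uncurry_right (y := y)).aemeasurable (hT.pow_const (p - 1)).aemeasurable
      _ = _ := lintegral_mul_const _ ((hh.pow_const p).lintegral_prod_left'.pow_const _)
  rcases eq_or_ne I 0 with hI0 | hI0
  · rw [hI0, ENNReal.zero_rpow_of_pos (one_div_pos.2 hpp'.pos)]
    exact zero_le
  · have hsplit : I ^ (1 / p) * I ^ (1 / p') = I := by
      rw [← ENNReal.rpow_add _ _ hI0 hT_top, one_div, one_div, hpp'.inv_add_inv_eq_one,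
        ENNReal.rpow_one]
    exact (ENNReal.mul_le_mul_iff_left (ENNReal.rpow_pos (pos_iff_ne_zero.2 hI0) hT_top).ne'
      (ENNReal.rpow_ne_top_of_nonneg (one_div_nonneg.2 hpp'.symm.nonneg) hT_top)).1
      (hsplit.trans_le hI)

theorem lintegral_rpow_lintegral_le [SigmaFinite μ] [SFinite ν] {p : ℝ} (hp : 1 ≤ p)
    {h : X → Y → ℝ≥0∞} (hh : Measurable (Function.uncurry h)) :
    (∫⁻ x, (∫⁻ y, h x y ∂ν) ^ p ∂μ) ^ (1 / p) ≤ ∫⁻ y, (∫⁻ x, h x y ^ p ∂μ) ^ (1 / p) ∂ν := by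
  rcases hp.eq_or_lt with rfl | hp1
  · simpa using (lintegral_lintegral_swap hh.aemeasurable).le
  have hp0 : 0 < p := by positivity
  obtain ⟨T, hT, hT_mono, hT_sup, hT_top⟩ :=
    exists_monotone_iSup_eq_lintegral_rpow_ne_top (μ := μ) hp0 (hh.lintegral_prod_right (ν := ν))
  have hsup : ∫⁻ x, (∫⁻ y, h x y ∂ν) ^ p ∂μ = ⨆ n, ∫⁻ x, T n x ^ p ∂μ := by
    rw [← lintegral_iSup (fun n => (hT n).pow_const p)
      (fun m n hmn x => ENNReal.rpow_le_rpow (hT_mono hmn x) hp0.le)]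
    refine lintegral_congr fun x => ?_
    rw [← hT_sup x]
    exact (ENNReal.orderIsoRpow p hp0).map_iSup _
  rw [hsup]
  refine ((ENNReal.orderIsoRpow (1 / p) (one_div_pos.2 hp0)).map_iSup _).trans_le ?_
  exact iSup_le fun n => lintegral_rpow_le_of_le_lintegral (.conjExponent hp1) hh (hT n)
    (fun x => (le_iSup (fun n => T n x) n).trans_eq (hT_sup x)) (hT_top n)

theorem lintegral_mul_mul_rpow_le {f g k : X → ℝ≥0∞} (hf : Measurable f) (hg : Measurable g)
    (hk : Measurable k) {α β γ : ℝ} (hα : 0 ≤ α) (hβ : 0 ≤ β) (hγ : 0 ≤ γ)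
    (hαβγ : α + β + γ = 1) :
    ∫⁻ x, f x ^ α * g x ^ β * k x ^ γ ∂μ ≤
      (∫⁻ x, f x ∂μ) ^ α * (∫⁻ x, g x ∂μ) ^ β * (∫⁻ x, k x ∂μ) ^ γ := by
  simpa [Fin.prod_univ_three] using
    ENNReal.lintegral_prod_norm_pow_le (μ := μ) (Finset.univ : Finset (Fin 3))
      (f := ![f, g, k]) (p := ![α, β, γ])
      (by simp [Fin.forall_fin_succ, hf.aemeasurable, hg.aemeasurable, hk.aemeasurable])
      (by simpa [Fin.sum_univ_three] using hαβγ) (by simp [Fin.forall_fin_succ, hα, hβ, hγ])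

theorem lintegral_mul_le_rpow_mul_rpow {a b r : ℝ} (ha : 1 ≤ a) (hb : 1 ≤ b) (hr : 0 < r)
    (h : 1 / a + 1 / b = 1 + 1 / r) {F G : X → ℝ≥0∞} (hF : Measurable F) (hG : Measurable G) :
    ∫⁻ x, F x * G x ∂μ ≤ (∫⁻ x, F x ^ a * G x ^ b ∂μ) ^ (1 / r) *
      ((∫⁻ x, F x ^ a ∂μ) ^ (1 / a - 1 / r) * (∫⁻ x, G x ^ b ∂μ) ^ (1 / b - 1 / r)) := by
  have hr' : 0 ≤ 1 / r := by positivity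
  have hra : 1 / r ≤ 1 / a := by linarith [(div_le_one (by positivity)).2 hb]
  have hrb : 1 / r ≤ 1 / b := by linarith [(div_le_one (by positivity)).2 ha]
  have split {c : ℝ} (hc : 1 ≤ c) (hrc : 1 / r ≤ 1 / c) (x : ℝ≥0∞) :
      x = (x ^ c) ^ (1 / r) * (x ^ c) ^ (1 / c - 1 / r) := by
    rw [rpow_mul_rpow_sub _ hr' hrc, one_div, ENNReal.rpow_rpow_inv (by positivity)]
  calc ∫⁻ x, F x * G x ∂μ
      = ∫⁻ x, (F x ^ a * G x ^ b) ^ (1 / r) * (F x ^ a) ^ (1 / a - 1 / r) *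
          (G x ^ b) ^ (1 / b - 1 / r) ∂μ := lintegral_congr fun x => by
        conv_lhs => rw [split ha hra (F x), split hb hrb (G x)]
        rw [ENNReal.mul_rpow_of_nonneg _ _ hr']
        ring
    _ ≤ _ := lintegral_mul_mul_rpow_le ((hF.pow_const a).mul (hG.pow_const b)) (hF.pow_const a)
        (hG.pow_const b) hr' (sub_nonneg.2 hra) (sub_nonneg.2 hrb) (by linarith)
    _ = _ := mul_assoc _ _ _

end Integrals

section Correlation

variable {X : Type*} [MeasurableSpace X] [AddCommGroup X] [MeasurableAdd₂ X] {μ : Measure X}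
  [SFinite μ] [μ.IsAddLeftInvariant]

theorem lintegral_lintegral_mul_add {F G : X → ℝ≥0∞} (hF : Measurable F) (hG : Measurable G) :
    ∫⁻ w, ∫⁻ z, F z * G (z + w) ∂μ ∂μ = (∫⁻ z, F z ∂μ) * ∫⁻ z, G z ∂μ := by
  have hFG : Measurable (Function.uncurry fun w z => F z * G (z + w)) := by
    unfold Function.uncurry
    fun_prop
  rw [lintegral_lintegral_swap hFG.aemeasurable, ← lintegral_mul_const _ hF]
  refine lintegral_congr fun z => ?_
  rw [lintegral_const_mul _ (by fun_prop), lintegral_add_left_eq_self G z]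

theorem lintegral_correlation_rpow_le {a b r : ℝ} (ha : 1 ≤ a) (hb : 1 ≤ b) (hr : 0 < r)
    (h : 1 / a + 1 / b = 1 + 1 / r) {F G : X → ℝ≥0∞} (hF : Measurable F) (hG : Measurable G) :
    (∫⁻ w, (∫⁻ z, F z * G (z + w) ∂μ) ^ r ∂μ) ^ (1 / r) ≤
      (∫⁻ z, F z ^ a ∂μ) ^ (1 / a) * (∫⁻ z, G z ^ b ∂μ) ^ (1 / b) := by
  set A := ∫⁻ z, F z ^ a ∂μ
  set B := ∫⁻ z, G z ^ b ∂μ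
  have hr' : 0 ≤ 1 / r := by positivity
  have pointwise (w : X) : (∫⁻ z, F z * G (z + w) ∂μ) ^ r ≤
      (∫⁻ z, F z ^ a * G (z + w) ^ b ∂μ) * (A ^ (1 / a - 1 / r) * B ^ (1 / b - 1 / r)) ^ r := by
    have hB : ∫⁻ z, G (z + w) ^ b ∂μ = B := by
      simp_rw [add_comm _ w]
      exact lintegral_add_left_eq_self (fun z => G z ^ b) w
    have := lintegral_mul_le_rpow_mul_rpow (μ := μ) ha hb hr h hF (G := fun z => G (z + w))
      (by fun_prop)
    rw [hB] at this
    refine (ENNReal.rpow_le_rpow this hr.le).trans_eq ?_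
    rw [ENNReal.mul_rpow_of_nonneg _ _ hr.le, one_div r, ENNReal.rpow_inv_rpow hr.ne']
  have hjoint : Measurable fun w => ∫⁻ z, F z ^ a * G (z + w) ^ b ∂μ :=
    Measurable.lintegral_prod_right (by unfold Function.uncurry; fun_prop)
  calc (∫⁻ w, (∫⁻ z, F z * G (z + w) ∂μ) ^ r ∂μ) ^ (1 / r)
      ≤ (∫⁻ w, (∫⁻ z, F z ^ a * G (z + w) ^ b ∂μ) *
          (A ^ (1 / a - 1 / r) * B ^ (1 / b - 1 / r)) ^ r ∂μ) ^ (1 / r) := by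
        gcongr with w
        exact pointwise w
    _ = (A ^ (1 / r) * A ^ (1 / a - 1 / r)) * (B ^ (1 / r) * B ^ (1 / b - 1 / r)) := by
        rw [lintegral_mul_const _ hjoint,
          lintegral_lintegral_mul_add (hF.pow_const a) (hG.pow_const b),
          ENNReal.mul_rpow_of_nonneg _ _ hr', one_div r, ENNReal.rpow_rpow_inv hr.ne',
          ENNReal.mul_rpow_of_nonneg _ _ (inv_nonneg.2 hr.le)]
        ring
    _ = _ := by
        rw [rpow_mul_rpow_sub _ hr' (by linarith [(div_le_one (by positivity)).2 hb]),
          rpow_mul_rpow_sub _ hr' (by linarith [(div_le_one (by positivity)).2 ha])]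

end Correlation

section MixedNorm

variable {X Y : Type*} [MeasureSpace X] [MeasureSpace Y]

/-- The mixed Lebesgue norm of a nonnegative function on `X × Y`: the `L^p` norm in the first
variable, followed by the `L^q` norm in the second. -/
def mixedNorm (p q : ℝ) (F : X → Y → ℝ≥0∞) : ℝ≥0∞ :=
  (∫⁻ y, (∫⁻ x, F x y ^ p) ^ (q / p)) ^ (1 / q)

theorem mixedNorm_eq_iterated (p q : ℝ) (F : X → Y → ℝ≥0∞) :
    mixedNorm p q F = (∫⁻ y, ((∫⁻ x, F x y ^ p) ^ (1 / p)) ^ q) ^ (1 / q) := by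
  simp_rw [mixedNorm, ← ENNReal.rpow_mul, one_div_mul_eq_div]

theorem mixedNorm_mono {p q : ℝ} (hp : 0 ≤ p) (hq : 0 ≤ q) {F G : X → Y → ℝ≥0∞}
    (h : ∀ x y, F x y ≤ G x y) : mixedNorm p q F ≤ mixedNorm p q G := by
  unfold mixedNorm
  gcongr with y x
  exact h x y

theorem mixedNorm_const_mul {p q : ℝ} (hp : 0 < p) (hq : 0 < q) {c : ℝ≥0∞} (hc : c ≠ ∞)
    (F : X → Y → ℝ≥0∞) : mixedNorm p q (fun x y => c * F x y) = c * mixedNorm p q F := by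
  have hc_top {r : ℝ} (hr : 0 < r) : c ^ r ≠ ∞ := ENNReal.rpow_ne_top_of_nonneg hr.le hc
  unfold mixedNorm
  simp_rw [ENNReal.mul_rpow_of_nonneg _ _ hp.le, lintegral_const_mul' _ _ (hc_top hp),
    ENNReal.mul_rpow_of_nonneg _ _ (div_pos hq hp).le, ← ENNReal.rpow_mul,
    mul_div_cancel₀ q hp.ne']
  rw [lintegral_const_mul' _ _ (hc_top hq), ENNReal.mul_rpow_of_nonneg _ _ (by positivity),
    ← ENNReal.rpow_mul, mul_one_div_cancel hq.ne', ENNReal.rpow_one]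

theorem mixedNorm_rpow {p q r : ℝ} (hr : r ≠ 0) (F : X → Y → ℝ≥0∞) :
    mixedNorm (p / r) (q / r) (fun x y => F x y ^ r) = mixedNorm p q F ^ r := by
  simp_rw [mixedNorm, ← ENNReal.rpow_mul, mul_div_cancel₀ p hr, div_div_div_cancel_right₀ hr,
    one_div_div, one_div_mul_eq_div]

variable [AddCommGroup X] [MeasurableAdd₂ X] [(volume : Measure X).IsAddLeftInvariant]
  [AddCommGroup Y] [MeasurableAdd₂ Y] [(volume : Measure Y).IsAddLeftInvariant]

theorem mixedNorm_correlation_le [SigmaFinite (volume : Measure X)]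
    [SFinite (volume : Measure Y)] {a b c d r t : ℝ} (ha : 1 ≤ a) (hb : 1 ≤ b) (hc : 1 ≤ c)
    (hd : 1 ≤ d) (hr : 1 ≤ r) (ht : 0 < t) (hacr : 1 / a + 1 / c = 1 + 1 / r)
    (hbdt : 1 / b + 1 / d = 1 + 1 / t) {F G : X → Y → ℝ≥0∞}
    (hF : Measurable (Function.uncurry F)) (hG : Measurable (Function.uncurry G)) :
    mixedNorm r t (fun x y => ∫⁻ y', ∫⁻ x', F x' y' * G (x' + x) (y' + y)) ≤
      mixedNorm a b F * mixedNorm c d G := by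
  have hinner (y : Y) :
      (∫⁻ x, (∫⁻ y', ∫⁻ x', F x' y' * G (x' + x) (y' + y)) ^ r) ^ (1 / r) ≤
        ∫⁻ y', (∫⁻ x, F x y' ^ a) ^ (1 / a) * (∫⁻ x, G x (y' + y) ^ c) ^ (1 / c) := by
    refine (lintegral_rpow_lintegral_le hr ?_).trans (lintegral_mono fun y' => ?_)
    · exact Measurable.lintegral_prod_right (f := fun (z : X × Y) x' =>
        F x' z.2 * G (x' + z.1) (z.2 + y))
        ((hF.comp (by fun_prop : Measurable fun z : (X × Y) × X => (z.2, z.1.2))).mul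
          (hG.comp (by fun_prop : Measurable fun z : (X × Y) × X => (z.2 + z.1.1, z.1.2 + y))))
    · exact lintegral_correlation_rpow_le ha hc (by positivity) hacr hF.of_uncurry_right
        hG.of_uncurry_right
  simp_rw [mixedNorm_eq_iterated]
  refine le_trans ?_ (lintegral_correlation_rpow_le hb hd ht hbdt
    ((hF.pow_const a).lintegral_prod_left'.pow_const _)
    ((hG.pow_const c).lintegral_prod_left'.pow_const _))
  gcongr with y
  exact hinner y

theorem mixedNorm_swap_correlation_le [SFinite (volume : Measure X)]
    [SigmaFinite (volume : Measure Y)] {a b c d r t : ℝ} (ha : 1 ≤ a) (hb : 1 ≤ b) (hc : 1 ≤ c)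
    (hd : 1 ≤ d) (hr : 1 ≤ r) (ht : 0 < t) (hacr : 1 / a + 1 / c = 1 + 1 / r)
    (hbdt : 1 / b + 1 / d = 1 + 1 / t) {F G : X → Y → ℝ≥0∞}
    (hF : Measurable (Function.uncurry F)) (hG : Measurable (Function.uncurry G)) :
    mixedNorm r t (fun y x => ∫⁻ y', ∫⁻ x', F x' y' * G (x' + x) (y' + y)) ≤
      mixedNorm a b (fun y x => F x y) * mixedNorm c d (fun y x => G x y) := by
  refine le_trans (le_of_eq ?_) (mixedNorm_correlation_le ha hb hc hd hr ht hacr hbdt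
    (hF.comp measurable_swap) (hG.comp measurable_swap))
  congr 1 with y x
  exact lintegral_lintegral_swap ((hF.comp measurable_swap).mul
    (hG.comp (by fun_prop : Measurable fun z : Y × X => (z.2 + x, z.1 + y)))).aemeasurable

end MixedNorm

section Product

variable {ι κ : Type*} [Fintype ι] [Fintype κ]

@[simp] theorem join_fstL_sndL (z : EuclideanSpace ℝ (ι ⊕ κ)) : join (fstL z) (sndL z) = z := by
  ext i; cases i <;> rfl

@[simp] theorem fstL_join (x : EuclideanSpace ℝ ι) (y : EuclideanSpace ℝ κ) :
    fstL (join x y) = x := rfl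

@[simp] theorem sndL_join (x : EuclideanSpace ℝ ι) (y : EuclideanSpace ℝ κ) :
    sndL (join x y) = y := rfl

theorem norm_fst_le (x : EuclideanSpace ℝ ι) (y : EuclideanSpace ℝ κ) : ‖x‖ ≤ ‖join x y‖ := by
  refine le_of_sq_le_sq ?_ (norm_nonneg _)
  rw [norm_join_sq]
  exact le_add_of_nonneg_right (sq_nonneg _)

theorem norm_join_le (x : EuclideanSpace ℝ ι) (y : EuclideanSpace ℝ κ) :
    ‖join x y‖ ≤ ‖x‖ + ‖y‖ := by
  refine le_of_sq_le_sq ?_ (by positivity)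
  rw [norm_join_sq]
  nlinarith [norm_nonneg x, norm_nonneg y]

theorem norm_fstL_le : ‖(fstL : EuclideanSpace ℝ (ι ⊕ κ) →L[ℝ] EuclideanSpace ℝ ι)‖ ≤ 1 :=
  ContinuousLinearMap.opNorm_le_bound _ zero_le_one fun z => by
    simpa using norm_fst_le (fstL z) (sndL z)

theorem norm_sndL_le : ‖(sndL : EuclideanSpace ℝ (ι ⊕ κ) →L[ℝ] EuclideanSpace ℝ κ)‖ ≤ 1 :=
  ContinuousLinearMap.opNorm_le_bound _ zero_le_one fun z => by
    simpa using norm_snd_le (fstL z) (sndL z)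

theorem norm_le_one_add_norm_mul (z : EuclideanSpace ℝ (ι ⊕ κ)) :
    ‖z‖ ≤ (1 + ‖fstL z‖) * (1 + ‖sndL z‖) := by
  have := norm_join_le (fstL z) (sndL z)
  rw [join_fstL_sndL] at this
  nlinarith [norm_nonneg (fstL z), norm_nonneg (sndL z)]

end Product

section TensorProduct

variable {V W W' : Type*} [NormedAddCommGroup V] [NormedSpace ℝ V] [NormedAddCommGroup W]
  [NormedSpace ℝ W] [NormedAddCommGroup W'] [NormedSpace ℝ W']

theorem norm_iteratedFDeriv_comp_le {L : V →L[ℝ] W} (hL : ‖L‖ ≤ 1) (φ : 𝓢(W, ℂ)) (n : ℕ) (z : V) :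
    ‖iteratedFDeriv ℝ n (fun z => φ (L z)) z‖ ≤ ‖iteratedFDeriv ℝ n φ (L z)‖ := by
  rw [show (fun z => φ (L z)) = φ ∘ L from rfl,
    ContinuousLinearMap.iteratedFDeriv_comp_right _ (φ.smooth n) _ le_rfl]
  exact (ContinuousMultilinearMap.norm_compContinuousLinearMap_le _ _).trans
    (mul_le_of_le_one_right (norm_nonneg _)
      (Finset.prod_le_one (fun _ _ => norm_nonneg _) fun _ _ => hL))

theorem exists_one_add_norm_pow_mul_iteratedFDeriv_le (φ : 𝓢(V, ℂ)) (k n : ℕ) :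
    ∃ C : ℝ, 0 ≤ C ∧ ∀ x, (1 + ‖x‖) ^ k * ‖iteratedFDeriv ℝ n φ x‖ ≤ C :=
  ⟨_, by positivity, fun x => SchwartzMap.one_add_le_sup_seminorm_apply (𝕜 := ℂ) (m := (k, n))
    (k := k) (n := n) le_rfl le_rfl φ x⟩

theorem norm_iteratedFDeriv_mul_comp_le {L : V →L[ℝ] W} {L' : V →L[ℝ] W'} (hL : ‖L‖ ≤ 1)
    (hL' : ‖L'‖ ≤ 1) (φ : 𝓢(W, ℂ)) (ψ : 𝓢(W', ℂ)) (n : ℕ) (z : V) :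
    ‖iteratedFDeriv ℝ n (fun z => φ (L z) * ψ (L' z)) z‖ ≤ ∑ i ∈ Finset.range (n + 1),
      (n.choose i : ℝ) * ‖iteratedFDeriv ℝ i φ (L z)‖ * ‖iteratedFDeriv ℝ (n - i) ψ (L' z)‖ := by
  refine (norm_iteratedFDeriv_mul_le (𝕜 := ℝ) (N := (⊤ : ℕ∞)) (n := n)
    ((φ.smooth ⊤).comp L.contDiff) ((ψ.smooth ⊤).comp L'.contDiff) z
    (by exact_mod_cast le_top)).trans (Finset.sum_le_sum fun i _ => ?_)
  gcongr
  · exact norm_iteratedFDeriv_comp_le hL φ i z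
  · exact norm_iteratedFDeriv_comp_le hL' ψ (n - i) z

theorem exists_norm_pow_mul_iteratedFDeriv_mul_comp_le {L : V →L[ℝ] W} {L' : V →L[ℝ] W'}
    (hL : ‖L‖ ≤ 1) (hL' : ‖L'‖ ≤ 1) (hLL' : ∀ z, ‖z‖ ≤ (1 + ‖L z‖) * (1 + ‖L' z‖))
    (φ : 𝓢(W, ℂ)) (ψ : 𝓢(W', ℂ)) (k n : ℕ) :
    ∃ C : ℝ, ∀ z : V, ‖z‖ ^ k * ‖iteratedFDeriv ℝ n (fun z => φ (L z) * ψ (L' z)) z‖ ≤ C := by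
  choose A hA0 hA using fun i => exists_one_add_norm_pow_mul_iteratedFDeriv_le φ k i
  choose B _ hB using fun i => exists_one_add_norm_pow_mul_iteratedFDeriv_le ψ k i
  refine ⟨∑ i ∈ Finset.range (n + 1), (n.choose i : ℝ) * A i * B (n - i), fun z => ?_⟩
  calc ‖z‖ ^ k * ‖iteratedFDeriv ℝ n (fun z => φ (L z) * ψ (L' z)) z‖
      ≤ ((1 + ‖L z‖) * (1 + ‖L' z‖)) ^ k * ∑ i ∈ Finset.range (n + 1),
          (n.choose i : ℝ) * ‖iteratedFDeriv ℝ i φ (L z)‖ *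
            ‖iteratedFDeriv ℝ (n - i) ψ (L' z)‖ := by
        gcongr
        · exact hLL' z
        · exact norm_iteratedFDeriv_mul_comp_le hL hL' φ ψ n z
    _ = ∑ i ∈ Finset.range (n + 1), (n.choose i : ℝ) *
          ((1 + ‖L z‖) ^ k * ‖iteratedFDeriv ℝ i φ (L z)‖) *
          ((1 + ‖L' z‖) ^ k * ‖iteratedFDeriv ℝ (n - i) ψ (L' z)‖) := by
        rw [Finset.mul_sum, mul_pow]
        exact Finset.sum_congr rfl fun i _ => by ring
    _ ≤ _ := by
        gcongr with i
        · exact mul_nonneg (Nat.cast_nonneg _) (hA0 i)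
        · exact hA i _
        · exact hB _ _

variable {ι κ : Type*} [Fintype ι] [Fintype κ]

/-- The tensor product `(x, y) ↦ φ(x) ψ(y)` of two Schwartz functions. -/
def tensorSchwartz (φ : 𝓢(EuclideanSpace ℝ ι, ℂ)) (ψ : 𝓢(EuclideanSpace ℝ κ, ℂ)) :
    𝓢(EuclideanSpace ℝ (ι ⊕ κ), ℂ) where
  toFun z := φ (fstL z) * ψ (sndL z)
  smooth' := ((φ.smooth ⊤).comp (fstL (ι := ι) (κ := κ)).contDiff).mul
    ((ψ.smooth ⊤).comp (sndL (ι := ι) (κ := κ)).contDiff)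
  decay' := exists_norm_pow_mul_iteratedFDeriv_mul_comp_le (V := EuclideanSpace ℝ (ι ⊕ κ))
    (W := EuclideanSpace ℝ ι) (W' := EuclideanSpace ℝ κ) (L := fstL) (L' := sndL)
    norm_fstL_le norm_sndL_le norm_le_one_add_norm_mul φ ψ

@[simp] theorem tensorSchwartz_apply (φ : 𝓢(EuclideanSpace ℝ ι, ℂ)) (ψ : 𝓢(EuclideanSpace ℝ κ, ℂ))
    (z : EuclideanSpace ℝ (ι ⊕ κ)) : tensorSchwartz φ ψ z = φ (fstL z) * ψ (sndL z) := rfl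

end TensorProduct

section WeightedJet

variable {V : Type*} [NormedAddCommGroup V] [NormedSpace ℝ V]

/-- The Banach space of bounded continuous functions on `V` whose values are `l`-linear forms. -/
def BoundedForms (V : Type*) [NormedAddCommGroup V] [NormedSpace ℝ V] (l : ℕ) : Type _ :=
  BoundedContinuousFunction V (V [×l]→L[ℝ] ℂ)

instance (l : ℕ) : NormedAddCommGroup (BoundedForms V l) :=
  inferInstanceAs (NormedAddCommGroup (BoundedContinuousFunction V (V [×l]→L[ℝ] ℂ)))

instance (l : ℕ) : CompleteSpace (BoundedForms V l) :=
  inferInstanceAs (CompleteSpace (BoundedContinuousFunction V (V [×l]→L[ℝ] ℂ)))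

instance (l : ℕ) : NormedSpace ℂ (BoundedForms V l) :=
  inferInstanceAs (NormedSpace ℂ (BoundedContinuousFunction V (V [×l]→L[ℝ] ℂ)))

/-- The value of a bounded form-valued function at `x`, applied to the vectors `m`. -/
def BoundedForms.evalCLM {l : ℕ} (x : V) (m : Fin l → V) : BoundedForms V l →L[ℝ] ℂ :=
  (ContinuousMultilinearMap.apply ℝ (fun _ => V) ℂ m).comp
    (BoundedContinuousFunction.evalCLM ℝ x :
      BoundedContinuousFunction V (V [×l]→L[ℝ] ℂ) →L[ℝ] V [×l]→L[ℝ] ℂ)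

theorem BoundedForms.ext {l : ℕ} {f g : BoundedForms V l}
    (h : ∀ x m, evalCLM x m f = evalCLM x m g) : f = g :=
  BoundedContinuousFunction.ext fun x => ContinuousMultilinearMap.ext (h x)

/-- The weighted derivative `x ↦ ‖x‖ ^ k D^l φ(x)` of a Schwartz function. These maps embed
`𝓢(V, ℂ)` into Banach spaces, where Bochner integrals are available. -/
def weightedJet (k l : ℕ) : 𝓢(V, ℂ) →ₗ[ℂ] BoundedForms V l where
  toFun φ := BoundedContinuousFunction.ofNormedAddCommGroup
    (fun x => ‖x‖ ^ k • iteratedFDeriv ℝ l φ x)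
    ((continuous_norm.pow k).smul ((φ.smooth l).continuous_iteratedFDeriv le_rfl))
    (SchwartzMap.seminorm ℂ k l φ) fun x => by
      simpa [norm_smul] using SchwartzMap.le_seminorm ℂ k l φ x
  map_add' φ ψ := by
    refine BoundedContinuousFunction.ext fun x => ?_
    change ‖x‖ ^ k • iteratedFDeriv ℝ l (⇑φ + ⇑ψ) x = _
    rw [iteratedFDeriv_add_apply (φ.smooth l).contDiffAt (ψ.smooth l).contDiffAt, smul_add]
    rfl
  map_smul' c φ := by
    refine BoundedContinuousFunction.ext fun x => ?_
    change ‖x‖ ^ k • iteratedFDeriv ℝ l (c • ⇑φ) x = _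
    rw [iteratedFDeriv_const_smul_apply (φ.smooth l).contDiffAt, smul_comm]
    rfl

theorem evalCLM_weightedJet (k l : ℕ) (φ : 𝓢(V, ℂ)) (x : V) (m : Fin l → V) :
    BoundedForms.evalCLM x m (weightedJet k l φ) = ‖x‖ ^ k • iteratedFDeriv ℝ l φ x m := rfl

theorem norm_weightedJet (k l : ℕ) (φ : 𝓢(V, ℂ)) :
    ‖weightedJet k l φ‖ = SchwartzMap.seminorm ℂ k l φ := by
  let J : BoundedContinuousFunction V (V [×l]→L[ℝ] ℂ) := weightedJet k l φ
  have norm_apply (x : V) : ‖J x‖ = ‖x‖ ^ k * ‖iteratedFDeriv ℝ l φ x‖ :=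
    (norm_smul _ _).trans (by simp)
  refine le_antisymm ((BoundedContinuousFunction.norm_le (f := J) (apply_nonneg _ _)).2 fun x => ?_)
    (SchwartzMap.seminorm_le_bound ℂ k l φ (norm_nonneg J) fun x => ?_)
  · exact (norm_apply x).trans_le (SchwartzMap.le_seminorm ℂ k l φ x)
  · exact (norm_apply x).symm.trans_le (BoundedContinuousFunction.norm_coe_le_norm J x)

theorem exists_factor_of_norm_le {S E : Type*} [AddCommGroup S] [Module ℂ S]
    [NormedAddCommGroup E] [NormedSpace ℂ E] (J : S →ₗ[ℂ] E) (f : S →ₗ[ℂ] ℂ) (C : ℝ)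
    (hf : ∀ φ, ‖f φ‖ ≤ C * ‖J φ‖) : ∃ F : E →L[ℂ] ℂ, ∀ φ, F (J φ) = f φ := by
  have hker : J.ker ≤ f.ker := fun φ hφ => by
    simpa [LinearMap.mem_ker.1 hφ] using hf φ
  let g₀ : J.range →ₗ[ℂ] ℂ := (J.ker.liftQ f hker) ∘ₗ J.quotKerEquivRange.symm.toLinearMap
  have hg₀ (φ : S) : g₀ ⟨J φ, LinearMap.mem_range_self _ φ⟩ = f φ := by
    simp only [g₀, LinearMap.comp_apply, LinearEquiv.coe_coe]
    rw [LinearMap.quotKerEquivRange_symm_apply_image]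
    rfl
  let g : J.range →L[ℂ] ℂ := g₀.mkContinuous C (by
    rintro ⟨_, φ, rfl⟩
    exact (hg₀ φ).symm ▸ hf φ)
  obtain ⟨F, hF, -⟩ := exists_extension_norm_eq _ g
  exact ⟨F, fun φ => (hF ⟨J φ, LinearMap.mem_range_self _ φ⟩).trans (hg₀ φ)⟩

theorem exists_factor_weightedJet (f : 𝓢(V, ℂ) →L[ℂ] ℂ) :
    ∃ (s : Finset (ℕ × ℕ))
      (F : ((i : s) → BoundedForms V i.1.2) →L[ℂ] ℂ),
      ∀ φ, F (fun i => weightedJet i.1.1 i.1.2 φ) = f φ := by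
  obtain ⟨s, C, -, hC⟩ := Seminorm.bound_of_continuous (schwartz_withSeminorms ℂ V ℂ)
    ((normSeminorm ℂ ℂ).comp f.toLinearMap) (continuous_norm.comp f.continuous)
  let J : 𝓢(V, ℂ) →ₗ[ℂ] (i : s) → BoundedForms V i.1.2 :=
    LinearMap.pi fun i => weightedJet i.1.1 i.1.2
  refine ⟨s, exists_factor_of_norm_le J f.toLinearMap C fun φ =>
    (hC φ).trans (mul_le_mul_of_nonneg_left ?_ C.2)⟩
  refine Seminorm.finset_sup_apply_le (norm_nonneg _) fun i hi => ?_
  exact (norm_weightedJet i.1 i.2 φ).symm.trans_le (norm_le_pi_norm (J φ) ⟨i, hi⟩)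

theorem seminorm_lineDerivOp_le (Φ : 𝓢(V, ℂ)) (h : V) (k l : ℕ) :
    SchwartzMap.seminorm ℂ k l (∂_{h} Φ : 𝓢(V, ℂ)) ≤ SchwartzMap.seminorm ℂ k (l + 1) Φ * ‖h‖ := by
  refine SchwartzMap.seminorm_le_bound ℂ k l _ (by positivity) fun x => ?_
  rw [iteratedFDeriv_lineDerivOp]
  calc ‖x‖ ^ k * ‖fderiv ℝ (iteratedFDeriv ℝ l Φ) x h‖
      ≤ ‖x‖ ^ k * (‖iteratedFDeriv ℝ (l + 1) Φ x‖ * ‖h‖) := by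
        gcongr
        rw [← norm_fderiv_iteratedFDeriv]
        exact ContinuousLinearMap.le_opNorm _ _
    _ = (‖x‖ ^ k * ‖iteratedFDeriv ℝ (l + 1) Φ x‖) * ‖h‖ := by ring
    _ ≤ _ := by gcongr; exact SchwartzMap.le_seminorm ℂ k (l + 1) Φ x

theorem tendsto_seminorm_translation (Φ : 𝓢(V, ℂ)) (k l : ℕ) :
    Filter.Tendsto (fun h : V => SchwartzMap.seminorm ℂ k l (Φ.compSubConstCLM ℂ (-h) - Φ))
      (nhds 0) (nhds 0) := by
  obtain ⟨C, -, hC⟩ := exists_seminorm_translation_le Φ k l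
  have hlim : Filter.Tendsto (fun h : V => C * ‖h‖ ^ 2 + SchwartzMap.seminorm ℂ k (l + 1) Φ * ‖h‖)
      (nhds 0) (nhds 0) :=
    Continuous.tendsto' (by fun_prop) _ _ (by simp)
  refine squeeze_zero' (.of_forall fun h => apply_nonneg _ _) ?_ hlim
  filter_upwards [Metric.closedBall_mem_nhds (0 : V) one_pos] with h hh
  calc SchwartzMap.seminorm ℂ k l (Φ.compSubConstCLM ℂ (-h) - Φ)
      = SchwartzMap.seminorm ℂ k l ((Φ.compSubConstCLM ℂ (-h) - Φ - ∂_{h} Φ) + ∂_{h} Φ) := by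
        rw [sub_add_cancel]
    _ ≤ _ := (map_add_le_add _ _ _).trans
        (add_le_add (hC h (by simpa using hh)) (seminorm_lineDerivOp_le Φ h k l))

end WeightedJet

section DistributionIntegral

variable {ι κ : Type*} [Fintype ι] [Fintype κ]

theorem norm_iteratedFDeriv_sectionCLM_le (Φ : 𝓢(EuclideanSpace ℝ (κ ⊕ ι), ℂ)) (l : ℕ)
    (y : EuclideanSpace ℝ κ) (t : EuclideanSpace ℝ ι) :
    ‖iteratedFDeriv ℝ l (sectionCLM y Φ) t‖ ≤ ‖iteratedFDeriv ℝ l Φ (join y t)‖ := by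
  have hsection : ⇑(sectionCLM y Φ) = fun t => Φ.compSubConstCLM ℂ (-inlL y) (inrL t) := by
    ext t
    simp [join_eq]
  rw [hsection]
  refine (norm_iteratedFDeriv_comp_le (L := (inrL (ι := κ) (κ := ι))) norm_inrL_le _ l t).trans_eq
    ?_
  change ‖iteratedFDeriv ℝ l (fun z => Φ (z - -inlL y)) (inrL t)‖ = _
  rw [iteratedFDeriv_comp_sub, sub_neg_eq_add, ← join_eq]

theorem exists_integrable_seminorm_sectionCLM_le (Φ : 𝓢(EuclideanSpace ℝ (κ ⊕ ι), ℂ)) (k l : ℕ) :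
    ∃ b : EuclideanSpace ℝ κ → ℝ, Integrable b ∧
      ∀ y, SchwartzMap.seminorm ℂ k l (sectionCLM y Φ) ≤ b y := by
  let N := (volume : Measure (EuclideanSpace ℝ κ)).integrablePower
  obtain ⟨C, hC0, hC⟩ := exists_one_add_norm_pow_mul_iteratedFDeriv_le Φ (N + k) l
  refine ⟨fun y => (1 + ‖y‖) ^ (-(N : ℝ)) * C,
    (Measure.integrable_pow_neg_integrablePower volume).mul_const C, fun y => ?_⟩
  refine SchwartzMap.seminorm_le_bound ℂ k l _ (by positivity) fun t => ?_
  beta_reduce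
  rw [Real.rpow_neg (by positivity), Real.rpow_natCast, ← div_eq_inv_mul,
    le_div_iff₀ (by positivity)]
  calc ‖t‖ ^ k * ‖iteratedFDeriv ℝ l (sectionCLM y Φ) t‖ * (1 + ‖y‖) ^ N
      ≤ (1 + ‖join y t‖) ^ k * ‖iteratedFDeriv ℝ l Φ (join y t)‖ * (1 + ‖join y t‖) ^ N := by
        gcongr
        · exact (norm_snd_le y t).trans (by linarith)
        · exact norm_iteratedFDeriv_sectionCLM_le Φ l y t
        · exact norm_fst_le y t
    _ = (1 + ‖join y t‖) ^ (N + k) * ‖iteratedFDeriv ℝ l Φ (join y t)‖ := by ring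
    _ ≤ C := hC (join y t)

theorem integrable_section (Φ : 𝓢(EuclideanSpace ℝ (κ ⊕ ι), ℂ)) (t : EuclideanSpace ℝ ι) :
    Integrable fun y => Φ (join y t) := by
  obtain ⟨b, hb, hΦb⟩ := exists_integrable_seminorm_sectionCLM_le Φ 0 0
  refine hb.mono' ?_ (.of_forall fun y =>
    (SchwartzMap.norm_le_seminorm ℂ (sectionCLM y Φ) t).trans (hΦb y))
  simp_rw [join_eq]
  exact (Φ.continuous.comp (by fun_prop)).aestronglyMeasurable

theorem lineDerivOp_integral_section {Φ : 𝓢(EuclideanSpace ℝ (κ ⊕ ι), ℂ)}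
    {φ : 𝓢(EuclideanSpace ℝ ι, ℂ)} (h : ∀ t, φ t = ∫ y, Φ (join y t)) (v : EuclideanSpace ℝ ι)
    (t : EuclideanSpace ℝ ι) :
    (∂_{v} φ : 𝓢(EuclideanSpace ℝ ι, ℂ)) t =
      ∫ y, (∂_{inrL (ι := κ) v} Φ : 𝓢(EuclideanSpace ℝ (κ ⊕ ι), ℂ)) (join y t) := by
  have hasDerivAt_line (ψ : 𝓢(EuclideanSpace ℝ ι, ℂ)) (r : ℝ) :
      HasDerivAt (fun r : ℝ => ψ (t + r • v)) ((∂_{v} ψ : 𝓢(EuclideanSpace ℝ ι, ℂ)) (t + r • v))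
        r := by
    have hline : HasDerivAt (fun r : ℝ => t + r • v) v r := by
      simpa using ((hasDerivAt_id r).smul_const v).const_add t
    rw [SchwartzMap.lineDerivOp_apply_eq_fderiv]
    exact (ψ.hasFDerivAt (t + r • v)).comp_hasDerivAt r hline
  obtain ⟨b, hb, hΦb⟩ := exists_integrable_seminorm_sectionCLM_le (∂_{inrL (ι := κ) v} Φ) 0 0
  have hderiv := (hasDerivAt_integral_of_dominated_loc_of_deriv_le (𝕜 := ℝ) (μ := volume)
    (x₀ := (0 : ℝ)) (s := Set.univ) (F := fun r y => Φ (join y (t + r • v)))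
    (F' := fun r y =>
      (∂_{inrL (ι := κ) v} Φ : 𝓢(EuclideanSpace ℝ (κ ⊕ ι), ℂ)) (join y (t + r • v)))
    (bound := b) Filter.univ_mem
    (.of_forall fun r => (integrable_section Φ _).aestronglyMeasurable)
    (integrable_section Φ _) (integrable_section _ _).aestronglyMeasurable
    (.of_forall fun y r _ =>
      (SchwartzMap.norm_le_seminorm ℂ (sectionCLM y (∂_{inrL (ι := κ) v} Φ)) _).trans (hΦb y)) hb
    (.of_forall fun y r _ => by
      have := hasDerivAt_line (sectionCLM y Φ) r
      rwa [← sectionCLM_lineDerivOp_inrL] at this)).2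
  simp_rw [← h] at hderiv
  simpa using (hasDerivAt_line φ 0).unique hderiv

theorem exists_section_eq_iteratedLineDerivOp {Φ : 𝓢(EuclideanSpace ℝ (κ ⊕ ι), ℂ)}
    {φ : 𝓢(EuclideanSpace ℝ ι, ℂ)} (h : ∀ t, φ t = ∫ y, Φ (join y t)) {n : ℕ}
    (m : Fin n → EuclideanSpace ℝ ι) :
    ∃ Ψ : 𝓢(EuclideanSpace ℝ (κ ⊕ ι), ℂ), (∀ y, sectionCLM y Ψ = ∂^{m} (sectionCLM y Φ)) ∧
      ∀ t, (∂^{m} φ : 𝓢(EuclideanSpace ℝ ι, ℂ)) t = ∫ y, Ψ (join y t) := by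
  induction n with
  | zero => exact ⟨Φ, fun y => by simp, fun t => by simpa using h t⟩
  | succ n ih =>
    obtain ⟨Ψ, hΨ, hφΨ⟩ := ih (Fin.tail m)
    refine ⟨∂_{inrL (ι := κ) (m 0)} Ψ, fun y => ?_, fun t => ?_⟩
    · rw [sectionCLM_lineDerivOp_inrL, hΨ, LineDeriv.iteratedLineDerivOp_succ_left]
    · rw [LineDeriv.iteratedLineDerivOp_succ_left, lineDerivOp_integral_section hφΨ]

theorem iteratedFDeriv_integral_section {Φ : 𝓢(EuclideanSpace ℝ (κ ⊕ ι), ℂ)}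
    {φ : 𝓢(EuclideanSpace ℝ ι, ℂ)} (h : ∀ t, φ t = ∫ y, Φ (join y t)) {n : ℕ}
    (t : EuclideanSpace ℝ ι) (m : Fin n → EuclideanSpace ℝ ι) :
    iteratedFDeriv ℝ n φ t m = ∫ y, iteratedFDeriv ℝ n (sectionCLM y Φ) t m := by
  obtain ⟨Ψ, hΨ, hφΨ⟩ := exists_section_eq_iteratedLineDerivOp h m
  simp_rw [← SchwartzMap.iteratedLineDerivOp_eq_iteratedFDeriv, hφΨ, ← hΨ, sectionCLM_apply]

theorem continuous_weightedJet_sectionCLM (k l : ℕ) (Φ : 𝓢(EuclideanSpace ℝ (κ ⊕ ι), ℂ)) :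
    Continuous fun y : EuclideanSpace ℝ κ => weightedJet k l (sectionCLM y Φ) := by
  refine continuous_iff_continuousAt.2 fun y₀ => ?_
  rw [ContinuousAt, tendsto_iff_norm_sub_tendsto_zero]
  have hsub (y : EuclideanSpace ℝ κ) : sectionCLM y Φ - sectionCLM y₀ Φ =
      sectionCLM y₀ (Φ.compSubConstCLM ℂ (-(inlL (κ := ι) (y - y₀))) - Φ) := by
    ext t
    simp only [sectionCLM_apply, map_sub, sub_apply, SchwartzMap.compSubConstCLM_apply]
    congr 2
    ext i; cases i <;> simp [inlL_apply]
  refine squeeze_zero (fun _ => norm_nonneg _) (fun y => ?_)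
    ((tendsto_seminorm_translation Φ k l).comp (Continuous.tendsto' (by fun_prop) y₀ 0 (by simp) :
      Filter.Tendsto (fun y => inlL (κ := ι) (y - y₀)) (nhds y₀) (nhds 0)))
  rw [← map_sub, norm_weightedJet, hsub]
  exact seminorm_sectionCLM_le _ _ _ _

theorem integrable_weightedJet_sectionCLM (k l : ℕ) (Φ : 𝓢(EuclideanSpace ℝ (κ ⊕ ι), ℂ)) :
    Integrable fun y : EuclideanSpace ℝ κ => weightedJet k l (sectionCLM y Φ) := by
  obtain ⟨b, hb, hΦb⟩ := exists_integrable_seminorm_sectionCLM_le Φ k l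
  exact hb.mono' (continuous_weightedJet_sectionCLM k l Φ).aestronglyMeasurable
    (.of_forall fun y => (norm_weightedJet k l _).trans_le (hΦb y))

theorem weightedJet_integral_section (k l : ℕ) {Φ : 𝓢(EuclideanSpace ℝ (κ ⊕ ι), ℂ)}
    {φ : 𝓢(EuclideanSpace ℝ ι, ℂ)} (h : ∀ t, φ t = ∫ y, Φ (join y t)) :
    weightedJet k l φ = ∫ y, weightedJet k l (sectionCLM y Φ) := by
  refine BoundedForms.ext fun x m => ?_
  rw [← ContinuousLinearMap.integral_comp_comm _ (integrable_weightedJet_sectionCLM k l Φ)]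
  simp_rw [evalCLM_weightedJet]
  rw [integral_smul, iteratedFDeriv_integral_section h]

theorem distribution_integral_section (f : 𝓢'(EuclideanSpace ℝ ι, ℂ))
    {Φ : 𝓢(EuclideanSpace ℝ (κ ⊕ ι), ℂ)} {φ : 𝓢(EuclideanSpace ℝ ι, ℂ)}
    (h : ∀ t, φ t = ∫ y, Φ (join y t)) : f φ = ∫ y, f (sectionCLM y Φ) := by
  obtain ⟨s, F, hF⟩ := exists_factor_weightedJet (f : 𝓢(EuclideanSpace ℝ ι, ℂ) →L[ℂ] ℂ)
  have jet_integrable (i : s) := integrable_weightedJet_sectionCLM i.1.1 i.1.2 Φ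
  calc f φ = F (fun i => weightedJet i.1.1 i.1.2 φ) := (hF φ).symm
    _ = F (∫ y, fun i : s => weightedJet i.1.1 i.1.2 (sectionCLM y Φ)) := by
        congr 1
        ext1 i
        rw [eval_integral jet_integrable, weightedJet_integral_section _ _ h]
    _ = ∫ y, f (sectionCLM y Φ) := by
        rw [← F.integral_comp_comm (Integrable.of_eval jet_integrable)]
        exact integral_congr_ae (.of_forall fun y => hF _)

end DistributionIntegral

section Join

variable {ι κ : Type*}

theorem join_add_join (x x' : EuclideanSpace ℝ ι) (y y' : EuclideanSpace ℝ κ) :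
    join x y + join x' y' = join (x + x') (y + y') := by
  ext i; cases i <;> simp

theorem join_sub_join (x x' : EuclideanSpace ℝ ι) (y y' : EuclideanSpace ℝ κ) :
    join x y - join x' y' = join (x - x') (y - y') := by
  ext i; cases i <;> simp

variable [Fintype ι] [Fintype κ]

theorem inlL_add_inrL (x : EuclideanSpace ℝ ι) (y : EuclideanSpace ℝ κ) :
    inlL x + inrL y = join x y := by rw [join_eq, add_comm]

theorem inner_join (x x' : EuclideanSpace ℝ ι) (y y' : EuclideanSpace ℝ κ) :
    inner ℝ (join x y) (join x' y') = inner ℝ x x' + inner ℝ y y' := by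
  simp [PiLp.inner_apply]

/-- The identification of `ℝ^ι × ℝ^κ` with `ℝ^(ι ⊕ κ)`. -/
def joinEquiv : (EuclideanSpace ℝ ι × EuclideanSpace ℝ κ) ≃L[ℝ] EuclideanSpace ℝ (ι ⊕ κ) :=
  EuclideanSpace.sumEquivProd.symm

theorem joinEquiv_apply (p : EuclideanSpace ℝ ι × EuclideanSpace ℝ κ) :
    joinEquiv p = join p.1 p.2 := by
  ext i; cases i <;> rfl

theorem continuous_join :
    Continuous fun p : EuclideanSpace ℝ ι × EuclideanSpace ℝ κ => join p.1 p.2 :=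
  joinEquiv.continuous.congr joinEquiv_apply

theorem measurePreserving_join :
    MeasurePreserving fun p : EuclideanSpace ℝ ι × EuclideanSpace ℝ κ => join p.1 p.2 := by
  have toPi : MeasurePreserving (fun p : EuclideanSpace ℝ ι × EuclideanSpace ℝ κ =>
      (WithLp.ofLp p.1, WithLp.ofLp p.2)) :=
    (PiLp.volume_preserving_ofLp ι).prod (PiLp.volume_preserving_ofLp κ)
  have sumPi := volume_measurePreserving_sumPiEquivProdPi_symm (fun _ : ι ⊕ κ => ℝ)
  convert ((PiLp.volume_preserving_toLp (ι ⊕ κ)).comp sumPi).comp toPi using 1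
  ext p i
  cases i <;> rfl

theorem measurableEmbedding_join :
    MeasurableEmbedding fun p : EuclideanSpace ℝ ι × EuclideanSpace ℝ κ => join p.1 p.2 :=
  (funext joinEquiv_apply : ⇑(joinEquiv (ι := ι) (κ := κ)) = _) ▸
    joinEquiv.toHomeomorph.measurableEmbedding

theorem lintegral_join {F : EuclideanSpace ℝ (ι ⊕ κ) → ℝ≥0∞} (hF : Measurable F) :
    ∫⁻ z, F z = ∫⁻ y : EuclideanSpace ℝ κ, ∫⁻ x : EuclideanSpace ℝ ι, F (join x y) := by
  rw [← measurePreserving_join.lintegral_comp_emb measurableEmbedding_join]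
  exact lintegral_prod_symm' _ (hF.comp continuous_join.measurable)

theorem integral_join {F : EuclideanSpace ℝ (ι ⊕ κ) → ℂ} (hF : Integrable F) :
    ∫ z, F z = ∫ x : EuclideanSpace ℝ ι, ∫ y : EuclideanSpace ℝ κ, F (join x y) := by
  rw [← measurePreserving_join.integral_comp measurableEmbedding_join]
  refine integral_prod _ ?_
  exact (measurePreserving_join.integrable_comp_emb measurableEmbedding_join).2 hF

end Join

section Kernel

variable {ι : Type*} [Fintype ι]

theorem hasTemperateGrowth_fourierChar :
    (fun r : ℝ => ((Real.fourierChar r : Circle) : ℂ)).HasTemperateGrowth := by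
  let v : EuclideanSpace ℝ Unit := EuclideanSpace.single () 1
  convert (hasTemperateGrowth_char v).comp
    ((ContinuousLinearMap.id ℝ ℝ).smulRight v).hasTemperateGrowth using 1
  ext r
  simp [v, inner_smul_right]

/-- The quadratic character `((x, ω), t) ↦ e^{-2πi ω·t}`. -/
def kernelChar (w : EuclideanSpace ℝ ((ι ⊕ ι) ⊕ ι)) : ℂ :=
  ((Real.fourierChar (-inner ℝ (sndL (fstL w)) (sndL w)) : Circle) : ℂ)

theorem hasTemperateGrowth_kernelChar :
    (kernelChar : EuclideanSpace ℝ ((ι ⊕ ι) ⊕ ι) → ℂ).HasTemperateGrowth := by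
  have inner_growth : (fun w : EuclideanSpace ℝ ((ι ⊕ ι) ⊕ ι) =>
      inner ℝ (sndL (fstL w)) (sndL w)).HasTemperateGrowth :=
    (innerSL ℝ (E := EuclideanSpace ℝ ι)).bilinear_hasTemperateGrowth
      ((sndL (ι := ι) (κ := ι)).comp (fstL (ι := ι ⊕ ι) (κ := ι))).hasTemperateGrowth
      (sndL (ι := ι ⊕ ι) (κ := ι)).hasTemperateGrowth
  exact hasTemperateGrowth_fourierChar.comp inner_growth.neg

/-- The linear map `((x, ω), t) ↦ ((x, ω), t - x)`. -/
def kernelShear : EuclideanSpace ℝ ((ι ⊕ ι) ⊕ ι) ≃L[ℝ] EuclideanSpace ℝ ((ι ⊕ ι) ⊕ ι) :=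
  ContinuousLinearEquiv.equivOfInverse
    (inlL.comp fstL + inrL.comp (sndL - fstL.comp fstL))
    (inlL.comp fstL + inrL.comp (sndL + fstL.comp fstL))
    (fun w => by
      change inlL (fstL _) + inrL (sndL _ + fstL (fstL _)) = w
      ext i; rcases i with (i | i) | i <;> simp [inlL_apply, inrL_apply])
    (fun w => by
      change inlL (fstL _) + inrL (sndL _ - fstL (fstL _)) = w
      ext i; rcases i with (i | i) | i <;> simp [inlL_apply, inrL_apply])

theorem kernelShear_join (z : EuclideanSpace ℝ (ι ⊕ ι)) (t : EuclideanSpace ℝ ι) :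
    kernelShear (join z t) = join z (t - fstL z) :=
  inlL_add_inrL z (t - fstL z)

/-- The Schwartz function `(z, t) ↦ c(z) conj (π(z) g (t))`. -/
def stftKernel (c : 𝓢(EuclideanSpace ℝ (ι ⊕ ι), ℂ)) (g : 𝓢(EuclideanSpace ℝ ι, ℂ)) :
    𝓢(EuclideanSpace ℝ ((ι ⊕ ι) ⊕ ι), ℂ) :=
  SchwartzMap.smulLeftCLM ℂ kernelChar
    (SchwartzMap.compCLMOfContinuousLinearEquiv ℂ kernelShear (tensorSchwartz c (conjSchwartz g)))

theorem stftKernel_join (c : 𝓢(EuclideanSpace ℝ (ι ⊕ ι), ℂ)) (g : 𝓢(EuclideanSpace ℝ ι, ℂ))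
    (z : EuclideanSpace ℝ (ι ⊕ ι)) (t : EuclideanSpace ℝ ι) :
    stftKernel c g (join z t) = ((Real.fourierChar (-inner ℝ (sndL z) t) : Circle) : ℂ) *
      (c z * starRingEnd ℂ (g (t - fstL z))) := by
  rw [stftKernel, SchwartzMap.smulLeftCLM_apply_apply hasTemperateGrowth_kernelChar]
  simp only [SchwartzMap.compCLMOfContinuousLinearEquiv_apply, Function.comp_apply,
    kernelShear_join, tensorSchwartz_apply, fstL_join, sndL_join, conjSchwartz_apply, smul_eq_mul]
  rfl

theorem sectionCLM_stftKernel (c : 𝓢(EuclideanSpace ℝ (ι ⊕ ι), ℂ)) (g : 𝓢(EuclideanSpace ℝ ι, ℂ))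
    (z : EuclideanSpace ℝ (ι ⊕ ι)) :
    sectionCLM z (stftKernel c g) = c z • conjSchwartz (tfShift (fstL z) (sndL z) g) := by
  ext t
  rw [sectionCLM_apply, stftKernel_join, smul_apply, conjSchwartz_apply, tfShift_apply, map_mul,
    Circle.starRingEnd_addChar, smul_eq_mul]
  ring

theorem sliceCLM_stftKernel (c : 𝓢(EuclideanSpace ℝ (ι ⊕ ι), ℂ)) (g : 𝓢(EuclideanSpace ℝ ι, ℂ))
    (f : 𝓢'(EuclideanSpace ℝ ι, ℂ)) (z : EuclideanSpace ℝ (ι ⊕ ι)) :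
    sliceCLM f (stftKernel c g) z = c z * stft g f (fstL z) (sndL z) := by
  rw [sliceCLM_apply, sectionCLM_stftKernel, map_smul]; rfl

theorem continuous_stft_fstL_sndL (g : 𝓢(EuclideanSpace ℝ ι, ℂ)) (f : 𝓢'(EuclideanSpace ℝ ι, ℂ)) :
    Continuous fun z : EuclideanSpace ℝ (ι ⊕ ι) => stft g f (fstL z) (sndL z) := by
  refine continuous_iff_continuousAt.2 fun z₀ => ?_
  -- After multiplication by a cutoff equal to `1` near `z₀`, the transform is a Schwartz function.
  let b : ContDiffBump z₀ := ⟨1, 2, one_pos, one_lt_two⟩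
  have b_compact : HasCompactSupport fun z => ((b z : ℝ) : ℂ) :=
    b.hasCompactSupport.comp_left Complex.ofReal_zero
  let c : 𝓢(EuclideanSpace ℝ (ι ⊕ ι), ℂ) := b_compact.toSchwartzMap
    (Complex.ofRealCLM.contDiff.comp b.contDiff)
  refine (sliceCLM f (stftKernel c g)).continuous.continuousAt.congr ?_
  filter_upwards [b.eventuallyEq_one] with z hz
  have c_eq_one : c z = 1 := by
    change ((b z : ℝ) : ℂ) = 1
    rw [hz, Pi.one_apply, Complex.ofReal_one]
  rw [sliceCLM_stftKernel, c_eq_one, one_mul]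

end Kernel

section Reproducing

variable {ι : Type*} [Fintype ι]

/-- The reflection `(x, ω) ↦ (x, -ω)`. -/
def reflectSnd : EuclideanSpace ℝ (ι ⊕ ι) ≃L[ℝ] EuclideanSpace ℝ (ι ⊕ ι) :=
  ContinuousLinearEquiv.equivOfInverse (inlL.comp fstL - inrL.comp sndL)
    (inlL.comp fstL - inrL.comp sndL)
    (fun w => by
      change inlL (fstL _) - inrL (sndL _) = w
      ext i; rcases i with i | i <;> simp [inlL_apply, inrL_apply])
    (fun w => by
      change inlL (fstL _) - inrL (sndL _) = w
      ext i; rcases i with i | i <;> simp [inlL_apply, inrL_apply])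

theorem reflectSnd_join (x ω : EuclideanSpace ℝ ι) : reflectSnd (join x ω) = join x (-ω) := by
  change inlL x - inrL ω = _
  rw [sub_eq_add_neg, ← map_neg, inlL_add_inrL]

/-- The involution `(x, t) ↦ (t - x, t)`. -/
def windowShear : EuclideanSpace ℝ (ι ⊕ ι) ≃L[ℝ] EuclideanSpace ℝ (ι ⊕ ι) :=
  ContinuousLinearEquiv.equivOfInverse (inlL.comp (sndL - fstL) + inrL.comp sndL)
    (inlL.comp (sndL - fstL) + inrL.comp sndL)
    (fun w => by
      change inlL (sndL _ - fstL _) + inrL (sndL _) = w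
      ext i; rcases i with i | i <;> simp [inlL_apply, inrL_apply])
    (fun w => by
      change inlL (sndL _ - fstL _) + inrL (sndL _) = w
      ext i; rcases i with i | i <;> simp [inlL_apply, inrL_apply])

theorem windowShear_join (x t : EuclideanSpace ℝ ι) : windowShear (join x t) = join (t - x) t :=
  inlL_add_inrL (t - x) t

/-- The Schwartz function `(x, t) ↦ h(t) g(t - x)`. -/
def windowedSchwartz (g h : 𝓢(EuclideanSpace ℝ ι, ℂ)) : 𝓢(EuclideanSpace ℝ (ι ⊕ ι), ℂ) :=
  SchwartzMap.compCLMOfContinuousLinearEquiv ℂ windowShear (tensorSchwartz g h)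

theorem windowedSchwartz_join (g h : 𝓢(EuclideanSpace ℝ ι, ℂ)) (x t : EuclideanSpace ℝ ι) :
    windowedSchwartz g h (join x t) = g (t - x) * h t := by
  simp [windowedSchwartz, windowShear_join]

/-- The Schwartz function `z ↦ ∫ h(t) π(z) g (t) dt`. -/
def ambiguity (g h : 𝓢(EuclideanSpace ℝ ι, ℂ)) : 𝓢(EuclideanSpace ℝ (ι ⊕ ι), ℂ) :=
  SchwartzMap.compCLMOfContinuousLinearEquiv ℂ reflectSnd
    (partialFourierCLM (windowedSchwartz g h))

theorem ambiguity_join (g h : 𝓢(EuclideanSpace ℝ ι, ℂ)) (x ω : EuclideanSpace ℝ ι) :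
    ambiguity g h (join x ω) =
      ∫ t, ((Real.fourierChar (inner ℝ ω t) : Circle) : ℂ) * (g (t - x) * h t) := by
  simp only [ambiguity, SchwartzMap.compCLMOfContinuousLinearEquiv_apply, Function.comp_apply,
    reflectSnd_join, partialFourierCLM_apply]
  refine integral_congr_ae (.of_forall fun t => ?_)
  simp only [windowedSchwartz_join, Circle.smul_def, smul_eq_mul]
  rw [inner_neg_right, neg_neg, real_inner_comm]

theorem partialFourierCLM_section (Φ : 𝓢(EuclideanSpace ℝ (ι ⊕ ι), ℂ)) (x ω : EuclideanSpace ℝ ι) :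
    partialFourierCLM Φ (join x ω) = 𝓕 (sectionCLM x Φ) ω := rfl

theorem partialFourierCLM_reflectSnd (Ψ : 𝓢(EuclideanSpace ℝ (ι ⊕ ι), ℂ))
    (x t : EuclideanSpace ℝ ι) :
    partialFourierCLM (SchwartzMap.compCLMOfContinuousLinearEquiv ℂ reflectSnd
      (partialFourierCLM Ψ)) (join x t) = Ψ (join x t) := by
  have inversion : 𝓕⁻ (𝓕 (sectionCLM x Ψ)) t = Ψ (join x t) := by
    rw [FourierTransform.fourierInv_fourier_eq, sectionCLM_apply]
  rw [← inversion, SchwartzMap.fourierInv_coe, Real.fourierInv_eq, ← integral_neg_eq_self,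
    partialFourierCLM_apply]
  refine integral_congr_ae (.of_forall fun ω => ?_)
  simp only [SchwartzMap.compCLMOfContinuousLinearEquiv_apply, Function.comp_apply,
    reflectSnd_join, partialFourierCLM_section, inner_neg_left]

theorem integral_ambiguity (g h : 𝓢(EuclideanSpace ℝ ι, ℂ)) (x t : EuclideanSpace ℝ ι) :
    ∫ ω, ((Real.fourierChar (-inner ℝ ω t) : Circle) : ℂ) * ambiguity g h (join x ω) =
      g (t - x) * h t := by
  rw [← windowedSchwartz_join, ← partialFourierCLM_reflectSnd, partialFourierCLM_apply]
  simp only [ambiguity, Circle.smul_def, smul_eq_mul]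

/-- The squared `L²` norm of a window. -/
def energy (g : 𝓢(EuclideanSpace ℝ ι, ℂ)) : ℝ := ∫ t, ‖g t‖ ^ 2

theorem energy_pos {g : 𝓢(EuclideanSpace ℝ ι, ℂ)} (hg : g ≠ 0) : 0 < energy g := by
  obtain ⟨t, ht⟩ : ∃ t, g t ≠ 0 := by
    by_contra! h
    exact hg (SchwartzMap.ext h)
  have g_sq_integrable : Integrable fun t => ‖g t‖ ^ 2 :=
    (g.memLp 2 volume).integrable_norm_pow two_ne_zero
  refine (integral_pos_iff_support_of_nonneg (fun t => by positivity) g_sq_integrable).2 ?_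
  refine IsOpen.measure_pos _ ?_ ⟨t, by simpa using ht⟩
  exact (g.continuous.norm.pow 2).isOpen_support

theorem integral_stftKernel_ambiguity (g h : 𝓢(EuclideanSpace ℝ ι, ℂ)) (t : EuclideanSpace ℝ ι) :
    ((energy g : ℂ) • h) t = ∫ z, stftKernel (ambiguity g h) g (join z t) := by
  rw [integral_join (integrable_section _ t)]
  simp_rw [stftKernel_join, fstL_join, sndL_join, ← mul_assoc]
  have inner_integral : ∀ x : EuclideanSpace ℝ ι,
      ∫ ω, ((Real.fourierChar (-inner ℝ ω t) : Circle) : ℂ) * ambiguity g h (join x ω) *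
        starRingEnd ℂ (g (t - x)) = h t * ((‖g (t - x)‖ ^ 2 : ℝ) : ℂ) := by
    intro x
    rw [integral_mul_const, integral_ambiguity, Complex.ofReal_pow, ← Complex.mul_conj']
    ring
  simp_rw [inner_integral]
  rw [integral_const_mul, integral_sub_left_eq_self (fun x => ((‖g x‖ ^ 2 : ℝ) : ℂ)),
    integral_complex_ofReal]
  simp [energy, mul_comm]

theorem energy_mul_apply_eq_integral_ambiguity_mul_stft (g h : 𝓢(EuclideanSpace ℝ ι, ℂ))
    (f : 𝓢'(EuclideanSpace ℝ ι, ℂ)) :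
    (energy g : ℂ) * f h = ∫ z, ambiguity g h z * stft g f (fstL z) (sndL z) := by
  rw [← smul_eq_mul, ← map_smul,
    distribution_integral_section f (integral_stftKernel_ambiguity g h)]
  exact integral_congr_ae (.of_forall (sliceCLM_stftKernel (ambiguity g h) g f))

theorem norm_ambiguity_tfShift (g₀ g : 𝓢(EuclideanSpace ℝ ι, ℂ)) (x₀ ω₀ x ω : EuclideanSpace ℝ ι) :
    ‖ambiguity g₀ (conjSchwartz (tfShift x₀ ω₀ g)) (join (x + x₀) (ω + ω₀))‖ =
      ‖ambiguity g₀ (conjSchwartz g) (join x ω)‖ := by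
  rw [ambiguity_join, ambiguity_join, ← integral_add_right_eq_self _ x₀]
  have integrand_eq : ∀ t, ((Real.fourierChar (inner ℝ (ω + ω₀) (t + x₀)) : Circle) : ℂ) *
      (g₀ (t + x₀ - (x + x₀)) * conjSchwartz (tfShift x₀ ω₀ g) (t + x₀)) =
      ((Real.fourierChar (inner ℝ ω x₀) : Circle) : ℂ) *
        (((Real.fourierChar (inner ℝ ω t) : Circle) : ℂ) * (g₀ (t - x) * conjSchwartz g t)) := by
    intro t
    have phase_eq : ((Real.fourierChar (inner ℝ (ω + ω₀) (t + x₀)) : Circle) : ℂ) *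
        ((Real.fourierChar (-inner ℝ ω₀ (t + x₀)) : Circle) : ℂ) =
        ((Real.fourierChar (inner ℝ ω x₀) : Circle) : ℂ) *
          ((Real.fourierChar (inner ℝ ω t) : Circle) : ℂ) := by
      rw [← Circle.coe_mul, ← Circle.coe_mul, ← AddChar.map_add_eq_mul, ← AddChar.map_add_eq_mul,
        inner_add_left, inner_add_right ω]
      ring_nf
    rw [conjSchwartz_apply, tfShift_apply, map_mul, Circle.starRingEnd_addChar,
      conjSchwartz_apply, add_sub_add_right_eq_sub, add_sub_cancel_right]
    linear_combination g₀ (t - x) * starRingEnd ℂ (g t) * phase_eq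
  simp_rw [integrand_eq]
  rw [integral_const_mul, norm_mul, Circle.norm_coe, one_mul]

theorem enorm_stft_le_lintegral_ambiguity_mul_stft (g₀ g : 𝓢(EuclideanSpace ℝ ι, ℂ))
    (f : 𝓢'(EuclideanSpace ℝ ι, ℂ)) (x₀ ω₀ : EuclideanSpace ℝ ι) :
    ENNReal.ofReal (energy g₀) * ‖stft g f x₀ ω₀‖ₑ ≤
      ∫⁻ ω, ∫⁻ x, ‖ambiguity g₀ (conjSchwartz g) (join x ω)‖ₑ *
        ‖stft g₀ f (x + x₀) (ω + ω₀)‖ₑ := by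
  have energy_nonneg : 0 ≤ energy g₀ := integral_nonneg fun t => by positivity
  have energy_mul_stft : ENNReal.ofReal (energy g₀) * ‖stft g f x₀ ω₀‖ₑ =
      ‖(energy g₀ : ℂ) * f (conjSchwartz (tfShift x₀ ω₀ g))‖ₑ := by
    rw [enorm_mul, ← ofReal_norm (energy g₀ : ℂ), Complex.norm_real,
      Real.norm_of_nonneg energy_nonneg]
    rfl
  rw [energy_mul_stft, energy_mul_apply_eq_integral_ambiguity_mul_stft,
    ← integral_add_right_eq_self _ (join x₀ ω₀)]
  refine (enorm_integral_le_lintegral_enorm _).trans (le_of_eq ?_)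
  have integrand_continuous : Continuous fun z : EuclideanSpace ℝ (ι ⊕ ι) =>
      ambiguity g₀ (conjSchwartz (tfShift x₀ ω₀ g)) (z + join x₀ ω₀) *
        stft g₀ f (fstL (z + join x₀ ω₀)) (sndL (z + join x₀ ω₀)) :=
    ((ambiguity g₀ (conjSchwartz (tfShift x₀ ω₀ g))).continuous.mul
      (continuous_stft_fstL_sndL g₀ f)).comp (continuous_add_const (join x₀ ω₀))
  rw [lintegral_join integrand_continuous.enorm.measurable]
  refine lintegral_congr fun ω => lintegral_congr fun x => ?_
  rw [join_add_join, enorm_mul, fstL_join, sndL_join, ← ofReal_norm,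
    norm_ambiguity_tfShift, ofReal_norm]

end Reproducing

section Weights

variable {ι κ : Type*} [Fintype ι] [Fintype κ]

theorem polyWeight_pos (s : ℝ) (z : EuclideanSpace ℝ ι) : 0 < polyWeight s z :=
  Real.rpow_pos_of_pos (by positivity) _

theorem continuous_polyWeight (s : ℝ) : Continuous (polyWeight s : EuclideanSpace ℝ ι → ℝ) :=
  Continuous.rpow_const (by fun_prop) fun z => Or.inl (by positivity)

theorem rpow_le_rpow_abs_mul_rpow {a b c : ℝ} (ha : 0 < a) (hb : 0 < b) (hc : 0 < c)
    (hab : a ≤ c * b) (hba : b ≤ c * a) (r : ℝ) : a ^ r ≤ c ^ |r| * b ^ r := by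
  rcases le_total 0 r with hr | hr
  · rw [abs_of_nonneg hr, ← Real.mul_rpow hc.le hb.le]
    exact Real.rpow_le_rpow ha.le hab hr
  · have inv_le : a⁻¹ ≤ c * b⁻¹ := by
      rw [← div_eq_mul_inv, le_div_iff₀ hb, inv_mul_le_iff₀ ha, mul_comm a]
      exact hba
    have rpow_eq_inv_rpow {x : ℝ} (hx : 0 < x) : x ^ r = x⁻¹ ^ (-r) := by
      rw [Real.inv_rpow hx.le, Real.rpow_neg hx.le, inv_inv]
    rw [abs_of_nonpos hr, rpow_eq_inv_rpow ha, rpow_eq_inv_rpow hb,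
      ← Real.mul_rpow hc.le (inv_pos.2 hb).le]
    exact Real.rpow_le_rpow (inv_pos.2 ha).le inv_le (neg_nonneg.2 hr)

theorem one_add_norm_add_sq_le {V : Type*} [SeminormedAddCommGroup V] (a b : V) :
    1 + ‖a + b‖ ^ 2 ≤ 2 * (1 + ‖a‖ ^ 2) * (1 + ‖b‖ ^ 2) := by
  have triangle_sq : ‖a + b‖ ^ 2 ≤ (‖a‖ + ‖b‖) ^ 2 := by gcongr; exact norm_add_le a b
  nlinarith [sq_nonneg (‖a‖ - ‖b‖), mul_nonneg (sq_nonneg ‖a‖) (sq_nonneg ‖b‖)]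

theorem polyWeight_add_le (s : ℝ) (z w : EuclideanSpace ℝ ι) :
    polyWeight s (z + w) ≤ 2 ^ |s / 2| * polyWeight |s| z * polyWeight s w := by
  have reverse : 1 + ‖w‖ ^ 2 ≤ 2 * (1 + ‖z‖ ^ 2) * (1 + ‖z + w‖ ^ 2) := by
    simpa using one_add_norm_add_sq_le (-z) (z + w)
  refine (rpow_le_rpow_abs_mul_rpow (by positivity) (by positivity) (by positivity)
    (one_add_norm_add_sq_le z w) reverse (s / 2)).trans (le_of_eq ?_)
  rw [Real.mul_rpow zero_le_two (by positivity), polyWeight, polyWeight, abs_div, abs_two]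

theorem polyWeight_le_of_norm_le (s : ℝ) {c : ℝ} (hc : 1 ≤ c) {a : EuclideanSpace ℝ ι}
    {b : EuclideanSpace ℝ κ} (hab : ‖a‖ ≤ c * ‖b‖) (hba : ‖b‖ ≤ c * ‖a‖) :
    polyWeight s a ≤ (c ^ 2) ^ |s / 2| * polyWeight s b := by
  have one_add_sq_le {x y : ℝ} (hx : 0 ≤ x) (hxy : x ≤ c * y) :
      1 + x ^ 2 ≤ c ^ 2 * (1 + y ^ 2) := by
    have : x ^ 2 ≤ (c * y) ^ 2 := by gcongr
    nlinarith
  exact rpow_le_rpow_abs_mul_rpow (by positivity) (by positivity) (by positivity)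
    (one_add_sq_le (norm_nonneg a) hab) (one_add_sq_le (norm_nonneg b) hba) (s / 2)

theorem polyWeight_abs_le (s : ℝ) (z : EuclideanSpace ℝ ι) :
    polyWeight |s| z ≤ (1 + ‖z‖) ^ ⌈|s|⌉₊ := by
  have one_add_sq_le : 1 + ‖z‖ ^ 2 ≤ (1 + ‖z‖) ^ (2 : ℝ) := by
    rw [Real.rpow_two]; nlinarith [norm_nonneg z]
  calc polyWeight |s| z ≤ ((1 + ‖z‖) ^ (2 : ℝ)) ^ (|s| / 2) :=
        Real.rpow_le_rpow (by positivity) one_add_sq_le (by positivity)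
    _ = (1 + ‖z‖) ^ |s| := by rw [← Real.rpow_mul (by positivity)]; ring_nf
    _ ≤ (1 + ‖z‖) ^ ((⌈|s|⌉₊ : ℕ) : ℝ) :=
        Real.rpow_le_rpow_of_exponent_le (le_add_of_nonneg_right (norm_nonneg z)) (Nat.le_ceil _)
    _ = _ := Real.rpow_natCast _ _

/-- Continuous nonnegative weights that are moderate with respect to a polynomial, the weights for
which the modulation and amalgam norms do not depend on the window up to equivalence. -/
structure IsModerate (m : EuclideanSpace ℝ ι → ℝ) : Prop where
  continuous : Continuous m
  nonneg : ∀ z, 0 ≤ m z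
  bound : ∃ (C : ℝ) (N : ℕ), 0 ≤ C ∧ ∀ z w, m (z + w) ≤ C * (1 + ‖z‖) ^ N * m w

theorem isModerate_polyWeight (s : ℝ) : IsModerate (polyWeight s : EuclideanSpace ℝ ι → ℝ) where
  continuous := continuous_polyWeight s
  nonneg z := (polyWeight_pos s z).le
  bound := by
    refine ⟨2 ^ |s / 2|, ⌈|s|⌉₊, by positivity, fun z w => (polyWeight_add_le s z w).trans ?_⟩
    gcongr
    · exact (polyWeight_pos s w).le
    · exact polyWeight_abs_le s z

theorem isModerate_one : IsModerate (fun _ : EuclideanSpace ℝ ι => (1 : ℝ)) where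
  continuous := continuous_const
  nonneg _ := zero_le_one
  bound := ⟨1, 0, zero_le_one, fun _ _ => by simp⟩

theorem IsModerate.tensorWeight {u w : EuclideanSpace ℝ ι → ℝ} (hu : IsModerate u)
    (hw : IsModerate w) : IsModerate (tensorWeight u w) where
  continuous := (hu.continuous.comp fstL.continuous).mul (hw.continuous.comp sndL.continuous)
  nonneg z := mul_nonneg (hu.nonneg _) (hw.nonneg _)
  bound := by
    obtain ⟨C, N, hC, hu_le⟩ := hu.bound
    obtain ⟨C', N', hC', hw_le⟩ := hw.bound
    refine ⟨C * C', N + N', by positivity, fun a b => ?_⟩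
    have norm_fstL : ‖fstL a‖ ≤ ‖a‖ := by simpa using norm_fst_le (fstL a) (sndL a)
    have norm_sndL : ‖sndL a‖ ≤ ‖a‖ := by simpa using norm_snd_le (fstL a) (sndL a)
    have hub := hu.nonneg (fstL b)
    have hwb := hw.nonneg (sndL b)
    simp only [MWD.tensorWeight, map_add]
    calc _ ≤ (C * (1 + ‖fstL a‖) ^ N * u (fstL b)) * (C' * (1 + ‖sndL a‖) ^ N' * w (sndL b)) :=
          mul_le_mul (hu_le _ _) (hw_le _ _) (hw.nonneg _) (by positivity)
      _ ≤ (C * (1 + ‖a‖) ^ N * u (fstL b)) * (C' * (1 + ‖a‖) ^ N' * w (sndL b)) := by gcongr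
      _ = _ := by ring

theorem IsModerate.exists_correlation_mul_le {m : EuclideanSpace ℝ (ι ⊕ κ) → ℝ}
    (hm : IsModerate m) : ∃ (C : ℝ≥0∞) (N : ℕ), C ≠ ∞ ∧
      ∀ (F G : EuclideanSpace ℝ ι → EuclideanSpace ℝ κ → ℝ≥0∞) (x : EuclideanSpace ℝ ι)
        (y : EuclideanSpace ℝ κ),
        (∫⁻ y', ∫⁻ x', F x' y' * G (x' + x) (y' + y)) * ENNReal.ofReal (m (join x y)) ≤
          C * ∫⁻ y', ∫⁻ x', (F x' y' * ENNReal.ofReal ((1 + ‖join x' y'‖) ^ N)) *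
            (G (x' + x) (y' + y) * ENNReal.ofReal (m (join (x' + x) (y' + y)))) := by
  obtain ⟨C, N, hC, m_le⟩ := hm.bound
  refine ⟨ENNReal.ofReal C, N, ENNReal.ofReal_ne_top, fun F G x y => ?_⟩
  simp_rw [← lintegral_mul_const' _ _ (ENNReal.ofReal_ne_top (r := m (join x y))),
    ← lintegral_const_mul' _ _ (ENNReal.ofReal_ne_top (r := C))]
  refine lintegral_mono fun y' => lintegral_mono fun x' => ?_
  have m_le_translate :
      m (join x y) ≤ C * (1 + ‖join x' y'‖) ^ N * m (join (x' + x) (y' + y)) := by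
    have := m_le (-(join x' y')) (join x' y' + join x y)
    rwa [neg_add_cancel_left, norm_neg, join_add_join] at this
  calc _ ≤ F x' y' * G (x' + x) (y' + y) *
        ENNReal.ofReal (C * (1 + ‖join x' y'‖) ^ N * m (join (x' + x) (y' + y))) := by gcongr
    _ = _ := by
        rw [ENNReal.ofReal_mul (by positivity), ENNReal.ofReal_mul hC]
        ring

end Weights

section Decay

theorem mixedNorm_mul_lt_top {X Y : Type*} [MeasureSpace X] [MeasureSpace Y] {p q : ℝ} (hp : 0 < p)
    (hq : 0 < q) {u : X → ℝ≥0∞} {v : Y → ℝ≥0∞} (hu : ∫⁻ x, u x ^ p < ∞) (hv : ∫⁻ y, v y ^ q < ∞)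
    (hv_top : ∀ y, v y ≠ ∞) : mixedNorm p q (fun x y => v y * u x) < ∞ := by
  have inner_integral (y : Y) : ∫⁻ x, v y ^ p * u x ^ p = v y ^ p * ∫⁻ x, u x ^ p :=
    lintegral_const_mul' _ _ (ENNReal.rpow_ne_top_of_nonneg hp.le (hv_top y))
  have hu' : (∫⁻ x, u x ^ p) ^ (q / p) < ∞ :=
    ENNReal.rpow_lt_top_of_nonneg (div_pos hq hp).le hu.ne
  unfold mixedNorm
  simp_rw [ENNReal.mul_rpow_of_nonneg _ _ hp.le, inner_integral,
    ENNReal.mul_rpow_of_nonneg _ _ (div_pos hq hp).le, ← ENNReal.rpow_mul,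
    mul_div_cancel₀ q hp.ne']
  rw [lintegral_mul_const' _ _ hu'.ne]
  exact ENNReal.rpow_lt_top_of_nonneg (by positivity) (ENNReal.mul_lt_top hv hu').ne

variable {ι κ : Type*} [Fintype ι] [Fintype κ]

/-- An integrable negative integer power of `1 + ‖x‖`, the majorant used for Schwartz functions. -/
def decayProfile (x : EuclideanSpace ℝ ι) : ℝ :=
  (1 + ‖x‖) ^ (-((volume : Measure (EuclideanSpace ℝ ι)).integrablePower : ℝ))

theorem decayProfile_eq_inv_pow (x : EuclideanSpace ℝ ι) :
    decayProfile x =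
      ((1 + ‖x‖) ^ (volume : Measure (EuclideanSpace ℝ ι)).integrablePower)⁻¹ := by
  rw [decayProfile, Real.rpow_neg (by positivity), Real.rpow_natCast]

theorem lintegral_decayProfile_rpow_lt_top {r : ℝ} (hr : 1 ≤ r) :
    ∫⁻ x : EuclideanSpace ℝ ι, ENNReal.ofReal (decayProfile x) ^ r < ∞ := by
  have integrable_decayProfile : Integrable (decayProfile : EuclideanSpace ℝ ι → ℝ) :=
    Measure.integrable_pow_neg_integrablePower volume
  refine lt_of_le_of_lt (lintegral_mono fun x => ?_) integrable_decayProfile.lintegral_lt_top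
  have le_one : ENNReal.ofReal (decayProfile x) ≤ 1 := by
    rw [ENNReal.ofReal_le_one]
    exact Real.rpow_le_one_of_one_le_of_nonpos (by linarith [norm_nonneg x]) (by simp)
  exact (ENNReal.rpow_le_rpow_of_exponent_ge le_one hr).trans_eq (ENNReal.rpow_one _)

theorem exists_enorm_schwartz_mul_pow_le (φ : 𝓢(EuclideanSpace ℝ (ι ⊕ κ), ℂ)) (N : ℕ) :
    ∃ C : ℝ≥0∞, C ≠ ∞ ∧ ∀ (x : EuclideanSpace ℝ ι) (y : EuclideanSpace ℝ κ),
      ‖φ (join x y)‖ₑ * ENNReal.ofReal ((1 + ‖join x y‖) ^ N) ≤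
        C * (ENNReal.ofReal (decayProfile x) * ENNReal.ofReal (decayProfile y)) := by
  let k := (volume : Measure (EuclideanSpace ℝ ι)).integrablePower
  let l := (volume : Measure (EuclideanSpace ℝ κ)).integrablePower
  obtain ⟨C, hC, φ_decay⟩ := exists_one_add_norm_pow_mul_iteratedFDeriv_le φ (N + (k + l)) 0
  refine ⟨ENNReal.ofReal C, ENNReal.ofReal_ne_top, fun x y => ?_⟩
  rw [decayProfile_eq_inv_pow x, decayProfile_eq_inv_pow y, ← ofReal_norm,
    ← ENNReal.ofReal_mul (norm_nonneg _), ← ENNReal.ofReal_mul (by positivity),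
    ← ENNReal.ofReal_mul hC]
  refine ENNReal.ofReal_le_ofReal ?_
  rw [← mul_inv, ← div_eq_mul_inv, le_div_iff₀ (by positivity)]
  calc _ ≤ ‖φ (join x y)‖ * (1 + ‖join x y‖) ^ N *
        ((1 + ‖join x y‖) ^ k * (1 + ‖join x y‖) ^ l) := by
        gcongr
        · exact norm_fst_le x y
        · exact norm_snd_le x y
    _ = (1 + ‖join x y‖) ^ (N + (k + l)) * ‖iteratedFDeriv ℝ 0 φ (join x y)‖ := by
        rw [norm_iteratedFDeriv_zero]; ring
    _ ≤ C := φ_decay (join x y)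

theorem mixedNorm_schwartz_lt_top (φ : 𝓢(EuclideanSpace ℝ (ι ⊕ κ), ℂ)) (N : ℕ) {p q : ℝ}
    (hp : 1 ≤ p) (hq : 1 ≤ q) :
    mixedNorm p q (fun (x : EuclideanSpace ℝ ι) (y : EuclideanSpace ℝ κ) =>
      ‖φ (join x y)‖ₑ * ENNReal.ofReal ((1 + ‖join x y‖) ^ N)) < ∞ := by
  obtain ⟨C, hC, φ_le⟩ := exists_enorm_schwartz_mul_pow_le φ N
  have hp₀ : 0 < p := one_pos.trans_le hp
  have hq₀ : 0 < q := one_pos.trans_le hq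
  refine (mixedNorm_mono hp₀.le hq₀.le fun x y => (φ_le x y).trans_eq
    (by rw [mul_comm (ENNReal.ofReal (decayProfile x))])).trans_lt ?_
  rw [mixedNorm_const_mul hp₀ hq₀ hC]
  exact ENNReal.mul_lt_top hC.lt_top (mixedNorm_mul_lt_top hp₀ hq₀
    (lintegral_decayProfile_rpow_lt_top hp) (lintegral_decayProfile_rpow_lt_top hq)
    fun _ => ENNReal.ofReal_ne_top)

theorem mixedNorm_swap_schwartz_lt_top (φ : 𝓢(EuclideanSpace ℝ (ι ⊕ κ), ℂ)) (N : ℕ) {p q : ℝ}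
    (hp : 1 ≤ p) (hq : 1 ≤ q) :
    mixedNorm p q (fun (y : EuclideanSpace ℝ κ) (x : EuclideanSpace ℝ ι) =>
      ‖φ (join x y)‖ₑ * ENNReal.ofReal ((1 + ‖join x y‖) ^ N)) < ∞ := by
  obtain ⟨C, hC, φ_le⟩ := exists_enorm_schwartz_mul_pow_le φ N
  have hp₀ : 0 < p := one_pos.trans_le hp
  have hq₀ : 0 < q := one_pos.trans_le hq
  refine (mixedNorm_mono hp₀.le hq₀.le fun y x => φ_le x y).trans_lt ?_
  rw [mixedNorm_const_mul hp₀ hq₀ hC]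
  exact ENNReal.mul_lt_top hC.lt_top (mixedNorm_mul_lt_top hp₀ hq₀
    (lintegral_decayProfile_rpow_lt_top hp) (lintegral_decayProfile_rpow_lt_top hq)
    fun _ => ENNReal.ofReal_ne_top)

theorem measurable_enorm_mul_ofReal_join {φ : EuclideanSpace ℝ (ι ⊕ κ) → ℂ}
    {m : EuclideanSpace ℝ (ι ⊕ κ) → ℝ} (hφ : Continuous φ) (hm : Continuous m) :
    Measurable (Function.uncurry fun (x : EuclideanSpace ℝ ι) (y : EuclideanSpace ℝ κ) =>
      ‖φ (join x y)‖ₑ * ENNReal.ofReal (m (join x y))) :=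
  (hφ.comp continuous_join).enorm.measurable.mul
    (ENNReal.measurable_ofReal.comp (hm.comp continuous_join).measurable)

end Decay

section Inclusion

variable {ι : Type*} [Fintype ι]

theorem modulationNorm_eq_mixedNorm (g : 𝓢(EuclideanSpace ℝ ι, ℂ)) {p : ℝ} (hp : 0 ≤ p) (q : ℝ)
    (m : EuclideanSpace ℝ (ι ⊕ ι) → ℝ) (f : 𝓢'(EuclideanSpace ℝ ι, ℂ)) :
    modulationNorm g p q m f =
      mixedNorm p q fun x ω => ‖stft g f x ω‖ₑ * ENNReal.ofReal (m (join x ω)) := by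
  simp_rw [modulationNorm, mixedNorm, ENNReal.mul_rpow_of_nonneg _ _ hp]

theorem amalgamNorm_eq_mixedNorm (g : 𝓢(EuclideanSpace ℝ ι, ℂ)) {p q : ℝ} (hp : 0 < p)
    (hq : 0 ≤ q) (w : EuclideanSpace ℝ ι → ℝ) (f : 𝓢'(EuclideanSpace ℝ ι, ℂ)) :
    amalgamNorm g p q (fun _ => 1) w f =
      mixedNorm p q fun ω x => ‖stft g f x ω‖ₑ *
        ENNReal.ofReal (tensorWeight w (fun _ => 1) (join x ω)) := by
  simp only [amalgamNorm, mixedNorm, tensorWeight, fstL_join, mul_one, ENNReal.ofReal_one,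
    ENNReal.one_rpow, ENNReal.mul_rpow_of_nonneg _ _ hp.le]
  congr 1
  refine lintegral_congr fun x => ?_
  rw [lintegral_mul_const' _ _ (ENNReal.rpow_ne_top_of_nonneg hp.le ENNReal.ofReal_ne_top),
    ENNReal.mul_rpow_of_nonneg _ _ (by positivity), ← ENNReal.rpow_mul, mul_div_cancel₀ q hp.ne']

theorem measurable_stft_mul_weight (g : 𝓢(EuclideanSpace ℝ ι, ℂ)) (f : 𝓢'(EuclideanSpace ℝ ι, ℂ))
    {m : EuclideanSpace ℝ (ι ⊕ ι) → ℝ} (hm : Continuous m) :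
    Measurable (Function.uncurry fun x ω => ‖stft g f x ω‖ₑ * ENNReal.ofReal (m (join x ω))) := by
  simpa using measurable_enorm_mul_ofReal_join (continuous_stft_fstL_sndL g f) hm

theorem exists_stft_mul_weight_le {g₀ : 𝓢(EuclideanSpace ℝ ι, ℂ)} (hg₀ : g₀ ≠ 0)
    (g : 𝓢(EuclideanSpace ℝ ι, ℂ)) {m : EuclideanSpace ℝ (ι ⊕ ι) → ℝ} (hm : IsModerate m) :
    ∃ (C : ℝ≥0∞) (N : ℕ), C ≠ ∞ ∧ ∀ (f : 𝓢'(EuclideanSpace ℝ ι, ℂ)) (x ω : EuclideanSpace ℝ ι),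
      ‖stft g f x ω‖ₑ * ENNReal.ofReal (m (join x ω)) ≤ C * ∫⁻ ω', ∫⁻ x',
        (‖ambiguity g₀ (conjSchwartz g) (join x' ω')‖ₑ *
            ENNReal.ofReal ((1 + ‖join x' ω'‖) ^ N)) *
          (‖stft g₀ f (x' + x) (ω' + ω)‖ₑ *
            ENNReal.ofReal (m (join (x' + x) (ω' + ω)))) := by
  obtain ⟨C, N, hC, correlation_le⟩ := hm.exists_correlation_mul_le
  have energy_ne_zero : ENNReal.ofReal (energy g₀) ≠ 0 := by simpa using energy_pos hg₀
  refine ⟨(ENNReal.ofReal (energy g₀))⁻¹ * C, N,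
    ENNReal.mul_ne_top (ENNReal.inv_ne_top.2 energy_ne_zero) hC, fun f x ω => ?_⟩
  have stft_le := enorm_stft_le_lintegral_ambiguity_mul_stft g₀ g f x ω
  rw [mul_comm, ← ENNReal.le_div_iff_mul_le (Or.inl energy_ne_zero) (Or.inl ENNReal.ofReal_ne_top),
    ENNReal.div_eq_inv_mul] at stft_le
  calc _ ≤ ((ENNReal.ofReal (energy g₀))⁻¹ * ∫⁻ ω', ∫⁻ x',
        ‖ambiguity g₀ (conjSchwartz g) (join x' ω')‖ₑ * ‖stft g₀ f (x' + x) (ω' + ω)‖ₑ) *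
        ENNReal.ofReal (m (join x ω)) := by gcongr
    _ ≤ _ := by
        rw [mul_assoc, mul_assoc]
        exact mul_le_mul_right
          (correlation_le (fun x' ω' => ‖ambiguity g₀ (conjSchwartz g) (join x' ω')‖ₑ)
            (fun x' ω' => ‖stft g₀ f x' ω'‖ₑ) x ω) _

theorem exists_young_exponent {p p' : ℝ} (hp : 1 ≤ p) (hpp' : p ≤ p') :
    ∃ a : ℝ, 1 ≤ a ∧ 1 / a + 1 / p = 1 + 1 / p' := by
  have hp₀ : 0 < p := one_pos.trans_le hp
  have hp'₀ : 0 < p' := hp₀.trans_le hpp'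
  have one_div_p_le_one : 1 / p ≤ 1 := (div_le_one hp₀).2 hp
  have one_div_antitone : 1 / p' ≤ 1 / p := one_div_le_one_div_of_le hp₀ hpp'
  have one_div_p'_pos : 0 < 1 / p' := by positivity
  refine ⟨(1 + 1 / p' - 1 / p)⁻¹, (one_le_inv₀ (by linarith)).2 (by linarith), ?_⟩
  rw [one_div, inv_inv]
  ring

theorem exists_modulationNorm_le {g₀ : 𝓢(EuclideanSpace ℝ ι, ℂ)} (hg₀ : g₀ ≠ 0)
    (g : 𝓢(EuclideanSpace ℝ ι, ℂ)) {m : EuclideanSpace ℝ (ι ⊕ ι) → ℝ} (hm : IsModerate m)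
    {p q p' q' : ℝ} (hp : 1 ≤ p) (hq : 1 ≤ q) (hpp' : p ≤ p') (hqq' : q ≤ q') :
    ∃ C : ℝ≥0, ∀ f, modulationNorm g p' q' m f ≤ C * modulationNorm g₀ p q m f := by
  obtain ⟨C, N, hC, stft_le⟩ := exists_stft_mul_weight_le hg₀ g hm
  obtain ⟨a, ha, hap⟩ := exists_young_exponent hp hpp'
  obtain ⟨b, hb, hbq⟩ := exists_young_exponent hq hqq'
  have ambiguity_lt_top := mixedNorm_schwartz_lt_top (ambiguity g₀ (conjSchwartz g)) N ha hb
  have ambiguity_measurable := measurable_enorm_mul_ofReal_join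
    (ambiguity g₀ (conjSchwartz g)).continuous
    (by fun_prop : Continuous fun z : EuclideanSpace ℝ (ι ⊕ ι) => (1 + ‖z‖) ^ N)
  refine ⟨_, fun f => le_of_le_of_eq ?_ (congrArg (· * _)
    (ENNReal.coe_toNNReal (ENNReal.mul_ne_top hC ambiguity_lt_top.ne)).symm)⟩
  rw [modulationNorm_eq_mixedNorm g (by linarith), modulationNorm_eq_mixedNorm g₀ (by linarith),
    mul_assoc]
  refine (mixedNorm_mono (by linarith) (by linarith) (stft_le f)).trans ?_
  rw [mixedNorm_const_mul (by linarith) (by linarith) hC]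
  gcongr
  exact mixedNorm_correlation_le ha hb hp hq (by linarith) (by linarith) hap hbq
    ambiguity_measurable (measurable_stft_mul_weight g₀ f hm.continuous)

theorem exists_amalgamNorm_le {g₀ : 𝓢(EuclideanSpace ℝ ι, ℂ)} (hg₀ : g₀ ≠ 0)
    (g : 𝓢(EuclideanSpace ℝ ι, ℂ)) {w : EuclideanSpace ℝ ι → ℝ} (hw : IsModerate w)
    {p q p' q' : ℝ} (hp : 1 ≤ p) (hq : 1 ≤ q) (hpp' : p ≤ p') (hqq' : q ≤ q') :
    ∃ C : ℝ≥0, ∀ f, amalgamNorm g p' q' (fun _ => 1) w f ≤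
      C * amalgamNorm g₀ p q (fun _ => 1) w f := by
  have hm := hw.tensorWeight isModerate_one
  obtain ⟨C, N, hC, stft_le⟩ := exists_stft_mul_weight_le hg₀ g hm
  obtain ⟨a, ha, hap⟩ := exists_young_exponent hp hpp'
  obtain ⟨b, hb, hbq⟩ := exists_young_exponent hq hqq'
  have ambiguity_lt_top := mixedNorm_swap_schwartz_lt_top (ambiguity g₀ (conjSchwartz g)) N ha hb
  have ambiguity_measurable := measurable_enorm_mul_ofReal_join
    (ambiguity g₀ (conjSchwartz g)).continuous
    (by fun_prop : Continuous fun z : EuclideanSpace ℝ (ι ⊕ ι) => (1 + ‖z‖) ^ N)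
  refine ⟨_, fun f => le_of_le_of_eq ?_ (congrArg (· * _)
    (ENNReal.coe_toNNReal (ENNReal.mul_ne_top hC ambiguity_lt_top.ne)).symm)⟩
  rw [amalgamNorm_eq_mixedNorm g (by linarith) (by linarith),
    amalgamNorm_eq_mixedNorm g₀ (by linarith) (by linarith), mul_assoc]
  refine (mixedNorm_mono (by linarith) (by linarith) fun ω x => stft_le f x ω).trans ?_
  rw [mixedNorm_const_mul (by linarith) (by linarith) hC]
  gcongr
  exact mixedNorm_swap_correlation_le ha hb hp hq (by linarith) (by linarith) hap hbq
    ambiguity_measurable (measurable_stft_mul_weight g₀ f hm.continuous)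

end Inclusion

/-! ### Matrix-Wigner distributions of Cohen type -/

section Wigner

variable {ι : Type*} [Fintype ι]

theorem partialFourierCLM_conj_tfShift (Φ : 𝓢(EuclideanSpace ℝ (ι ⊕ ι), ℂ))
    (x ω ξ η a b : EuclideanSpace ℝ ι) :
    partialFourierCLM (conjSchwartz (tfShift (join x ω) (join ξ η) (conjSchwartz Φ))) (join a b) =
      ((Real.fourierChar (-inner ℝ ξ a - inner ℝ ω (b + η)) : Circle) : ℂ) *
        partialFourierCLM Φ (join (a - x) (b + η)) := by
  rw [partialFourierCLM_apply, partialFourierCLM_apply, ← integral_const_mul,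
    ← integral_add_right_eq_self _ ω]
  refine integral_congr_ae (.of_forall fun y => ?_)
  simp only [conjSchwartz_apply, tfShift_apply, map_mul, Circle.starRingEnd_addChar,
    Complex.conj_conj, Circle.smul_def, smul_eq_mul, inner_join, join_sub_join,
    add_sub_cancel_right]
  rw [← mul_assoc, ← mul_assoc, ← Circle.coe_mul, ← Circle.coe_mul, ← AddChar.map_add_eq_mul,
    ← AddChar.map_add_eq_mul]
  congr 3
  simp only [inner_add_left, inner_add_right, real_inner_comm y η, real_inner_comm ω η]
  ring

theorem sectionCLM_tensorSchwartz (φ ψ : 𝓢(EuclideanSpace ℝ ι, ℂ)) (t : EuclideanSpace ℝ ι) :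
    sectionCLM t (tensorSchwartz φ ψ) = φ t • ψ := by
  ext u
  simp

theorem sliceCLM_tensorSchwartz (f : 𝓢'(EuclideanSpace ℝ ι, ℂ))
    (φ ψ : 𝓢(EuclideanSpace ℝ ι, ℂ)) : sliceCLM f (tensorSchwartz φ ψ) = f ψ • φ := by
  ext t
  rw [sliceCLM_apply, sectionCLM_tensorSchwartz, map_smul, smul_apply, smul_eq_mul, smul_eq_mul,
    mul_comm]

theorem norm_tensorDist_conjDist_tfShift (g₁ g₂ : 𝓢(EuclideanSpace ℝ ι, ℂ))
    (f₁ f₂ : 𝓢'(EuclideanSpace ℝ ι, ℂ)) (x₁ ω₁ x₂ ω₂ : EuclideanSpace ℝ ι) :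
    ‖tensorDist f₁ (conjDist f₂)
        (tensorSchwartz (conjSchwartz (tfShift x₁ ω₁ g₁)) (tfShift x₂ ω₂ g₂))‖ =
      ‖stft g₁ f₁ x₁ ω₁‖ * ‖stft g₂ f₂ x₂ ω₂‖ := by
  rw [tensorDist_apply, sliceCLM_tensorSchwartz, conjDist_apply, map_smul, norm_smul,
    RCLike.norm_conj, mul_comm]
  rfl

variable [DecidableEq ι]

/-- The linear map `x ↦ (M + I/2) x`, the argument of the first factor of `𝓑_{A_M}`. -/
def upperL (M : Matrix ι ι ℝ) : EuclideanSpace ℝ ι →L[ℝ] EuclideanSpace ℝ ι :=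
  Matrix.toEuclideanCLM (𝕜 := ℝ) (n := ι) (M + (1 / 2 : ℝ) • 1)

/-- The linear map `x ↦ (M - I/2) x`, the argument of the second factor of `𝓑_{A_M}`. -/
def lowerL (M : Matrix ι ι ℝ) : EuclideanSpace ℝ ι →L[ℝ] EuclideanSpace ℝ ι :=
  Matrix.toEuclideanCLM (𝕜 := ℝ) (n := ι) (M - (1 / 2 : ℝ) • 1)

theorem upperL_eq_lowerL_add_one (M : Matrix ι ι ℝ) : upperL M = lowerL M + 1 := by
  rw [upperL, lowerL, ← map_one (Matrix.toEuclideanCLM (𝕜 := ℝ) (n := ι)), ← map_add]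
  congr 1
  module

theorem upperL_apply_eq (M : Matrix ι ι ℝ) (x : EuclideanSpace ℝ ι) :
    upperL M x = lowerL M x + x := by
  rw [upperL_eq_lowerL_add_one]; rfl

theorem adjoint_upperL_apply_eq (M : Matrix ι ι ℝ) (x : EuclideanSpace ℝ ι) :
    (upperL M).adjoint x = (lowerL M).adjoint x + x := by
  refine ext_inner_right ℝ fun y => ?_
  rw [inner_add_left, ContinuousLinearMap.adjoint_inner_left,
    ContinuousLinearMap.adjoint_inner_left, upperL_apply_eq, inner_add_right]

theorem glEquiv_cohenMatrix_join (M : Matrix ι ι ℝ) (a b : EuclideanSpace ℝ ι) :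
    glEquiv (cohenMatrix M) (join a b) = join (a + upperL M b) (a + lowerL M b) := by
  change WithLp.toLp 2 ((Matrix.fromBlocks 1 (M + (1 / 2 : ℝ) • 1) 1
    (M - (1 / 2 : ℝ) • 1)).mulVec (Sum.elim a b)) = _
  rw [Matrix.fromBlocks_mulVec, Matrix.one_mulVec]
  ext (i | i) <;> rfl

theorem glEquiv_cohenMatrix_inv_join (M : Matrix ι ι ℝ) (u v : EuclideanSpace ℝ ι) :
    glEquiv (cohenMatrix M)⁻¹ (join u v) = join (upperL M v - lowerL M u) (u - v) := by
  change WithLp.toLp 2 ((Matrix.fromBlocks (-(M - (1 / 2 : ℝ) • 1)) (M + (1 / 2 : ℝ) • 1) 1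
    (-1)).mulVec (Sum.elim u v)) = _
  rw [Matrix.fromBlocks_mulVec, Matrix.neg_mulVec, Matrix.neg_mulVec, Matrix.one_mulVec,
    Matrix.one_mulVec, neg_add_eq_sub, ← sub_eq_add_neg]
  ext (i | i) <;> rfl

theorem abs_det_cohenMatrix (M : Matrix ι ι ℝ) : |(cohenMatrix M).val.det| = 1 := by
  have det_eq : (cohenMatrix M).val.det = (-1 : Matrix ι ι ℝ).det := by
    rw [cohenMatrix, Matrix.det_fromBlocks_one₁₁]
    congr 1
    rw [one_mul]
    module
  rw [det_eq, Matrix.det_neg, Matrix.det_one, mul_one, abs_pow, abs_neg, abs_one, one_pow]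

/-- The conjugate of `wignerWindow`: its partial Fourier transform is
`(a, b) ↦ conj g₁ (a + (M + I/2) b) g₂ (a + (M - I/2) b)`. -/
def wignerWindowConj (M : Matrix ι ι ℝ) (g₁ g₂ : 𝓢(EuclideanSpace ℝ ι, ℂ)) :
    𝓢(EuclideanSpace ℝ (ι ⊕ ι), ℂ) :=
  SchwartzMap.compCLMOfContinuousLinearEquiv ℂ reflectSnd (partialFourierCLM
    (SchwartzMap.compCLMOfContinuousLinearEquiv ℂ (glEquiv (cohenMatrix M))
      (tensorSchwartz (conjSchwartz g₁) g₂)))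

theorem partialFourierCLM_wignerWindowConj (M : Matrix ι ι ℝ) (g₁ g₂ : 𝓢(EuclideanSpace ℝ ι, ℂ))
    (a b : EuclideanSpace ℝ ι) :
    partialFourierCLM (wignerWindowConj M g₁ g₂) (join a b) =
      starRingEnd ℂ (g₁ (a + upperL M b)) * g₂ (a + lowerL M b) := by
  rw [wignerWindowConj, partialFourierCLM_reflectSnd]
  simp only [SchwartzMap.compCLMOfContinuousLinearEquiv_apply, Function.comp_apply,
    glEquiv_cohenMatrix_join, tensorSchwartz_apply, fstL_join, sndL_join, conjSchwartz_apply]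

/-- The matrix-Wigner distribution `𝓑_{A_M}(g₁, g₂)` of two windows: with respect to it the
short-time Fourier transform of `𝓑_{A_M}(f₁, f₂)` factorises. -/
def wignerWindow (M : Matrix ι ι ℝ) (g₁ g₂ : 𝓢(EuclideanSpace ℝ ι, ℂ)) :
    𝓢(EuclideanSpace ℝ (ι ⊕ ι), ℂ) :=
  conjSchwartz (wignerWindowConj M g₁ g₂)

theorem wignerWindow_ne_zero (M : Matrix ι ι ℝ) {g₁ g₂ : 𝓢(EuclideanSpace ℝ ι, ℂ)} (hg₁ : g₁ ≠ 0)
    (hg₂ : g₂ ≠ 0) : wignerWindow M g₁ g₂ ≠ 0 := by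
  obtain ⟨u, hu⟩ : ∃ u, g₁ u ≠ 0 := by by_contra! h; exact hg₁ (SchwartzMap.ext h)
  obtain ⟨v, hv⟩ : ∃ v, g₂ v ≠ 0 := by by_contra! h; exact hg₂ (SchwartzMap.ext h)
  intro window_eq_zero
  have conj_eq_zero : wignerWindowConj M g₁ g₂ = 0 := by
    ext z
    simpa [wignerWindow] using DFunLike.congr_fun window_eq_zero z
  have product_eq_zero :=
    partialFourierCLM_wignerWindowConj M g₁ g₂ (upperL M v - lowerL M u) (u - v)
  have upper_arg : upperL M v - lowerL M u + upperL M (u - v) = u := by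
    simp only [upperL_apply_eq, map_sub]; abel
  have lower_arg : upperL M v - lowerL M u + lowerL M (u - v) = v := by
    simp only [upperL_apply_eq, map_sub]; abel
  rw [conj_eq_zero, map_zero, upper_arg, lower_arg] at product_eq_zero
  exact mul_ne_zero ((map_ne_zero _).2 hu) hv product_eq_zero.symm

theorem exists_circle_smul_tensorSchwartz_eq (M : Matrix ι ι ℝ) (g₁ g₂ : 𝓢(EuclideanSpace ℝ ι, ℂ))
    (x ω ξ η : EuclideanSpace ℝ ι) :
    ∃ c : Circle, SchwartzMap.compCLMOfContinuousLinearEquiv ℂ (glEquiv (cohenMatrix M)⁻¹)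
        (partialFourierCLM
          (conjSchwartz (tfShift (join x ω) (join ξ η) (wignerWindow M g₁ g₂)))) =
      (c : ℂ) • tensorSchwartz
        (conjSchwartz (tfShift (x - upperL M η) (ω - (lowerL M).adjoint ξ) g₁))
        (tfShift (x - lowerL M η) (ω - (upperL M).adjoint ξ) g₂) := by
  refine ⟨Real.fourierChar (-inner ℝ ω η), ?_⟩
  ext w
  obtain ⟨u, v, rfl⟩ : ∃ u v, w = join u v := ⟨_, _, (join_fstL_sndL w).symm⟩
  rw [SchwartzMap.compCLMOfContinuousLinearEquiv_apply, Function.comp_apply,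
    glEquiv_cohenMatrix_inv_join, wignerWindow, partialFourierCLM_conj_tfShift,
    partialFourierCLM_wignerWindowConj, smul_apply, tensorSchwartz_apply, fstL_join, sndL_join,
    conjSchwartz_apply, tfShift_apply, tfShift_apply, map_mul, Circle.starRingEnd_addChar,
    smul_eq_mul]
  have upper_arg : upperL M v - lowerL M u - x + upperL M (u - v + η) = u - (x - upperL M η) := by
    simp only [upperL_apply_eq, map_add, map_sub]; abel
  have lower_arg : upperL M v - lowerL M u - x + lowerL M (u - v + η) = v - (x - lowerL M η) := by
    simp only [upperL_apply_eq, map_add, map_sub]; abel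
  have phase_eq : ((Real.fourierChar
      (-inner ℝ ξ (upperL M v - lowerL M u) - inner ℝ ω (u - v + η)) : Circle) : ℂ) =
      ((Real.fourierChar (-inner ℝ ω η) : Circle) : ℂ) *
        (((Real.fourierChar (-inner ℝ (ω - (lowerL M).adjoint ξ) u) : Circle) : ℂ) *
          ((Real.fourierChar (inner ℝ (ω - (upperL M).adjoint ξ) v) : Circle) : ℂ)) := by
    rw [← Circle.coe_mul, ← Circle.coe_mul, ← AddChar.map_add_eq_mul, ← AddChar.map_add_eq_mul]
    congr 2
    simp only [inner_add_right, inner_sub_right, inner_sub_left,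
      ContinuousLinearMap.adjoint_inner_left]
    ring
  rw [upper_arg, lower_arg, phase_eq]
  ring

theorem enorm_stft_matrixWigner (M : Matrix ι ι ℝ) (g₁ g₂ : 𝓢(EuclideanSpace ℝ ι, ℂ))
    (f₁ f₂ : 𝓢'(EuclideanSpace ℝ ι, ℂ)) (x ω ξ η : EuclideanSpace ℝ ι) :
    ‖stft (wignerWindow M g₁ g₂) (matrixWigner (cohenMatrix M) f₁ f₂) (join x ω) (join ξ η)‖ₑ =
      ‖stft g₁ f₁ (x - upperL M η) (ω - (lowerL M).adjoint ξ)‖ₑ *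
        ‖stft g₂ f₂ (x - lowerL M η) (ω - (upperL M).adjoint ξ)‖ₑ := by
  obtain ⟨c, factorisation⟩ := exists_circle_smul_tensorSchwartz_eq M g₁ g₂ x ω ξ η
  have stft_eq : stft (wignerWindow M g₁ g₂) (matrixWigner (cohenMatrix M) f₁ f₂) (join x ω)
      (join ξ η) = ((|(cohenMatrix M).val.det|⁻¹ : ℝ) : ℂ) * tensorDist f₁ (conjDist f₂)
        (SchwartzMap.compCLMOfContinuousLinearEquiv ℂ (glEquiv (cohenMatrix M)⁻¹)
          (partialFourierCLM
            (conjSchwartz (tfShift (join x ω) (join ξ η) (wignerWindow M g₁ g₂))))) := rfl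
  rw [stft_eq, abs_det_cohenMatrix, inv_one, Complex.ofReal_one, one_mul, factorisation, map_smul,
    ← ofReal_norm, norm_smul, Circle.norm_coe, one_mul, norm_tensorDist_conjDist_tfShift,
    ENNReal.ofReal_mul (norm_nonneg _), ofReal_norm, ofReal_norm]

end Wigner

/-! ### Correlation estimates for sheared products -/

section Translation

variable {X Y : Type*} [MeasureSpace X] [MeasureSpace Y]

theorem mixedNorm_self (p : ℝ) (F : X → Y → ℝ≥0∞) (hp : p ≠ 0) :
    mixedNorm p p F = (∫⁻ y, ∫⁻ x, F x y ^ p) ^ (1 / p) := by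
  simp_rw [mixedNorm, div_self hp, ENNReal.rpow_one]

theorem mixedNorm_self_swap [SFinite (volume : Measure X)] [SFinite (volume : Measure Y)] {p : ℝ}
    (hp : p ≠ 0) {F : X → Y → ℝ≥0∞} (hF : Measurable (Function.uncurry F)) :
    mixedNorm p p (fun y x => F x y) = mixedNorm p p F := by
  rw [mixedNorm_self _ _ hp, mixedNorm_self _ _ hp]
  exact congrArg (· ^ (1 / p)) (lintegral_lintegral_swap (hF.pow_const p).aemeasurable)

variable [AddCommGroup X] [MeasurableAdd X] [(volume : Measure X).IsAddLeftInvariant]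
  [AddCommGroup Y] [MeasurableAdd Y] [(volume : Measure Y).IsAddLeftInvariant]

theorem mixedNorm_sub_right (p q : ℝ) (F : X → Y → ℝ≥0∞) (a : X) (b : Y) :
    mixedNorm p q (fun x y => F (x - a) (y - b)) = mixedNorm p q F := by
  have inner_eq (y : Y) : ∫⁻ x, F (x - a) (y - b) ^ p = ∫⁻ x, F x (y - b) ^ p :=
    lintegral_sub_right_eq_self (fun x => F x (y - b) ^ p) a
  simp_rw [mixedNorm, inner_eq]
  exact congrArg (· ^ (1 / q))
    (lintegral_sub_right_eq_self (fun y => (∫⁻ x, F x y ^ p) ^ (q / p)) b)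

theorem mixedNorm_sub_left [MeasurableNeg X] [(volume : Measure X).IsNegInvariant]
    [MeasurableNeg Y] [(volume : Measure Y).IsNegInvariant] (p q : ℝ) (F : X → Y → ℝ≥0∞)
    (a : X) (b : Y) : mixedNorm p q (fun x y => F (a - x) (b - y)) = mixedNorm p q F := by
  have inner_eq (y : Y) : ∫⁻ x, F (a - x) (b - y) ^ p = ∫⁻ x, F x (b - y) ^ p :=
    lintegral_sub_left_eq_self (fun x => F x (b - y) ^ p) a
  simp_rw [mixedNorm, inner_eq]
  exact congrArg (· ^ (1 / q))
    (lintegral_sub_left_eq_self (fun y => (∫⁻ x, F x y ^ p) ^ (q / p)) b)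

end Translation

section ChangeOfVariables

variable {E F : Type*} [NormedAddCommGroup E] [NormedSpace ℝ E] [FiniteDimensional ℝ E]
  [MeasureSpace E] [BorelSpace E] [(volume : Measure E).IsAddHaarMeasure]
  [NormedAddCommGroup F] [NormedSpace ℝ F] [FiniteDimensional ℝ F]
  [MeasureSpace F] [BorelSpace F] [(volume : Measure F).IsAddHaarMeasure]

theorem exists_lintegral_comp_equiv (e : E ≃L[ℝ] E) :
    ∃ c : ℝ≥0, ∀ φ : E → ℝ≥0∞, ∫⁻ x, φ (e x) = c * ∫⁻ x, φ x := by
  have det_ne_zero : LinearMap.det (e.toLinearEquiv : E →ₗ[ℝ] E) ≠ 0 :=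
    (LinearEquiv.isUnit_det' e.toLinearEquiv).ne_zero
  refine ⟨Real.toNNReal |(LinearMap.det (e.toLinearEquiv : E →ₗ[ℝ] E))⁻¹|, fun φ => ?_⟩
  calc ∫⁻ x, φ (e x) = ∫⁻ x, φ x ∂(Measure.map (e.toLinearEquiv : E →ₗ[ℝ] E) volume) :=
        (lintegral_map_equiv φ e.toHomeomorph.toMeasurableEquiv).symm
    _ = _ := by
        rw [Measure.map_linearMap_addHaar_eq_smul_addHaar volume det_ne_zero,
          lintegral_smul_measure]
        rfl

theorem exists_mixedNorm_comp_equiv (e : E ≃L[ℝ] E) (f : F ≃L[ℝ] F) {p q : ℝ} (hp : 0 < p)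
    (hq : 0 < q) : ∃ c : ℝ≥0, ∀ H : E → F → ℝ≥0∞,
      mixedNorm p q (fun x y => H (e x) (f y)) = c * mixedNorm p q H := by
  obtain ⟨c, comp_e⟩ := exists_lintegral_comp_equiv e
  obtain ⟨c', comp_f⟩ := exists_lintegral_comp_equiv f
  have hr : 0 ≤ q / p := by positivity
  refine ⟨(c ^ (q / p) * c') ^ (1 / q), fun H => ?_⟩
  have inner_eq (y : F) : ∫⁻ x, H (e x) y ^ p = c * ∫⁻ x, H x y ^ p := comp_e fun x => H x y ^ p
  simp_rw [mixedNorm, inner_eq, ENNReal.mul_rpow_of_nonneg _ _ hr]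
  rw [lintegral_const_mul' _ _ (ENNReal.rpow_ne_top_of_nonneg hr ENNReal.coe_ne_top),
    comp_f fun y => (∫⁻ x, H x y ^ p) ^ (q / p), ← mul_assoc,
    ENNReal.mul_rpow_of_nonneg _ _ (by positivity),
    ENNReal.coe_rpow_of_nonneg _ (by positivity), ENNReal.coe_mul, ENNReal.coe_rpow_of_nonneg _ hr]

end ChangeOfVariables

section Young

/-- The exponents `(p, q, P₁, P₂)` for which Young's inequality, applied to `p`-th powers, bounds
the `L^q` norm in `u` of `‖h₁ · h₂(· + u)‖_p` by `‖h₁‖_{P₁} ‖h₂‖_{P₂}`. -/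
structure YoungExponents (p q P₁ P₂ : ℝ) : Prop where
  pos : 0 < p
  le : p ≤ q
  le₁ : p ≤ P₁
  le₂ : p ≤ P₂
  sum : 1 / P₁ + 1 / P₂ = 1 / p + 1 / q

theorem YoungExponents.sum_div {p q P₁ P₂ : ℝ} (h : YoungExponents p q P₁ P₂) :
    1 / (P₁ / p) + 1 / (P₂ / p) = 1 + 1 / (q / p) := by
  have := h.pos
  have hq : 0 < q := h.pos.trans_le h.le
  have hP₁ : 0 < P₁ := h.pos.trans_le h.le₁
  have hP₂ : 0 < P₂ := h.pos.trans_le h.le₂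
  calc 1 / (P₁ / p) + 1 / (P₂ / p) = p * (1 / P₁ + 1 / P₂) := by field_simp
    _ = _ := by rw [h.sum]; field_simp

variable {X Y : Type*} [MeasureSpace X] [AddCommGroup X] [MeasurableAdd₂ X]
  [MeasureSpace Y] [AddCommGroup Y] [MeasurableAdd₂ Y]
  {H₁ H₂ : X → Y → ℝ≥0∞}

theorem measurable_mixedNorm_self_mul_translate [SFinite (volume : Measure X)]
    [SFinite (volume : Measure Y)] {p : ℝ} (hp : p ≠ 0) (hH₁ : Measurable (Function.uncurry H₁))
    (hH₂ : Measurable (Function.uncurry H₂)) :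
    Measurable (Function.uncurry fun u v =>
      mixedNorm p p fun x y => H₁ x y * H₂ (x + u) (y + v)) := by
  simp_rw [mixedNorm_self _ _ hp]
  refine Measurable.pow_const (Measurable.lintegral_prod_right
    (f := fun (w : X × Y) y => ∫⁻ x, (H₁ x y * H₂ (x + w.1) (y + w.2)) ^ p) ?_) (1 / p)
  refine Measurable.lintegral_prod_right
    (f := fun (v : (X × Y) × Y) x => (H₁ x v.2 * H₂ (x + v.1.1) (v.2 + v.1.2)) ^ p) ?_
  exact ((hH₁.comp (by fun_prop : Measurable fun z : ((X × Y) × Y) × X => (z.2, z.1.2))).mul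
    (hH₂.comp (by fun_prop : Measurable fun z : ((X × Y) × Y) × X =>
      (z.2 + z.1.1.1, z.1.2 + z.1.1.2)))).pow_const p

theorem mixedNorm_mixedNorm_mul_translate_le [SigmaFinite (volume : Measure X)]
    [SFinite (volume : Measure Y)] [(volume : Measure X).IsAddLeftInvariant]
    [(volume : Measure Y).IsAddLeftInvariant] (hH₁ : Measurable (Function.uncurry H₁))
    (hH₂ : Measurable (Function.uncurry H₂)) {p q P₁ P₂ Q₁ Q₂ : ℝ}
    (hP : YoungExponents p q P₁ P₂) (hQ : YoungExponents p q Q₁ Q₂) :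
    mixedNorm q q (fun u v => mixedNorm p p fun x y => H₁ x y * H₂ (x + u) (y + v)) ≤
      mixedNorm P₁ Q₁ H₁ * mixedNorm P₂ Q₂ H₂ := by
  have hp := hP.pos
  have one_le_div {r : ℝ} (h : p ≤ r) : 1 ≤ r / p := (one_le_div hp).2 h
  rw [← ENNReal.rpow_le_rpow_iff hp, ENNReal.mul_rpow_of_nonneg _ _ hp.le, ← mixedNorm_rpow hp.ne',
    ← mixedNorm_rpow hp.ne', ← mixedNorm_rpow hp.ne']
  refine le_of_eq_of_le ?_ (mixedNorm_correlation_le (one_le_div hP.le₁) (one_le_div hQ.le₁)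
    (one_le_div hP.le₂) (one_le_div hQ.le₂) (one_le_div hP.le) (one_pos.trans_le (one_le_div hP.le))
    hP.sum_div hQ.sum_div (hH₁.pow_const p) (hH₂.pow_const p))
  congr 1
  funext u v
  rw [mixedNorm_self _ _ hp.ne', ← ENNReal.rpow_mul, one_div_mul_cancel hp.ne', ENNReal.rpow_one]
  simp_rw [ENNReal.mul_rpow_of_nonneg _ _ hp.le]

end Young

section Shear

variable {ι κ : Type*} [Fintype ι] [Fintype κ]

theorem mixedNorm_fstL_sndL {p q : ℝ} (hp : p ≠ 0) (hq : q ≠ 0)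
    {K : EuclideanSpace ℝ ι → EuclideanSpace ℝ ι → EuclideanSpace ℝ κ → EuclideanSpace ℝ κ → ℝ≥0∞}
    (hK : Measurable fun w : ((EuclideanSpace ℝ κ × EuclideanSpace ℝ κ) × EuclideanSpace ℝ ι) ×
      EuclideanSpace ℝ ι => K w.2 w.1.2 w.1.1.1 w.1.1.2) :
    mixedNorm p q (fun (z : EuclideanSpace ℝ (ι ⊕ ι)) (ζ : EuclideanSpace ℝ (κ ⊕ κ)) =>
        K (fstL z) (sndL z) (fstL ζ) (sndL ζ)) =
      mixedNorm q q fun ξ η => mixedNorm p p fun x ω => K x ω ξ η := by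
  have inner_eq (ξ η : EuclideanSpace ℝ κ) :
      ∫⁻ z : EuclideanSpace ℝ (ι ⊕ ι), K (fstL z) (sndL z) ξ η ^ p = ∫⁻ ω, ∫⁻ x, K x ω ξ η ^ p :=
    lintegral_join ((hK.comp (by fun_prop : Measurable fun z : EuclideanSpace ℝ (ι ⊕ ι) =>
      (((ξ, η), sndL z), fstL z))).pow_const p)
  have outer_measurable : Measurable fun ζ : EuclideanSpace ℝ (κ ⊕ κ) =>
      (∫⁻ ω, ∫⁻ x, K x ω (fstL ζ) (sndL ζ) ^ p) ^ (q / p) :=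
    ((hK.pow_const p).lintegral_prod_right'.lintegral_prod_right'.comp
      (by fun_prop : Measurable fun ζ : EuclideanSpace ℝ (κ ⊕ κ) => (fstL ζ, sndL ζ))).pow_const _
  rw [mixedNorm_self q _ hq]
  simp_rw [mixedNorm_self p _ hp, ← ENNReal.rpow_mul, one_div_mul_eq_div, mixedNorm, inner_eq]
  exact congrArg (· ^ (1 / q)) (lintegral_join outer_measurable)

variable {p q P₁ P₂ Q₁ Q₂ : ℝ}

theorem exists_mixedNorm_sheared_mul_le
    (hP : YoungExponents p q P₁ P₂) (hQ : YoungExponents p q Q₁ Q₂)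
    {S S' T T' : EuclideanSpace ℝ ι →L[ℝ] EuclideanSpace ℝ ι}
    (D D' : EuclideanSpace ℝ ι ≃L[ℝ] EuclideanSpace ℝ ι)
    (hD : ∀ η, S η = S' η + D η) (hD' : ∀ ξ, T ξ = T' ξ + D' ξ) :
    ∃ C : ℝ≥0, ∀ H₁ H₂ : EuclideanSpace ℝ ι → EuclideanSpace ℝ ι → ℝ≥0∞,
      Measurable (Function.uncurry H₁) → Measurable (Function.uncurry H₂) →
      mixedNorm p q (fun z ζ : EuclideanSpace ℝ (ι ⊕ ι) =>
        H₁ (fstL z - S (sndL ζ)) (sndL z - T (fstL ζ)) *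
          H₂ (fstL z - S' (sndL ζ)) (sndL z - T' (fstL ζ))) ≤
      C * (mixedNorm P₁ Q₁ H₁ * mixedNorm P₂ Q₂ H₂) := by
  have hp := hP.pos
  have hq : 0 < q := hp.trans_le hP.le
  obtain ⟨c, comp_D⟩ := exists_mixedNorm_comp_equiv D D' hq hq
  refine ⟨c, fun H₁ H₂ hH₁ hH₂ => ?_⟩
  rw [mixedNorm_fstL_sndL (K := fun x ω ξ η => H₁ (x - S η) (ω - T ξ) * H₂ (x - S' η) (ω - T' ξ))
    hp.ne' hq.ne' (by fun_prop)]
  let N u v := mixedNorm p p fun x ω => H₁ x ω * H₂ (x + u) (ω + v)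
  have inner_eq (ξ η : EuclideanSpace ℝ ι) :
      (mixedNorm p p fun x ω => H₁ (x - S η) (ω - T ξ) * H₂ (x - S' η) (ω - T' ξ)) =
        N (D η) (D' ξ) := by
    have sheared_eq (x ω : EuclideanSpace ℝ ι) :
        H₂ (x - S' η) (ω - T' ξ) = H₂ (x - S η + D η) (ω - T ξ + D' ξ) := by
      rw [hD, hD', sub_add_eq_sub_sub, sub_add_eq_sub_sub, sub_add_cancel, sub_add_cancel]
    simp_rw [sheared_eq]
    exact mixedNorm_sub_right p p (fun x ω => H₁ x ω * H₂ (x + D η) (ω + D' ξ)) (S η) (T ξ)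
  have N_measurable : Measurable (Function.uncurry N) :=
    measurable_mixedNorm_self_mul_translate hp.ne' hH₁ hH₂
  simp_rw [inner_eq]
  calc _ = mixedNorm q q fun η ξ => N (D η) (D' ξ) :=
        mixedNorm_self_swap (F := fun η ξ => N (D η) (D' ξ)) hq.ne' (by fun_prop)
    _ = c * mixedNorm q q N := comp_D N
    _ ≤ c * (mixedNorm P₁ Q₁ H₁ * mixedNorm P₂ Q₂ H₂) := by
        gcongr
        exact mixedNorm_mixedNorm_mul_translate_le hH₁ hH₂ hP hQ

theorem sub_apply_eq_apply_symm {E : Type*} [NormedAddCommGroup E] [NormedSpace ℝ E]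
    {A B D : E ≃L[ℝ] E} (hD : ∀ y, A y = B y + D y) (x y : E) :
    x - B y = B (A.symm (x - A y + D (B.symm x))) := by
  have A_B_symm : A (B.symm x) = x + D (B.symm x) := by rw [hD, B.apply_symm_apply]
  rw [sub_add_eq_add_sub, ← A_B_symm, ← map_sub, A.symm_apply_apply, map_sub, B.apply_symm_apply]

theorem exists_mixedNorm_self_sheared_mul_eq (hp : 0 < p)
    (S S' T T' D D' : EuclideanSpace ℝ ι ≃L[ℝ] EuclideanSpace ℝ ι)
    (hD : ∀ η, S η = S' η + D η) (hD' : ∀ ξ, T ξ = T' ξ + D' ξ) :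
    ∃ C : ℝ≥0, ∀ H₁ H₂ : EuclideanSpace ℝ ι → EuclideanSpace ℝ ι → ℝ≥0∞,
      Measurable (Function.uncurry H₁) → Measurable (Function.uncurry H₂) → ∀ x ω,
      (mixedNorm p p fun ξ η => H₁ (x - S η) (ω - T ξ) * H₂ (x - S' η) (ω - T' ξ)) =
        C * mixedNorm p p fun a b => H₁ a b *
          H₂ (S' (S.symm (a + D (S'.symm x)))) (T' (T.symm (b + D' (T'.symm ω)))) := by
  obtain ⟨C, comp_ST⟩ := exists_mixedNorm_comp_equiv S T hp hp
  refine ⟨C, fun H₁ H₂ hH₁ hH₂ x ω => ?_⟩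
  let F := fun a b => H₁ a b *
    H₂ (S' (S.symm (a + D (S'.symm x)))) (T' (T.symm (b + D' (T'.symm ω))))
  have sheared_eq (η ξ : EuclideanSpace ℝ ι) :
      H₁ (x - S η) (ω - T ξ) * H₂ (x - S' η) (ω - T' ξ) = F (x - S η) (ω - T ξ) := by
    rw [sub_apply_eq_apply_symm hD, sub_apply_eq_apply_symm hD']
  have F_measurable : Measurable (Function.uncurry F) := by fun_prop
  simp_rw [sheared_eq]
  rw [mixedNorm_self_swap (F := fun η ξ => F (x - S η) (ω - T ξ)) hp.ne' (by fun_prop),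
    comp_ST fun a b => F (x - a) (ω - b), mixedNorm_sub_left]

theorem exists_mixedNorm_swap_sheared_mul_le
    (hP : YoungExponents p q P₁ P₂) (hQ : YoungExponents p q Q₁ Q₂)
    (S S' T T' D D' : EuclideanSpace ℝ ι ≃L[ℝ] EuclideanSpace ℝ ι)
    (hD : ∀ η, S η = S' η + D η) (hD' : ∀ ξ, T ξ = T' ξ + D' ξ) :
    ∃ C : ℝ≥0, ∀ H₁ H₂ : EuclideanSpace ℝ ι → EuclideanSpace ℝ ι → ℝ≥0∞,
      Measurable (Function.uncurry H₁) → Measurable (Function.uncurry H₂) →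
      mixedNorm p q (fun ζ z : EuclideanSpace ℝ (ι ⊕ ι) =>
        H₁ (fstL z - S (sndL ζ)) (sndL z - T (fstL ζ)) *
          H₂ (fstL z - S' (sndL ζ)) (sndL z - T' (fstL ζ))) ≤
      C * (mixedNorm P₁ Q₁ H₁ * mixedNorm P₂ Q₂ H₂) := by
  have hp := hP.pos
  have hq : 0 < q := hp.trans_le hP.le
  let U := S.symm.trans S'
  let V := T.symm.trans T'
  obtain ⟨c₁, inner_eq⟩ := exists_mixedNorm_self_sheared_mul_eq hp S S' T T' D D' hD hD'
  obtain ⟨c₂, comp_R⟩ := exists_mixedNorm_comp_equiv (S'.symm.trans D) (T'.symm.trans D') hq hq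
  obtain ⟨c₃, comp_UV⟩ := exists_mixedNorm_comp_equiv U V (hp.trans_le hP.le₂)
    (hp.trans_le hQ.le₂)
  refine ⟨c₁ * (c₂ * c₃), fun H₁ H₂ hH₁ hH₂ => ?_⟩
  let G := fun x ω => H₂ (U x) (V ω)
  have G_measurable : Measurable (Function.uncurry G) := by fun_prop
  let N u v := mixedNorm p p fun x ω => H₁ x ω * G (x + u) (ω + v)
  rw [mixedNorm_fstL_sndL (K := fun ξ η x ω => H₁ (x - S η) (ω - T ξ) * H₂ (x - S' η) (ω - T' ξ))
    hp.ne' hq.ne' (by fun_prop)]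
  simp_rw [inner_eq H₁ H₂ hH₁ hH₂]
  rw [mixedNorm_const_mul hq hq ENNReal.coe_ne_top, ENNReal.coe_mul, mul_assoc]
  gcongr
  calc _ = c₂ * mixedNorm q q N := comp_R N
    _ ≤ c₂ * (mixedNorm P₁ Q₁ H₁ * mixedNorm P₂ Q₂ G) := by
        gcongr
        exact mixedNorm_mixedNorm_mul_translate_le hH₁ G_measurable hP hQ
    _ = _ := by
        rw [comp_UV H₂, ENNReal.coe_mul]
        ring

end Shear

/-! ### Boundedness with respect to the adapted window -/

section WeightComparison

variable {ι κ : Type*} [Fintype ι] [Fintype κ]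

theorem exists_polyWeight_comp_equiv_le (s : ℝ)
    (e : EuclideanSpace ℝ κ ≃L[ℝ] EuclideanSpace ℝ κ) :
    ∃ C : ℝ, 0 ≤ C ∧ ∀ z, polyWeight s (e z) ≤ C * polyWeight s z := by
  let T : EuclideanSpace ℝ κ →L[ℝ] EuclideanSpace ℝ κ := e
  let T' : EuclideanSpace ℝ κ →L[ℝ] EuclideanSpace ℝ κ := e.symm
  have norm_le (z : EuclideanSpace ℝ κ) : ‖e z‖ ≤ (1 + ‖T‖ + ‖T'‖) * ‖z‖ :=
    T.le_of_opNorm_le (by linarith [norm_nonneg T']) z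
  have le_norm (z : EuclideanSpace ℝ κ) : ‖z‖ ≤ (1 + ‖T‖ + ‖T'‖) * ‖e z‖ := by
    simpa [T'] using T'.le_of_opNorm_le
      (by linarith [norm_nonneg T] : ‖T'‖ ≤ 1 + ‖T‖ + ‖T'‖) (e z)
  exact ⟨_, by positivity, fun z => polyWeight_le_of_norm_le s
    (by linarith [norm_nonneg T, norm_nonneg T']) (norm_le z) (le_norm z)⟩

theorem exists_polyWeight_map_add_map_le (s : ℝ)
    (A B : EuclideanSpace ℝ κ ≃L[ℝ] EuclideanSpace ℝ κ) :
    ∃ C : ℝ, 0 ≤ C ∧ ∀ z w,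
      polyWeight s (A z + B w) ≤ C * polyWeight |s| z * polyWeight s w := by
  obtain ⟨C₁, hC₁, weight_A_le⟩ := exists_polyWeight_comp_equiv_le |s| A
  obtain ⟨C₂, hC₂, weight_B_le⟩ := exists_polyWeight_comp_equiv_le s B
  refine ⟨2 ^ |s / 2| * C₁ * C₂, by positivity, fun z w => ?_⟩
  have := (polyWeight_pos |s| z).le
  have := (polyWeight_pos s (B w)).le
  calc polyWeight s (A z + B w) ≤ 2 ^ |s / 2| * polyWeight |s| (A z) * polyWeight s (B w) :=
        polyWeight_add_le s _ _
    _ ≤ 2 ^ |s / 2| * (C₁ * polyWeight |s| z) * (C₂ * polyWeight s w) := by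
        gcongr
        exacts [weight_A_le z, weight_B_le w]
    _ = _ := by ring

theorem norm_join_neg_swap (x y : EuclideanSpace ℝ ι) : ‖join (-y) x‖ = ‖join x y‖ := by
  rw [← sq_eq_sq₀ (norm_nonneg _) (norm_nonneg _), norm_join_sq, norm_join_sq, norm_neg, add_comm]

theorem polyWeight_join_sub_swap_le (s : ℝ) (x y x' y' : EuclideanSpace ℝ ι) :
    polyWeight s (join (y - y') (x' - x)) ≤
      2 ^ |s / 2| * polyWeight |s| (join x y) * polyWeight s (join x' y') := by
  have norm_eq : ‖join (y - y') (x' - x)‖ = ‖-join x y + join x' y'‖ := by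
    rw [neg_add_eq_sub, join_sub_join, ← norm_join_neg_swap (x' - x), neg_sub]
  have peetre := polyWeight_add_le s (-join x y) (join x' y')
  rw [polyWeight, ← norm_eq] at peetre
  simpa only [polyWeight, norm_neg] using peetre

/-- The automorphism `(x, y) ↦ (e x, f y)` of `ℝ^(ι ⊕ κ)`. -/
def joinMap (e : EuclideanSpace ℝ ι ≃L[ℝ] EuclideanSpace ℝ ι)
    (f : EuclideanSpace ℝ κ ≃L[ℝ] EuclideanSpace ℝ κ) :
    EuclideanSpace ℝ (ι ⊕ κ) ≃L[ℝ] EuclideanSpace ℝ (ι ⊕ κ) :=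
  joinEquiv.symm.trans ((e.prodCongr f).trans joinEquiv)

theorem joinMap_join (e : EuclideanSpace ℝ ι ≃L[ℝ] EuclideanSpace ℝ ι)
    (f : EuclideanSpace ℝ κ ≃L[ℝ] EuclideanSpace ℝ κ) (x : EuclideanSpace ℝ ι)
    (y : EuclideanSpace ℝ κ) : joinMap e f (join x y) = join (e x) (f y) := by
  have symm_join : joinEquiv.symm (join x y) = (x, y) :=
    (ContinuousLinearEquiv.symm_apply_eq _).2 (joinEquiv_apply (x, y)).symm
  simp only [joinMap, ContinuousLinearEquiv.trans_apply, symm_join,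
    ContinuousLinearEquiv.prodCongr_apply, joinEquiv_apply]

theorem sub_eq_of_apply_eq_apply_add {E : Type*} [NormedAddCommGroup E] [NormedSpace ℝ E]
    {A B : E ≃L[ℝ] E} (hAB : ∀ y, A y = B y + y) (x y : E) :
    A (x - B y) - B (x - A y) = x := by
  simp only [map_sub, hAB, map_add]
  abel

theorem exists_polyWeight_sheared_le (s : ℝ)
    {S S' T T' : EuclideanSpace ℝ ι ≃L[ℝ] EuclideanSpace ℝ ι}
    (hS : ∀ η, S η = S' η + η) (hT : ∀ ξ, T' ξ = T ξ + ξ) :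
    ∃ C : ℝ, 0 ≤ C ∧ ∀ x ω ξ η : EuclideanSpace ℝ ι, polyWeight s (join x ω) ≤
      C * polyWeight |s| (join (x - S η) (ω - T ξ)) *
        polyWeight s (join (x - S' η) (ω - T' ξ)) := by
  let neg := ContinuousLinearEquiv.neg ℝ (M := EuclideanSpace ℝ ι)
  obtain ⟨C, hC, weight_le⟩ := exists_polyWeight_map_add_map_le s
    (joinMap (S'.trans neg) T') (joinMap S (T.trans neg))
  refine ⟨C, hC, fun x ω ξ η => ?_⟩
  have join_eq_add : join x ω = joinMap (S'.trans neg) T' (join (x - S η) (ω - T ξ)) +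
      joinMap S (T.trans neg) (join (x - S' η) (ω - T' ξ)) := by
    rw [joinMap_join, joinMap_join, join_add_join]
    congr 1
    · exact (neg_add_eq_sub _ _).trans (sub_eq_of_apply_eq_apply_add hS x η) |>.symm
    · exact ((sub_eq_add_neg _ _).symm.trans (sub_eq_of_apply_eq_apply_add hT ω ξ)).symm
  rw [join_eq_add]
  exact weight_le _ _

theorem modulationNorm_le_of_weight_le (g : 𝓢(EuclideanSpace ℝ ι, ℂ)) {p q : ℝ} (hp : 0 < p)
    (hq : 0 < q) {m m' : EuclideanSpace ℝ (ι ⊕ ι) → ℝ} {C : ℝ} (hC : 0 ≤ C)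
    (h : ∀ z, m z ≤ C * m' z) (f : 𝓢'(EuclideanSpace ℝ ι, ℂ)) :
    modulationNorm g p q m f ≤ C.toNNReal * modulationNorm g p q m' f := by
  rw [modulationNorm_eq_mixedNorm g hp.le, modulationNorm_eq_mixedNorm g hp.le,
    ← mixedNorm_const_mul hp hq ENNReal.coe_ne_top]
  refine mixedNorm_mono hp.le hq.le fun x ω => ?_
  rw [mul_left_comm, ← ENNReal.ofReal, ← ENNReal.ofReal_mul hC]
  gcongr
  exact h _

theorem amalgamNorm_le_of_weight_le (g : 𝓢(EuclideanSpace ℝ ι, ℂ)) {p q : ℝ} (hp : 0 < p)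
    (hq : 0 < q) {w w' : EuclideanSpace ℝ ι → ℝ} {C : ℝ} (hC : 0 ≤ C)
    (h : ∀ z, w z ≤ C * w' z) (f : 𝓢'(EuclideanSpace ℝ ι, ℂ)) :
    amalgamNorm g p q (fun _ => 1) w f ≤ C.toNNReal * amalgamNorm g p q (fun _ => 1) w' f := by
  rw [amalgamNorm_eq_mixedNorm g hp hq.le, amalgamNorm_eq_mixedNorm g hp hq.le,
    ← mixedNorm_const_mul hp hq ENNReal.coe_ne_top]
  refine mixedNorm_mono hp.le hq.le fun ω x => ?_
  rw [mul_left_comm, ← ENNReal.ofReal, ← ENNReal.ofReal_mul hC]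
  gcongr
  simpa only [tensorWeight, mul_one] using h _

end WeightComparison

section Exponents

variable {p q p₁ p₂ : ℝ}

theorem exists_youngExponents_of_le (hp : 0 < p) (hpq : p ≤ q) (hp₁ : 0 < p₁) (hp₂ : 0 < p₂)
    (hp₁q : p₁ ≤ q) (hp₂q : p₂ ≤ q) (h : 1 / p + 1 / q ≤ 1 / p₁ + 1 / p₂) :
    ∃ P₁ P₂, YoungExponents p q P₁ P₂ ∧ p₁ ≤ P₁ ∧ p₂ ≤ P₂ := by
  rcases le_total p₁ p with hp₁p | hpp₁
  · exact ⟨p, q, ⟨hp, hpq, le_rfl, hpq, rfl⟩, hp₁p, hp₂q⟩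
  · have inv_le_inv : 1 / p₁ ≤ 1 / p := one_div_le_one_div_of_le hp hpp₁
    have inv_q_le : 1 / q ≤ 1 / p₁ := one_div_le_one_div_of_le hp₁ hp₁q
    have inv_q_pos : 0 < 1 / q := one_div_pos.2 (hp.trans_le hpq)
    have inv_P₂_pos : 0 < 1 / p + 1 / q - 1 / p₁ := by linarith
    refine ⟨p₁, 1 / (1 / p + 1 / q - 1 / p₁), ⟨hp, hpq, hpp₁, ?_, ?_⟩, le_rfl, ?_⟩
    · exact (le_one_div hp inv_P₂_pos).2 (by linarith)
    · rw [one_div_one_div]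
      ring
    · exact (le_one_div hp₂ inv_P₂_pos).2 (by linarith)

theorem exists_youngExponents_min (hp : 0 < p) (hp₁ : 0 < p₁) (hp₂ : 0 < p₂) (hp₁q : p₁ ≤ q)
    (hp₂q : p₂ ≤ q) (h : 1 / p + 1 / q ≤ 1 / p₁ + 1 / p₂) :
    ∃ P₁ P₂, YoungExponents (min p q) q P₁ P₂ ∧ p₁ ≤ P₁ ∧ p₂ ≤ P₂ := by
  refine exists_youngExponents_of_le (lt_min hp (hp₁.trans_le hp₁q)) (min_le_right p q) hp₁ hp₂
    hp₁q hp₂q ?_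
  rcases le_total p q with hpq | hqp
  · rwa [min_eq_left hpq]
  · rw [min_eq_right hqp]
    exact add_le_add (one_div_le_one_div_of_le hp₁ hp₁q) (one_div_le_one_div_of_le hp₂ hp₂q)

end Exponents

section WignerBounds

theorem mul_mul_ofReal_le {V₁ V₂ : ℝ≥0∞} {w w₁ w₂ K : ℝ} (hK : 0 ≤ K) (hw₁ : 0 ≤ w₁)
    (hw : w ≤ K * w₁ * w₂) :
    V₁ * V₂ * ENNReal.ofReal w ≤
      ENNReal.ofReal K * ((V₁ * ENNReal.ofReal w₁) * (V₂ * ENNReal.ofReal w₂)) := by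
  calc V₁ * V₂ * ENNReal.ofReal w ≤ V₁ * V₂ * ENNReal.ofReal (K * w₁ * w₂) := by gcongr
    _ = _ := by
        rw [ENNReal.ofReal_mul (by positivity), ENNReal.ofReal_mul hK]
        ring

variable {ι : Type*} [Fintype ι]

theorem exists_equiv_of_isUnit {E : Type*} [NormedAddCommGroup E] [NormedSpace ℝ E] {T : E →L[ℝ] E}
    (h : IsUnit T) : ∃ e : E ≃L[ℝ] E, ∀ x, e x = T x := by
  obtain ⟨u, rfl⟩ := h
  exact ⟨ContinuousLinearEquiv.unitsEquiv ℝ _ u, fun _ => rfl⟩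

variable [DecidableEq ι] {p q P₁ P₂ Q₁ Q₂ : ℝ}

theorem exists_modulationNorm_wignerWindow_matrixWigner_le (M : Matrix ι ι ℝ) (s : ℝ)
    (g₁ g₂ : 𝓢(EuclideanSpace ℝ ι, ℂ)) (hP : YoungExponents p q P₁ P₂)
    (hQ : YoungExponents p q Q₁ Q₂) :
    ∃ C : ℝ≥0, ∀ f₁ f₂ : 𝓢'(EuclideanSpace ℝ ι, ℂ),
      modulationNorm (wignerWindow M g₁ g₂) p q (tensorWeight (fun _ => 1) (polyWeight s))
          (matrixWigner (cohenMatrix M) f₁ f₂) ≤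
        C * (modulationNorm g₁ P₁ Q₁ (polyWeight |s|) f₁ *
          modulationNorm g₂ P₂ Q₂ (polyWeight s) f₂) := by
  have hp := hP.pos
  have hq := hp.trans_le hP.le
  obtain ⟨C, sheared_le⟩ := exists_mixedNorm_sheared_mul_le hP hQ
    (S := upperL M) (S' := lowerL M) (T := (lowerL M).adjoint) (T' := (upperL M).adjoint)
    (ContinuousLinearEquiv.refl ℝ _) (ContinuousLinearEquiv.neg ℝ) (upperL_apply_eq M)
    fun ξ => by rw [adjoint_upperL_apply_eq]; exact (add_neg_cancel_right _ ξ).symm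
  refine ⟨Real.toNNReal (2 ^ |s / 2|) * C, fun f₁ f₂ => ?_⟩
  rw [modulationNorm_eq_mixedNorm _ hp.le, modulationNorm_eq_mixedNorm g₁ (hp.le.trans hP.le₁),
    modulationNorm_eq_mixedNorm g₂ (hp.le.trans hP.le₂), ENNReal.coe_mul, mul_assoc]
  refine le_trans ?_ (mul_le_mul_right (sheared_le _ _
    (measurable_stft_mul_weight g₁ f₁ (continuous_polyWeight |s|))
    (measurable_stft_mul_weight g₂ f₂ (continuous_polyWeight s))) _)
  rw [← mixedNorm_const_mul hp hq ENNReal.coe_ne_top]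
  refine mixedNorm_mono hp.le hq.le fun z ζ => ?_
  have weight_le := polyWeight_join_sub_swap_le s (fstL z - upperL M (sndL ζ))
    (sndL z - (lowerL M).adjoint (fstL ζ)) (fstL z - lowerL M (sndL ζ))
    (sndL z - (upperL M).adjoint (fstL ζ))
  rw [sub_sub_sub_cancel_left, sub_sub_sub_cancel_left, upperL_apply_eq M (sndL ζ),
    adjoint_upperL_apply_eq M (fstL ζ), add_sub_cancel_left, add_sub_cancel_left,
    ← upperL_apply_eq, ← adjoint_upperL_apply_eq, join_fstL_sndL] at weight_le
  rw [← join_fstL_sndL z, ← join_fstL_sndL ζ, enorm_stft_matrixWigner]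
  simp only [tensorWeight, sndL_join, one_mul, join_fstL_sndL]
  exact mul_mul_ofReal_le (by positivity) (polyWeight_pos _ _).le weight_le

theorem isUnit_lowerL {M : Matrix ι ι ℝ} (hM : IsUnit (M - (1 / 2 : ℝ) • 1)) :
    IsUnit (lowerL M) :=
  hM.map (Matrix.toEuclideanCLM (𝕜 := ℝ) (n := ι))

theorem isUnit_upperL {M : Matrix ι ι ℝ} (hM : IsUnit (M + (1 / 2 : ℝ) • 1)) :
    IsUnit (upperL M) :=
  hM.map (Matrix.toEuclideanCLM (𝕜 := ℝ) (n := ι))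

theorem exists_amalgamNorm_wignerWindow_matrixWigner_le {M : Matrix ι ι ℝ}
    (hM : IsUnit (M - (1 / 2 : ℝ) • 1)) (hM' : IsUnit (M + (1 / 2 : ℝ) • 1)) (s : ℝ)
    (g₁ g₂ : 𝓢(EuclideanSpace ℝ ι, ℂ)) (hP : YoungExponents p q P₁ P₂)
    (hQ : YoungExponents p q Q₁ Q₂) :
    ∃ C : ℝ≥0, ∀ f₁ f₂ : 𝓢'(EuclideanSpace ℝ ι, ℂ),
      amalgamNorm (wignerWindow M g₁ g₂) p q (fun _ => 1) (polyWeight s)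
          (matrixWigner (cohenMatrix M) f₁ f₂) ≤
        C * (modulationNorm g₁ P₁ Q₁ (polyWeight |s|) f₁ *
          modulationNorm g₂ P₂ Q₂ (polyWeight s) f₂) := by
  have hp := hP.pos
  have hq := hp.trans_le hP.le
  obtain ⟨S, hS⟩ := exists_equiv_of_isUnit (isUnit_upperL hM')
  obtain ⟨S', hS'⟩ := exists_equiv_of_isUnit (isUnit_lowerL hM)
  obtain ⟨T, hT⟩ := exists_equiv_of_isUnit (isUnit_lowerL hM).star
  obtain ⟨T', hT'⟩ := exists_equiv_of_isUnit (isUnit_upperL hM').star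
  have S_eq (η : EuclideanSpace ℝ ι) : S η = S' η + η := by rw [hS, hS', upperL_apply_eq]
  have T'_eq (ξ : EuclideanSpace ℝ ι) : T' ξ = T ξ + ξ := by
    rw [hT, hT']; exact adjoint_upperL_apply_eq M ξ
  obtain ⟨K, hK, weight_le⟩ := exists_polyWeight_sheared_le s S_eq T'_eq
  obtain ⟨C, sheared_le⟩ := exists_mixedNorm_swap_sheared_mul_le hP hQ S S' T T'
    (ContinuousLinearEquiv.refl ℝ _) (ContinuousLinearEquiv.neg ℝ) S_eq
    fun ξ => by rw [T'_eq]; exact (add_neg_cancel_right _ ξ).symm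
  refine ⟨Real.toNNReal K * C, fun f₁ f₂ => ?_⟩
  rw [amalgamNorm_eq_mixedNorm _ hp hq.le, modulationNorm_eq_mixedNorm g₁ (hp.le.trans hP.le₁),
    modulationNorm_eq_mixedNorm g₂ (hp.le.trans hP.le₂), ENNReal.coe_mul, mul_assoc]
  refine le_trans ?_ (mul_le_mul_right (sheared_le _ _
    (measurable_stft_mul_weight g₁ f₁ (continuous_polyWeight |s|))
    (measurable_stft_mul_weight g₂ f₂ (continuous_polyWeight s))) _)
  rw [← mixedNorm_const_mul hp hq ENNReal.coe_ne_top]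
  refine mixedNorm_mono hp.le hq.le fun ζ z => ?_
  have stft_eq := enorm_stft_matrixWigner M g₁ g₂ f₁ f₂ (fstL z) (sndL z) (fstL ζ) (sndL ζ)
  rw [join_fstL_sndL, join_fstL_sndL, ← hS, ← hS', ← ContinuousLinearMap.star_eq_adjoint,
    ← ContinuousLinearMap.star_eq_adjoint, ← hT, ← hT'] at stft_eq
  rw [stft_eq, tensorWeight, fstL_join, mul_one]
  refine mul_mul_ofReal_le hK (polyWeight_pos _ _).le ?_
  rw [← join_fstL_sndL z]
  simpa only [fstL_join, sndL_join] using weight_le (fstL z) (sndL z) (fstL ζ) (sndL ζ)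

end WignerBounds

/-! ### Boundedness for arbitrary windows -/

section CohenMatrix

variable {ι : Type*} [DecidableEq ι]

theorem one_add_matrixP (M : Matrix ι ι ℝ) :
    1 + matrixP M = Matrix.fromBlocks (-(M - (1 / 2 : ℝ) • 1)) 0 0 (M + (1 / 2 : ℝ) • 1) := by
  rw [matrixP, ← Matrix.fromBlocks_one, Matrix.fromBlocks_add, add_zero]
  congr 1 <;> module

variable [Fintype ι]

theorem isRightRegular_cohenMatrix_iff (M : Matrix ι ι ℝ) :
    IsRightRegular (cohenMatrix M).val ↔
      IsUnit (M - (1 / 2 : ℝ) • 1) ∧ IsUnit (M + (1 / 2 : ℝ) • 1) :=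
  and_comm

theorem isUnit_matrixP_iff (M : Matrix ι ι ℝ) :
    IsUnit (matrixP M) ↔ IsUnit (M - (1 / 2 : ℝ) • 1) ∧ IsUnit (M + (1 / 2 : ℝ) • 1) := by
  rw [matrixP, Matrix.isUnit_fromBlocks_zero₂₁, IsUnit.neg_iff, and_comm]

theorem isUnit_one_add_matrixP_inv {M : Matrix ι ι ℝ} (hM : IsUnit (M - (1 / 2 : ℝ) • 1))
    (hM' : IsUnit (M + (1 / 2 : ℝ) • 1)) : IsUnit (1 + (matrixP M)⁻¹) := by
  have hP : IsUnit (matrixP M) := (isUnit_matrixP_iff M).2 ⟨hM, hM'⟩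
  have mul_eq : matrixP M * (1 + (matrixP M)⁻¹) = 1 + matrixP M := by
    rw [mul_add, mul_one, Matrix.mul_nonsing_inv _ ((Matrix.isUnit_iff_isUnit_det _).1 hP),
      add_comm]
  rw [← hP.mul_left_iff, mul_eq, one_add_matrixP, Matrix.isUnit_fromBlocks_zero₂₁,
    IsUnit.neg_iff]
  exact ⟨hM, hM'⟩

theorem constC_pos {M : Matrix ι ι ℝ} (hM : IsUnit (M - (1 / 2 : ℝ) • 1))
    (hM' : IsUnit (M + (1 / 2 : ℝ) • 1)) : 0 < constC M :=
  abs_pos.2 (mul_ne_zero ((Matrix.isUnit_iff_isUnit_det _).1 hM').ne_zero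
    ((Matrix.isUnit_iff_isUnit_det _).1 hM).ne_zero)

theorem exists_polyWeightM_le_and_le {M : Matrix ι ι ℝ} (hM : IsUnit (M - (1 / 2 : ℝ) • 1))
    (hM' : IsUnit (M + (1 / 2 : ℝ) • 1)) (s : ℝ) :
    ∃ C : ℝ, 0 ≤ C ∧ (∀ z, polyWeightM s M z ≤ C * polyWeight s z) ∧
      ∀ z, polyWeight s z ≤ C * polyWeightM s M z := by
  have isUnit_inv : IsUnit (1 + (matrixP M)⁻¹)⁻¹ :=
    Matrix.isUnit_nonsing_inv_iff.2 (isUnit_one_add_matrixP_inv hM hM')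
  obtain ⟨e, he⟩ := exists_equiv_of_isUnit
    (isUnit_inv.map (Matrix.toEuclideanCLM (𝕜 := ℝ) (n := ι ⊕ ι)))
  have polyWeightM_eq (z) : polyWeightM s M z = polyWeight s (e z) := by rw [he, polyWeightM]
  obtain ⟨C₁, hC₁, le₁⟩ := exists_polyWeight_comp_equiv_le s e
  obtain ⟨C₂, -, le₂⟩ := exists_polyWeight_comp_equiv_le s e.symm
  refine ⟨max C₁ C₂, hC₁.trans (le_max_left _ _), fun z => ?_, fun z => ?_⟩
  · rw [polyWeightM_eq]
    exact (le₁ z).trans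
      (mul_le_mul_of_nonneg_right (le_max_left _ _) (polyWeight_pos s z).le)
  · rw [polyWeightM_eq]
    refine le_trans ?_
      (mul_le_mul_of_nonneg_right (le_max_right C₁ C₂) (polyWeight_pos s (e z)).le)
    simpa only [ContinuousLinearEquiv.symm_apply_apply] using le₂ (e z)

end CohenMatrix

section Boundedness

variable {ι : Type*} [Fintype ι] {p₁ p₂ q₁ q₂ p q : ℝ}

theorem exists_youngExponents_modulationNorm_mul_le
    (hp₁ : 1 ≤ p₁) (hp₂ : 1 ≤ p₂) (hq₁ : 1 ≤ q₁) (hq₂ : 1 ≤ q₂) (hp : 0 < p)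
    (hp₁q : p₁ ≤ q) (hp₂q : p₂ ≤ q) (hq₁q : q₁ ≤ q) (hq₂q : q₂ ≤ q)
    (hpp : 1 / p + 1 / q ≤ 1 / p₁ + 1 / p₂) (hqq : 1 / p + 1 / q ≤ 1 / q₁ + 1 / q₂)
    {g₁ g₂ : 𝓢(EuclideanSpace ℝ ι, ℂ)} (hg₁ : g₁ ≠ 0) (hg₂ : g₂ ≠ 0)
    {m₁ m₂ : EuclideanSpace ℝ (ι ⊕ ι) → ℝ} (hm₁ : IsModerate m₁) (hm₂ : IsModerate m₂) :
    ∃ P₁ P₂ Q₁ Q₂ : ℝ, YoungExponents (min p q) q P₁ P₂ ∧ YoungExponents (min p q) q Q₁ Q₂ ∧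
      ∃ C : ℝ≥0, ∀ f₁ f₂ : 𝓢'(EuclideanSpace ℝ ι, ℂ),
        modulationNorm g₁ P₁ Q₁ m₁ f₁ * modulationNorm g₂ P₂ Q₂ m₂ f₂ ≤
          C * (modulationNorm g₁ p₁ q₁ m₁ f₁ * modulationNorm g₂ p₂ q₂ m₂ f₂) := by
  obtain ⟨P₁, P₂, hP, hP₁, hP₂⟩ := exists_youngExponents_min hp (by linarith) (by linarith)
    hp₁q hp₂q hpp
  obtain ⟨Q₁, Q₂, hQ, hQ₁, hQ₂⟩ := exists_youngExponents_min hp (by linarith) (by linarith)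
    hq₁q hq₂q hqq
  obtain ⟨C₁, norm₁_le⟩ := exists_modulationNorm_le hg₁ g₁ hm₁ hp₁ hq₁ hP₁ hQ₁
  obtain ⟨C₂, norm₂_le⟩ := exists_modulationNorm_le hg₂ g₂ hm₂ hp₂ hq₂ hP₂ hQ₂
  refine ⟨P₁, P₂, Q₁, Q₂, hP, hQ, C₁ * C₂, fun f₁ f₂ =>
    (mul_le_mul' (norm₁_le f₁) (norm₂_le f₂)).trans_eq ?_⟩
  rw [ENNReal.coe_mul, mul_mul_mul_comm]

variable [DecidableEq ι] {M : Matrix ι ι ℝ} {g₁ g₂ : 𝓢(EuclideanSpace ℝ ι, ℂ)}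

theorem exists_modulationNorm_matrixWigner_le (s : ℝ)
    (hp₁ : 1 ≤ p₁) (hp₂ : 1 ≤ p₂) (hq₁ : 1 ≤ q₁) (hq₂ : 1 ≤ q₂) (hp : 1 ≤ p)
    (hp₁q : p₁ ≤ q) (hp₂q : p₂ ≤ q) (hq₁q : q₁ ≤ q) (hq₂q : q₂ ≤ q)
    (hpp : 1 / p + 1 / q ≤ 1 / p₁ + 1 / p₂) (hqq : 1 / p + 1 / q ≤ 1 / q₁ + 1 / q₂)
    (hg₁ : g₁ ≠ 0) (hg₂ : g₂ ≠ 0) (Φ : 𝓢(EuclideanSpace ℝ (ι ⊕ ι), ℂ)) :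
    ∃ C : ℝ≥0, ∀ f₁ f₂ : 𝓢'(EuclideanSpace ℝ ι, ℂ),
      modulationNorm Φ p q (tensorWeight (fun _ => 1) (polyWeight s))
          (matrixWigner (cohenMatrix M) f₁ f₂) ≤
        C * modulationNorm g₁ p₁ q₁ (polyWeight |s|) f₁ *
          modulationNorm g₂ p₂ q₂ (polyWeight s) f₂ := by
  have hq : 1 ≤ q := hp₁.trans hp₁q
  obtain ⟨P₁, P₂, Q₁, Q₂, hP, hQ, C₁, inclusion⟩ := exists_youngExponents_modulationNorm_mul_le
    hp₁ hp₂ hq₁ hq₂ (by linarith) hp₁q hp₂q hq₁q hq₂q hpp hqq hg₁ hg₂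
    (isModerate_polyWeight |s|) (isModerate_polyWeight s)
  obtain ⟨C₂, adapted_bound⟩ := exists_modulationNorm_wignerWindow_matrixWigner_le M s g₁ g₂ hP hQ
  obtain ⟨C₃, window_change⟩ := exists_modulationNorm_le (wignerWindow_ne_zero M hg₁ hg₂) Φ
    (isModerate_one.tensorWeight (isModerate_polyWeight s)) (le_min hp hq) hq
    (min_le_left p q) le_rfl
  refine ⟨C₃ * (C₂ * C₁), fun f₁ f₂ => ?_⟩
  calc modulationNorm Φ p q (tensorWeight (fun _ => 1) (polyWeight s))
        (matrixWigner (cohenMatrix M) f₁ f₂)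
    _ ≤ C₃ * modulationNorm (wignerWindow M g₁ g₂) (min p q) q
          (tensorWeight (fun _ => 1) (polyWeight s)) (matrixWigner (cohenMatrix M) f₁ f₂) :=
        window_change _
    _ ≤ C₃ * (C₂ * (modulationNorm g₁ P₁ Q₁ (polyWeight |s|) f₁ *
          modulationNorm g₂ P₂ Q₂ (polyWeight s) f₂)) := by grw [adapted_bound f₁ f₂]
    _ ≤ C₃ * (C₂ * (C₁ * (modulationNorm g₁ p₁ q₁ (polyWeight |s|) f₁ *
          modulationNorm g₂ p₂ q₂ (polyWeight s) f₂))) := by grw [inclusion f₁ f₂]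
    _ = _ := by simp only [ENNReal.coe_mul, mul_assoc]

theorem exists_amalgamNorm_polyWeight_matrixWigner_le (s : ℝ)
    (hM : IsUnit (M - (1 / 2 : ℝ) • 1)) (hM' : IsUnit (M + (1 / 2 : ℝ) • 1))
    (hp₁ : 1 ≤ p₁) (hp₂ : 1 ≤ p₂) (hq₁ : 1 ≤ q₁) (hq₂ : 1 ≤ q₂) (hp : 1 ≤ p)
    (hp₁q : p₁ ≤ q) (hp₂q : p₂ ≤ q) (hq₁q : q₁ ≤ q) (hq₂q : q₂ ≤ q)
    (hpp : 1 / p + 1 / q ≤ 1 / p₁ + 1 / p₂) (hqq : 1 / p + 1 / q ≤ 1 / q₁ + 1 / q₂)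
    (hg₁ : g₁ ≠ 0) (hg₂ : g₂ ≠ 0) (Φ : 𝓢(EuclideanSpace ℝ (ι ⊕ ι), ℂ)) :
    ∃ C : ℝ≥0, ∀ f₁ f₂ : 𝓢'(EuclideanSpace ℝ ι, ℂ),
      amalgamNorm Φ p q (fun _ => 1) (polyWeight s) (matrixWigner (cohenMatrix M) f₁ f₂) ≤
        C * (modulationNorm g₁ p₁ q₁ (polyWeight |s|) f₁ *
          modulationNorm g₂ p₂ q₂ (polyWeight s) f₂) := by
  have hq : 1 ≤ q := hp₁.trans hp₁q
  obtain ⟨P₁, P₂, Q₁, Q₂, hP, hQ, C₁, inclusion⟩ := exists_youngExponents_modulationNorm_mul_le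
    hp₁ hp₂ hq₁ hq₂ (by linarith) hp₁q hp₂q hq₁q hq₂q hpp hqq hg₁ hg₂
    (isModerate_polyWeight |s|) (isModerate_polyWeight s)
  obtain ⟨C₂, adapted_bound⟩ :=
    exists_amalgamNorm_wignerWindow_matrixWigner_le hM hM' s g₁ g₂ hP hQ
  obtain ⟨C₃, window_change⟩ := exists_amalgamNorm_le (wignerWindow_ne_zero M hg₁ hg₂) Φ
    (isModerate_polyWeight s) (le_min hp hq) hq (min_le_left p q) le_rfl
  refine ⟨C₃ * (C₂ * C₁), fun f₁ f₂ => ?_⟩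
  calc amalgamNorm Φ p q (fun _ => 1) (polyWeight s) (matrixWigner (cohenMatrix M) f₁ f₂)
    _ ≤ C₃ * amalgamNorm (wignerWindow M g₁ g₂) (min p q) q (fun _ => 1) (polyWeight s)
          (matrixWigner (cohenMatrix M) f₁ f₂) := window_change _
    _ ≤ C₃ * (C₂ * (modulationNorm g₁ P₁ Q₁ (polyWeight |s|) f₁ *
          modulationNorm g₂ P₂ Q₂ (polyWeight s) f₂)) := by grw [adapted_bound f₁ f₂]
    _ ≤ C₃ * (C₂ * (C₁ * (modulationNorm g₁ p₁ q₁ (polyWeight |s|) f₁ *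
          modulationNorm g₂ p₂ q₂ (polyWeight s) f₂))) := by grw [inclusion f₁ f₂]
    _ = _ := by simp only [ENNReal.coe_mul, mul_assoc]

theorem exists_amalgamNorm_polyWeightM_matrixWigner_le (s : ℝ)
    (hM : IsUnit (M - (1 / 2 : ℝ) • 1)) (hM' : IsUnit (M + (1 / 2 : ℝ) • 1))
    (hp₁ : 1 ≤ p₁) (hp₂ : 1 ≤ p₂) (hq₁ : 1 ≤ q₁) (hq₂ : 1 ≤ q₂) (hp : 1 ≤ p)
    (hp₁q : p₁ ≤ q) (hp₂q : p₂ ≤ q) (hq₁q : q₁ ≤ q) (hq₂q : q₂ ≤ q)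
    (hpp : 1 / p + 1 / q ≤ 1 / p₁ + 1 / p₂) (hqq : 1 / p + 1 / q ≤ 1 / q₁ + 1 / q₂)
    (hg₁ : g₁ ≠ 0) (hg₂ : g₂ ≠ 0) (Φ : 𝓢(EuclideanSpace ℝ (ι ⊕ ι), ℂ)) :
    ∃ C : ℝ≥0, ∀ f₁ f₂ : 𝓢'(EuclideanSpace ℝ ι, ℂ),
      amalgamNorm Φ p q (fun _ => 1) (polyWeightM s M) (matrixWigner (cohenMatrix M) f₁ f₂) ≤
        C * ENNReal.ofReal (constC M ^ (1 / q - 1 / p)) *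
          modulationNorm g₁ p₁ q₁ (polyWeight |s|) f₁ *
          modulationNorm g₂ p₂ q₂ (polyWeightM s M) f₂ := by
  obtain ⟨C, bound⟩ := exists_amalgamNorm_polyWeight_matrixWigner_le s hM hM' hp₁ hp₂ hq₁ hq₂ hp
    hp₁q hp₂q hq₁q hq₂q hpp hqq hg₁ hg₂ Φ
  obtain ⟨K, hK, polyWeightM_le, le_polyWeightM⟩ := exists_polyWeightM_le_and_le hM hM' s
  have hc : 0 < constC M ^ (1 / q - 1 / p) := Real.rpow_pos_of_pos (constC_pos hM hM') _
  set c := constC M ^ (1 / q - 1 / p)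
  have inv_mul_cancel : (c.toNNReal⁻¹ : ℝ≥0) * ENNReal.ofReal c = 1 := by
    rw [ENNReal.ofReal, ← ENNReal.coe_mul, inv_mul_cancel₀ (Real.toNNReal_pos.2 hc).ne',
      ENNReal.coe_one]
  refine ⟨K.toNNReal * C * K.toNNReal * c.toNNReal⁻¹, fun f₁ f₂ => ?_⟩
  calc amalgamNorm Φ p q (fun _ => 1) (polyWeightM s M) (matrixWigner (cohenMatrix M) f₁ f₂)
    _ ≤ K.toNNReal *
          amalgamNorm Φ p q (fun _ => 1) (polyWeight s) (matrixWigner (cohenMatrix M) f₁ f₂) :=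
        amalgamNorm_le_of_weight_le Φ (by linarith) (by linarith) hK polyWeightM_le _
    _ ≤ K.toNNReal * (C * (modulationNorm g₁ p₁ q₁ (polyWeight |s|) f₁ *
          (K.toNNReal * modulationNorm g₂ p₂ q₂ (polyWeightM s M) f₂))) := by
        grw [bound f₁ f₂, modulationNorm_le_of_weight_le g₂ (by linarith) (by linarith) hK
          le_polyWeightM f₂]
    _ = K.toNNReal * C * K.toNNReal * ((c.toNNReal⁻¹ : ℝ≥0) * ENNReal.ofReal c) *
          modulationNorm g₁ p₁ q₁ (polyWeight |s|) f₁ *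
          modulationNorm g₂ p₂ q₂ (polyWeightM s M) f₂ := by rw [inv_mul_cancel]; ring
    _ = _ := by push_cast; ring

end Boundedness

end

end MWD

theorem mainTheorem5 (d : ℕ) (M : Matrix (Fin d) (Fin d) ℝ) (s p₁ p₂ q₁ q₂ p q : ℝ)
    (hp₁ : 1 ≤ p₁) (hp₂ : 1 ≤ p₂) (hq₁ : 1 ≤ q₁) (hq₂ : 1 ≤ q₂) (hp : 1 ≤ p) (hq : 1 ≤ q)
    (hp₁q : p₁ ≤ q) (hp₂q : p₂ ≤ q) (hq₁q : q₁ ≤ q) (hq₂q : q₂ ≤ q)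
    (hpp : 1 / p + 1 / q ≤ 1 / p₁ + 1 / p₂) (hqq : 1 / p + 1 / q ≤ 1 / q₁ + 1 / q₂)
    (g₁ g₂ : 𝓢(EuclideanSpace ℝ (Fin d), ℂ)) (hg₁ : g₁ ≠ 0) (hg₂ : g₂ ≠ 0)
    (Φ : 𝓢(EuclideanSpace ℝ (Fin d ⊕ Fin d), ℂ)) (hΦ : Φ ≠ 0) :
    (∃ C : ℝ≥0, ∀ f₁ f₂ : 𝓢'(EuclideanSpace ℝ (Fin d), ℂ),
      MWD.MemModulation g₁ p₁ q₁ (MWD.polyWeight |s|) f₁ →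
      MWD.MemModulation g₂ p₂ q₂ (MWD.polyWeight s) f₂ →
      MWD.MemModulation Φ p q (MWD.tensorWeight (fun _ => 1) (MWD.polyWeight s))
          (MWD.matrixWigner (MWD.cohenMatrix M) f₁ f₂) ∧
        MWD.modulationNorm Φ p q (MWD.tensorWeight (fun _ => 1) (MWD.polyWeight s))
            (MWD.matrixWigner (MWD.cohenMatrix M) f₁ f₂) ≤
          C * MWD.modulationNorm g₁ p₁ q₁ (MWD.polyWeight |s|) f₁ *
            MWD.modulationNorm g₂ p₂ q₂ (MWD.polyWeight s) f₂) ∧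
    ((IsUnit (M - (1 / 2 : ℝ) • 1) ∧ IsUnit (M + (1 / 2 : ℝ) • 1)) ↔
      MWD.IsRightRegular (MWD.cohenMatrix M).val) ∧
    ((IsUnit (M - (1 / 2 : ℝ) • 1) ∧ IsUnit (M + (1 / 2 : ℝ) • 1)) ↔
      IsUnit (MWD.matrixP M)) ∧
    (IsUnit (M - (1 / 2 : ℝ) • 1) → IsUnit (M + (1 / 2 : ℝ) • 1) →
      IsUnit (1 + (MWD.matrixP M)⁻¹) ∧ 0 < MWD.constC M ∧
      ∃ C : ℝ≥0, ∀ f₁ f₂ : 𝓢'(EuclideanSpace ℝ (Fin d), ℂ),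
        MWD.MemModulation g₁ p₁ q₁ (MWD.polyWeight |s|) f₁ →
        MWD.MemModulation g₂ p₂ q₂ (MWD.polyWeightM s M) f₂ →
        MWD.MemAmalgam Φ p q (fun _ => 1) (MWD.polyWeightM s M)
            (MWD.matrixWigner (MWD.cohenMatrix M) f₁ f₂) ∧
          MWD.amalgamNorm Φ p q (fun _ => 1) (MWD.polyWeightM s M)
              (MWD.matrixWigner (MWD.cohenMatrix M) f₁ f₂) ≤
            C * ENNReal.ofReal (MWD.constC M ^ (1 / q - 1 / p)) *
              MWD.modulationNorm g₁ p₁ q₁ (MWD.polyWeight |s|) f₁ *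
              MWD.modulationNorm g₂ p₂ q₂ (MWD.polyWeightM s M) f₂) := by
  refine ⟨?_, (MWD.isRightRegular_cohenMatrix_iff M).symm, (MWD.isUnit_matrixP_iff M).symm,
    fun hM hM' => ⟨MWD.isUnit_one_add_matrixP_inv hM hM', MWD.constC_pos hM hM', ?_⟩⟩
  · obtain ⟨C, bound⟩ := MWD.exists_modulationNorm_matrixWigner_le (M := M) s hp₁ hp₂ hq₁ hq₂ hp
      hp₁q hp₂q hq₁q hq₂q hpp hqq hg₁ hg₂ Φ
    exact ⟨C, fun f₁ f₂ hf₁ hf₂ => ⟨(bound f₁ f₂).trans_lt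
      (ENNReal.mul_lt_top (ENNReal.mul_lt_top ENNReal.coe_lt_top hf₁) hf₂), bound f₁ f₂⟩⟩
  · obtain ⟨C, bound⟩ := MWD.exists_amalgamNorm_polyWeightM_matrixWigner_le s hM hM' hp₁ hp₂ hq₁
      hq₂ hp hp₁q hp₂q hq₁q hq₂q hpp hqq hg₁ hg₂ Φ
    exact ⟨C, fun f₁ f₂ hf₁ hf₂ => ⟨(bound f₁ f₂).trans_lt (ENNReal.mul_lt_top
      (ENNReal.mul_lt_top (ENNReal.mul_lt_top ENNReal.coe_lt_top ENNReal.ofReal_lt_top) hf₁) hf₂),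
      bound f₁ f₂⟩⟩
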